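/- All graphs are finite, undirected and loopless, and may have parallel edges. For a graph $G$, $X\subseteq V(G)$ and $u,v\in V(G)$, let $d(X)$ be the number of edges with exactly one endpoint in $X$ and $e(u,v)$ the number of edges between $u$ and $v$; $\delta(X)$ (the set of edges counted by $d(X)$) is an edge-cut if $|X|,|V(G)\setminus X|\ge 1$, and an internal edge-cut if $|X|,|V(G)\setminus X|\ge 2$; it separates two vertices if exactly one of them is in $X$. Splitting off two distinct edges $xy,yz$ (at $y$) means deleting them and adding a new edge $xz$. A graph $G$ with distinct roots $x_0,x_1$ has a rooted immersion of a graph $H$ with distinct roots $y_0,y_1$ if some sequence of splittings and (vertex and edge) deletions transforms $G$ into a graph isomorphic to $H$ by an isomorphism that maps $x_i$ to $y_i$ for $i=0,1$. For $m\ge 2$ let $D_m$ be the graph on four vertices $x_0,x_1,y_0,y_1$ with roots $x_0,x_1$, with $m-2$ parallel edges between $x_0$ and $x_1$ and exactly one edge between every other pair of vertices. Let $G$ be a connected graph with distinct roots $x_0,x_1$. - $\lambda_s(G)$ is the minimum size of an edge-cut separating $x_0$ and $x_1$; $\lambda_n(G)$ and $\lambda_n^i(G)$ are the minimum sizes of an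 edge-cut, respectively an internal edge-cut, not separating $x_0$ and $x_1$. - $G$ has type $A_m$ if there are sets $X_1\subset X_2\subset\dots\subset X_k$ ($k\ge 1$) of vertices with $|X_{i+1}\setminus X_i|=1$ for $1\le i<k$ and $d(X_i)=m$ for $1\le i\le k$, such that $x_0\in X_1$, $|X_1|\le 2$, $x_1\in V(G)\setminus X_k$ and $|V(G)\setminus X_k|\le 2$. - For the vertex set $C$ of a component of $G\setminus\{x_0,x_1\}$, the graph obtained from the induced subgraph $G[C\cup\{x_0,x_1\}]$ by deleting all edges between $x_0$ and $x_1$ is called a lobe of $G$. $G$ has type $B_m$ if every lobe $L$ is obtained from a path from $x_0$ to $x_1$ by replacing each edge by $n_L$ parallel edges, for some $n_L\ge 2$, with $n_L=2$ whenever $|V(L)|\ge 4$, and $e(x_0,x_1)+\sum_L n_L=m+1$, the sum being over all lobes $L$ of $G$. **Theorem.** Let $m\ge 2$ and let $G$ be a connected graph with distinct roots $x_0,x_1$ and $|V(G)|\ge 4$. Assume that $\lambda_n(G)\ge 3$, $\lambda_n^i(G)\ge 4$ and $\lambda_s(G)\ge m$. Then $G$ has no rooted immersion of $D_m$ if and only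 if $G$ has type $A_m$ or type $B_m$. -/

import Mathlib

/-
Graphs are finite loopless multigraphs, modelled by Mathlib's `Graph α β` (vertex set `V(G)`,
edge set `E(G)`, and `G.IsLink e x y` for "`e` is an edge with ends `x` and `y`").
Finiteness, looplessness, connectedness and the choice of two roots are collected
in `Graph.IsRootedGraph`.
-/

namespace Graph

section Basic

variable {α : Type*} {β : Type*}

/-- `δ_G(X)`: the set of edges with exactly one end in `X`. -/
def edgeCut (G : Graph α β) (X : Set α) : Set β :=
  {e | ∃ x ∈ X, ∃ y ∉ X, G.IsLink e x y}

/-- `d_G(X) = |δ_G(X)|`. -/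
noncomputable def cutSize (G : Graph α β) (X : Set α) : ℕ :=
  (G.edgeCut X).ncard

/-- `E_G(u, v)`: the set of edges between `u` and `v`. -/
def edgesBetween (G : Graph α β) (u v : α) : Set β :=
  {e | G.IsLink e u v}

/-- `e_G(u, v) = |E_G(u, v)|`. -/
noncomputable def edgeMult (G : Graph α β) (u v : α) : ℕ :=
  (G.edgesBetween u v).ncard

/-- There is a walk from `u` to `v` in `G`. -/
def Reaches (G : Graph α β) (u v : α) : Prop :=
  Relation.ReflTransGen G.Adj u v

/-- `G` is nonempty and any two of its vertices are joined by a walk. -/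
def IsConnected (G : Graph α β) : Prop :=
  V(G).Nonempty ∧ ∀ u ∈ V(G), ∀ v ∈ V(G), G.Reaches u v

/-- `C` is the vertex set of a connected component of `G`. -/
def IsComponent (G : Graph α β) (C : Set α) : Prop :=
  ∃ v ∈ V(G), C = {w | G.Reaches v w}

/-- `G` is a finite, loopless, connected graph with two distinct root vertices `x₀`, `x₁`. -/
structure IsRootedGraph (G : Graph α β) (x₀ x₁ : α) : Prop where
  finite_vertexSet : V(G).Finite
  finite_edgeSet : E(G).Finite
  loopless : G.Loopless
  connected : G.IsConnected
  mem₀ : x₀ ∈ V(G)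
  mem₁ : x₁ ∈ V(G)
  ne : x₀ ≠ x₁

/-! ### Edge cuts and the roots -/

/-- `δ_G(X)` is an edge-cut: `X` is a nonempty proper subset of `V(G)`. -/
def IsCutSide (G : Graph α β) (X : Set α) : Prop :=
  X ⊆ V(G) ∧ 1 ≤ X.encard ∧ 1 ≤ (V(G) \ X).encard

/-- `δ_G(X)` is an internal edge-cut: both sides have at least two vertices. -/
def IsInternalCutSide (G : Graph α β) (X : Set α) : Prop :=
  X ⊆ V(G) ∧ 2 ≤ X.encard ∧ 2 ≤ (V(G) \ X).encard

/-- Exactly one of `x₀`, `x₁` belongs to `X`. -/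
def Separates (X : Set α) (x₀ x₁ : α) : Prop :=
  ¬ (x₀ ∈ X ↔ x₁ ∈ X)

/-- `λ_s(G)`: the minimum size of an edge-cut separating `x₀` and `x₁`. -/
noncomputable def lambdaS (G : Graph α β) (x₀ x₁ : α) : ℕ∞ :=
  ⨅ (X : Set α) (_ : G.IsCutSide X ∧ Separates X x₀ x₁), (G.cutSize X : ℕ∞)

/-- `λ_n(G)`: the minimum size of an edge-cut not separating `x₀` and `x₁`
(`⊤` if there is no such edge-cut). -/
noncomputable def lambdaN (G : Graph α β) (x₀ x₁ : α) : ℕ∞ :=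
  ⨅ (X : Set α) (_ : G.IsCutSide X ∧ ¬ Separates X x₀ x₁), (G.cutSize X : ℕ∞)

/-- `λ_n^i(G)`: the minimum size of an internal edge-cut not separating `x₀` and `x₁`
(`⊤` if there is no such edge-cut). -/
noncomputable def lambdaNI (G : Graph α β) (x₀ x₁ : α) : ℕ∞ :=
  ⨅ (X : Set α) (_ : G.IsInternalCutSide X ∧ ¬ Separates X x₀ x₁), (G.cutSize X : ℕ∞)

/-! ### Splitting and rooted immersion -/

/-- Splitting off the edges `e = xy` and `f = yz` at `y`: both are deleted and a new edge `xz`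
is added. The new edge reuses the name `e`. -/
def splitOff (G : Graph α β) {e f : β} {x y z : α}
    (he : G.IsLink e x y) (hf : G.IsLink f y z) : Graph α β where
  vertexSet := V(G)
  IsLink g u v := (g = e ∧ s(u, v) = s(x, z)) ∨ (g ≠ e ∧ g ≠ f ∧ G.IsLink g u v)
  isLink_symm := by
    intro g _
    refine ⟨fun u v h ↦ ?_⟩
    rcases h with ⟨h₁, h₂⟩ | ⟨h₁, h₂, h₃⟩
    · exact Or.inl ⟨h₁, by rw [Sym2.eq_swap, h₂]⟩
    · exact Or.inr ⟨h₁, h₂, h₃.symm⟩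
  eq_or_eq_of_isLink_of_isLink := by
    rintro g a b c d (⟨h₁, h₂⟩ | ⟨h₁, h₂, h₃⟩) (⟨k₁, k₂⟩ | ⟨k₁, k₂, k₃⟩)
    · have := h₂.trans k₂.symm
      rw [Sym2.eq_iff] at this
      tauto
    · exact absurd h₁ k₁
    · exact absurd k₁ h₁
    · exact h₃.left_eq_or_eq k₃
  left_mem_of_isLink := by
    rintro g u v (⟨-, h₂⟩ | ⟨-, -, h₃⟩)
    · rw [Sym2.eq_iff] at h₂
      rcases h₂ with ⟨rfl, -⟩ | ⟨rfl, -⟩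
      · exact he.left_mem
      · exact hf.right_mem
    · exact h₃.left_mem

/-- One step of a sequence of splits and deletions. Splits are only made when the new edge
is not a loop; a deletion removes any set of vertices and edges, i.e. passes to a subgraph. -/
inductive ImmersionStep : Graph α β → Graph α β → Prop
  | split {G : Graph α β} {e f : β} {x y z : α} (he : G.IsLink e x y) (hf : G.IsLink f y z)
      (hef : e ≠ f) (hxz : x ≠ z) : ImmersionStep G (G.splitOff he hf)
  | delete {G H : Graph α β} (h : H ≤ G) : ImmersionStep G H

/-- There is an isomorphism from `G` to `H` that maps the vertices `x₀`, `x₁` of `G`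
to `y₀`, `y₁` respectively. -/
def RootedIso {α' : Type*} {β' : Type*} (G : Graph α β) (x₀ x₁ : α)
    (H : Graph α' β') (y₀ y₁ : α') : Prop :=
  ∃ (φ : V(G) ≃ V(H)) (ψ : E(G) ≃ E(H)),
    (∀ (e : E(G)) (u v : V(G)), G.IsLink e u v ↔ H.IsLink (ψ e) (φ u) (φ v)) ∧
    (∃ h₀ : x₀ ∈ V(G), (φ ⟨x₀, h₀⟩ : α') = y₀) ∧
    (∃ h₁ : x₁ ∈ V(G), (φ ⟨x₁, h₁⟩ : α') = y₁)

/-- `(G; x₀, x₁)` contains `(H; y₀, y₁)` as a rooted immersion: some sequence of splits and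
deletions transforms `G` into a graph isomorphic to `H` by an isomorphism mapping `xᵢ` to `yᵢ`. -/
def HasRootedImmersion {α' : Type*} {β' : Type*} (G : Graph α β) (x₀ x₁ : α)
    (H : Graph α' β') (y₀ y₁ : α') : Prop :=
  ∃ G' : Graph α β, Relation.ReflTransGen ImmersionStep G G' ∧ RootedIso G' x₀ x₁ H y₀ y₁

/-! ### Segmentations and type `A_m` -/

/-- `X 0 ⊂ X 1 ⊂ ⋯ ⊂ X k` is a segmentation of `G` relative to `(A, B)`. -/
structure IsSegmentation (G : Graph α β) (A B : Set α) {k : ℕ} (X : Fin (k + 1) → Set α) :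
    Prop where
  subset : ∀ i, X i ⊆ V(G)
  disjoint : Disjoint A B
  head_eq : X 0 = A
  tail_eq : V(G) \ X (Fin.last k) = B
  ssubset : ∀ i : Fin k, X i.castSucc ⊂ X i.succ
  step : ∀ i : Fin k, (X i.succ \ X i.castSucc).encard = 1

/-- `G` has a segmentation of width `w` relative to `(A, B)`. -/
def HasSegmentation (G : Graph α β) (w : ℕ) (A B : Set α) : Prop :=
  ∃ (k : ℕ) (X : Fin (k + 1) → Set α), G.IsSegmentation A B X ∧ ∀ i, G.cutSize (X i) = w

/-- Type `A_m`. -/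
def IsTypeA (G : Graph α β) (x₀ x₁ : α) (m : ℕ) : Prop :=
  ∃ A B : Set α, A.encard ≤ 2 ∧ B.encard ≤ 2 ∧ x₀ ∈ A ∧ x₁ ∈ B ∧ G.HasSegmentation m A B

/-! ### Lobes and type `B_m` -/

/-- The lobe `G[C ∪ {x₀, x₁}] ∖ E(x₀, x₁)`, where `C` is a component of `G ∖ {x₀, x₁}`. -/
def lobe (G : Graph α β) (x₀ x₁ : α) (C : Set α) : Graph α β :=
  (G.induce (C ∪ {x₀, x₁})).deleteEdges (G.edgesBetween x₀ x₁)

/-- `L` consists of an `x₀`–`x₁` path `p 0, p 1, …, p ℓ` in which every edge has been replaced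
by exactly `n` parallel copies. -/
def IsMultipliedPath (L : Graph α β) (x₀ x₁ : α) (n : ℕ) : Prop :=
  ∃ (ℓ : ℕ) (p : Fin (ℓ + 1) → α), Function.Injective p ∧ p 0 = x₀ ∧ p (Fin.last ℓ) = x₁ ∧
    Set.range p = V(L) ∧
    ∀ i j : Fin (ℓ + 1), L.edgeMult (p i) (p j) =
      if (i : ℕ) + 1 = j ∨ (j : ℕ) + 1 = i then n else 0

/-- Type `B_m`. The lobes correspond to the components `C` of `G ∖ {x₀, x₁}`, and `n C` is the
edge multiplicity of the lobe of `C`. -/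
def IsTypeB (G : Graph α β) (x₀ x₁ : α) (m : ℕ) : Prop :=
  ∃ n : Set α → ℕ,
    (∀ C, (G.deleteVerts {x₀, x₁}).IsComponent C →
      2 ≤ n C ∧ (G.lobe x₀ x₁ C).IsMultipliedPath x₀ x₁ (n C) ∧
      (4 ≤ V(G.lobe x₀ x₁ C).encard → n C = 2)) ∧
    G.edgeMult x₀ x₁ + ∑ᶠ (C : Set α) (_ : (G.deleteVerts {x₀, x₁}).IsComponent C), n C = m + 1

end Basic

/-! ### The graphs `D_m` -/

/-- The ends of the edges of `D_m`, with roots `0`, `1` and the two other vertices `2`, `3`. -/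
def dEnds (m : ℕ) : Fin 5 ⊕ Fin (m - 2) → Sym2 (Fin 4)
  | Sum.inl i => ![s(0, 2), s(0, 3), s(1, 2), s(1, 3), s(2, 3)] i
  | Sum.inr _ => s(0, 1)

/-- `D_m` (for `m ≥ 2`): the complete graph on `{0, 1, 2, 3}` in which the edge between the
roots `0` and `1` has multiplicity `m - 2` (so it is absent for `m = 2`). -/
def dGraph (m : ℕ) : Graph (Fin 4) (Fin 5 ⊕ Fin (m - 2)) where
  vertexSet := Set.univ
  IsLink e u v := dEnds m e = s(u, v)
  isLink_symm := fun _ _ ↦ ⟨fun _ _ h ↦ h.trans Sym2.eq_swap⟩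
  eq_or_eq_of_isLink_of_isLink := by
    intro e a b c d h k
    have := h.symm.trans k
    rw [Sym2.eq_iff] at this
    tauto
  left_mem_of_isLink := fun _ _ _ _ ↦ Set.mem_univ _

end Graph

/-! Edge names play no role, so the argument is carried out for multisets of unordered pairs. `Imm`
is the immersion order on them and `HasD` says that $D_m$ is immersed. The last parts translate
between this model and `Graph`.

Type $A_m$ or $B_m$ excludes $D_m$. Splitting never enlarges a cut (`Imm.cut_le`). In $D_m$ a cut
separating the roots and also the two other vertices $u,v$ has $m+1$ edges, so a cut of size $m$
that separates the roots keeps $u$ and $v$ together. A chain that grows by single vertices, with at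
most one non-root vertex at either end, cannot do this. For type $B_m$, each root has degree $m+1$
against $m$ in $D_m$, and an inner vertex of a long lobe has degree 4 against 3. A splitting at such
a vertex, with both new ends elsewhere, costs two edges of its cut, which is one too many. Hence no
edge can be created across these vertices (`Imm.noEdge`), although $D_m$ requires one.

Conversely, suppose that there is no $D_m$ and let $k\ge m$ be the minimum size of a cut separating
the roots. Then there is no $D_k$ either, and `hasD_or_typeA` yields a chain of minimum cuts, that
is, type $A_k$. Its proof is by induction: at a minimum cut with at least two vertices on either
side, each side can be contracted to its root by an immersion (Menger, `imm_contract`), and the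
chains of the two contractions are glued. If there is no such cut, some root has degree $k$ and all
internal separating cuts are larger, and `hasD_of_internal` constructs $D_k$. It takes $k$
edge-disjoint paths between the roots with at least one edge left over. If some vertex lies on just
one path, a set of vertices with tripods to that path is grown until it reaches another path or is
closed (`hasD_of_tripods`). If all inner vertices of the paths are shared, a component of the
left-over edges supplies the rung (`hasD_of_shared`). When these constructions get stuck, the cut
conditions force nearly all edges at a root to lead to the other root, and `hasD_of_one_edge` or
`hasD_of_no_edge` applies.

If $k=m$ this is type $A_m$. If $k>m$, two consecutive vertices $u,v$ of the chain are isolated by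
contracting everything before and after them. The graphs on four vertices can be analysed directly
(`four_of_not_hasD`): $k=m+1$, and $u,v$ are either non-adjacent or joined by exactly two edges, in
which case $u$ has no edges to later vertices or $x_1$ and $v$ none to earlier vertices or $x_0$.
Non-adjacent neighbours in the order may be exchanged without losing tightness (`TightList.swap`),
so the same holds for any two adjacent vertices (`TightList.unique`). Thus every non-root vertex has
at most one earlier and one later neighbour besides the roots, and as many edges back as forward.
The graph falls apart into multiplied paths, which is type $B_m$ (`TightList.typeB`). -/

namespace EdgeMultiset

open Classical Relation

variable {α : Type*}

/-! ### Edge cuts of a multiset of edges -/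

/-- The edge `e` has exactly one end in `X`. -/
def Crosses (X : Set α) (e : Sym2 α) : Prop := (∃ v ∈ e, v ∈ X) ∧ ∃ v ∈ e, v ∉ X

@[simp] lemma crosses_mk {X : Set α} {a b : α} : Crosses X s(a, b) ↔ ¬ (a ∈ X ↔ b ∈ X) := by
  simp only [Crosses, Sym2.mem_iff, exists_eq_or_imp, exists_eq_left]
  tauto

/-- The number of edges of `M` with exactly one end in `X`. -/
noncomputable def cut (M : Multiset (Sym2 α)) (X : Set α) : ℕ := M.countP (Crosses X)

@[simp] lemma cut_zero (X : Set α) : cut 0 X = 0 := rfl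

@[simp] lemma cut_add (M N : Multiset (Sym2 α)) (X : Set α) :
    cut (M + N) X = cut M X + cut N X := Multiset.countP_add _ _ _

lemma cut_cons (a b : α) (M : Multiset (Sym2 α)) (X : Set α) :
    cut (s(a, b) ::ₘ M) X = cut M X + if (a ∈ X ↔ b ∈ X) then 0 else 1 := by
  rw [cut, Multiset.countP_cons]
  simp only [crosses_mk, cut, ite_not]

lemma cut_mono {M N : Multiset (Sym2 α)} (h : M ≤ N) (X : Set α) : cut M X ≤ cut N X :=
  Multiset.countP_le_of_le _ h

@[simp] lemma cut_nsmul (n : ℕ) (M : Multiset (Sym2 α)) (X : Set α) :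
    cut (n • M) X = n * cut M X := by
  rw [cut, Multiset.countP_nsmul, cut]

lemma cut_compl (M : Multiset (Sym2 α)) (X : Set α) : cut M Xᶜ = cut M X := by
  induction M using Multiset.induction_on with
  | empty => simp
  | cons e M ih =>
    induction e with | _ a b
    simp only [cut_cons, ih, Set.mem_compl_iff, not_iff_not]

/-- Two sets that agree on all ends of edges define the same cut. -/
lemma cut_congr {M : Multiset (Sym2 α)} {X Y : Set α}
    (h : ∀ e ∈ M, ∀ v ∈ e, (v ∈ X ↔ v ∈ Y)) : cut M X = cut M Y := by
  unfold cut
  apply Multiset.countP_congr rfl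
  intro e he
  induction e with | _ a b
  simp only [crosses_mk, h _ he a (by simp), h _ he b (by simp)]

lemma cut_le_of_crosses {M : Multiset (Sym2 α)} {X Y : Set α}
    (h : ∀ e ∈ M, Crosses X e → Crosses Y e) : cut M X ≤ cut M Y := by
  unfold cut
  rw [Multiset.countP_eq_card_filter, Multiset.countP_eq_card_filter]
  apply Multiset.card_le_card
  rw [Multiset.le_filter]
  refine ⟨Multiset.filter_le _ _, fun e he => ?_⟩
  rw [Multiset.mem_filter] at he
  exact h e he.1 he.2

lemma cut_eq_zero {M : Multiset (Sym2 α)} {X : Set α} :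
    cut M X = 0 ↔ ∀ e ∈ M, ¬ Crosses X e := Multiset.countP_eq_zero

lemma cut_submodular (M : Multiset (Sym2 α)) (X Y : Set α) :
    cut M (X ∪ Y) + cut M (X ∩ Y) ≤ cut M X + cut M Y := by
  induction M using Multiset.induction_on with
  | empty => simp
  | cons e M ih =>
    induction e with | _ a b
    simp only [cut_cons, Set.mem_union, Set.mem_inter_iff]
    by_cases h1 : a ∈ X <;> by_cases h2 : b ∈ X <;> by_cases h3 : a ∈ Y <;>
      by_cases h4 : b ∈ Y <;> simp [h1, h2, h3, h4] <;> omega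

/-- The number of edges of `M` with one end in `A` and one end in `B`. -/
noncomputable def btw (M : Multiset (Sym2 α)) (A B : Set α) : ℕ :=
  M.countP (fun e => ∃ a ∈ A, ∃ b ∈ B, e = s(a, b))

@[simp] lemma btw_zero (A B : Set α) : btw 0 A B = 0 := rfl

lemma exists_mk_iff {A B : Set α} {a b : α} :
    (∃ x ∈ A, ∃ y ∈ B, s(a, b) = s(x, y)) ↔ (a ∈ A ∧ b ∈ B ∨ a ∈ B ∧ b ∈ A) := by
  constructor
  · rintro ⟨x, hx, y, hy, h⟩
    rw [Sym2.eq_iff] at h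
    rcases h with ⟨rfl, rfl⟩ | ⟨rfl, rfl⟩ <;> tauto
  · rintro (⟨h1, h2⟩ | ⟨h1, h2⟩)
    · exact ⟨a, h1, b, h2, rfl⟩
    · exact ⟨b, h2, a, h1, Sym2.eq_swap⟩

lemma btw_cons (a b : α) (M : Multiset (Sym2 α)) (A B : Set α) :
    btw (s(a, b) ::ₘ M) A B = btw M A B + if (a ∈ A ∧ b ∈ B ∨ a ∈ B ∧ b ∈ A) then 1 else 0 := by
  rw [btw, Multiset.countP_cons]
  simp only [exists_mk_iff, btw]

lemma btw_comm (M : Multiset (Sym2 α)) (A B : Set α) : btw M A B = btw M B A := by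
  induction M using Multiset.induction_on with
  | empty => simp
  | cons e M ih =>
    induction e with | _ a b
    rw [btw_cons, btw_cons, ih]
    congr 1
    exact if_congr or_comm rfl rfl

lemma btw_eq_zero {M : Multiset (Sym2 α)} {A B : Set α} :
    btw M A B = 0 ↔ ∀ a ∈ A, ∀ b ∈ B, s(a, b) ∉ M := by
  rw [btw, Multiset.countP_eq_zero]
  constructor
  · intro h a ha b hb hm
    exact h _ hm ⟨a, ha, b, hb, rfl⟩
  · rintro h e he ⟨a, ha, b, hb, rfl⟩
    exact h a ha b hb he

lemma btw_singleton (M : Multiset (Sym2 α)) (a b : α) : btw M {a} {b} = M.count s(a, b) := by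
  rw [btw, Multiset.count]
  apply Multiset.countP_congr rfl
  intro e _
  simp [eq_comm]

/-! ### Immersion of multisets of edges -/

/-- One splitting or deletion of a multiset of edges; loops may be created freely. -/
inductive Step : Multiset (Sym2 α) → Multiset (Sym2 α) → Prop
  | split (a b c : α) (M : Multiset (Sym2 α)) :
      Step (s(a, b) ::ₘ s(b, c) ::ₘ M) (s(a, c) ::ₘ M)
  | del (e : Sym2 α) (M : Multiset (Sym2 α)) : Step (e ::ₘ M) M
  -- Free loops let a walk of length zero count as an edge, so degenerate concatenations need no
  -- case distinction. A loop crosses no cut, and loops are discarded again when immersions are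
  -- realised in graphs.
  | loop (a : α) (M : Multiset (Sym2 α)) : Step M (s(a, a) ::ₘ M)

/-- `N` is obtained from `M` by splittings, deletions and creation of loops. -/
def Imm (M N : Multiset (Sym2 α)) : Prop := ReflTransGen Step M N

lemma Imm.refl (M : Multiset (Sym2 α)) : Imm M M := ReflTransGen.refl

lemma Imm.trans {M N K : Multiset (Sym2 α)} (h : Imm M N) (h' : Imm N K) : Imm M K :=
  ReflTransGen.trans h h'

lemma Step.add_right {M N : Multiset (Sym2 α)} (h : Step M N) (K : Multiset (Sym2 α)) :
    Step (M + K) (N + K) := by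
  cases h with
  | split a b c M => simpa using Step.split a b c (M + K)
  | del e M => simpa using Step.del e (N + K)
  | loop a M => simpa using Step.loop a (M + K)

lemma Imm.add_right {M N : Multiset (Sym2 α)} (h : Imm M N) (K : Multiset (Sym2 α)) :
    Imm (M + K) (N + K) := by
  induction h with
  | refl => exact .refl _
  | tail _ h ih => exact ih.tail (h.add_right K)

lemma Imm.add {M N K L : Multiset (Sym2 α)} (h : Imm M N) (h' : Imm K L) :
    Imm (M + K) (N + L) :=
  (h.add_right K).trans (by rw [add_comm N, add_comm N]; exact h'.add_right N)

lemma imm_zero (M : Multiset (Sym2 α)) : Imm M 0 := by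
  induction M using Multiset.induction_on with
  | empty => exact .refl _
  | cons e M ih => exact ReflTransGen.head (Step.del e M) ih

lemma imm_of_le {M N : Multiset (Sym2 α)} (h : N ≤ M) : Imm M N := by
  obtain ⟨K, rfl⟩ := Multiset.le_iff_exists_add.1 h
  simpa using (Imm.refl N).add (imm_zero K)

lemma Imm.of_le {M N K : Multiset (Sym2 α)} (h : Imm N K) (h' : N ≤ M) : Imm M K :=
  (imm_of_le h').trans h

lemma Imm.nsmul {M N : Multiset (Sym2 α)} (h : Imm M N) (n : ℕ) : Imm (n • M) (n • N) := by
  induction n with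
  | zero => simpa using Imm.refl _
  | succ n ih => rw [succ_nsmul, succ_nsmul]; exact ih.add h

lemma Imm.sum {ι : Type*} {s : Multiset ι} {f g : ι → Multiset (Sym2 α)}
    (h : ∀ i ∈ s, Imm (f i) (g i)) : Imm (s.map f).sum (s.map g).sum := by
  induction s using Multiset.induction_on with
  | empty => simpa using Imm.refl _
  | cons i s ih =>
    simp only [Multiset.map_cons, Multiset.sum_cons]
    exact (h i (by simp)).add (ih fun j hj => h j (by simp [hj]))

/-- A single edge. -/
abbrev edge (a b : α) : Multiset (Sym2 α) := {s(a, b)}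

lemma edge_comm (a b : α) : edge a b = edge b a := by rw [edge, edge, Sym2.eq_swap]

lemma imm_path (a b c : α) : Imm (edge a b + edge b c) (edge a c) :=
  ReflTransGen.single (Step.split a b c 0)

lemma imm_loop (a : α) (M : Multiset (Sym2 α)) : Imm M (edge a a) :=
  (imm_zero M).trans (ReflTransGen.single (Step.loop a 0))

lemma Imm.path {M N : Multiset (Sym2 α)} {a b c : α} (h : Imm M (edge a b))
    (h' : Imm N (edge b c)) : Imm (M + N) (edge a c) :=
  (h.add h').trans (imm_path a b c)

lemma Imm.comm {M : Multiset (Sym2 α)} {a b : α} (h : Imm M (edge a b)) : Imm M (edge b a) := by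
  rwa [edge_comm]

@[simp] lemma cut_edge (a b : α) (X : Set α) :
    cut (edge a b) X = if (a ∈ X ↔ b ∈ X) then 0 else 1 := by
  simpa using cut_cons a b 0 X

lemma Step.cut_le {M N : Multiset (Sym2 α)} (h : Step M N) (X : Set α) : cut N X ≤ cut M X := by
  cases h with
  | split a b c M =>
    simp only [cut_cons]
    by_cases h1 : a ∈ X <;> by_cases h2 : b ∈ X <;> by_cases h3 : c ∈ X <;> simp [h1, h2, h3] <;> omega
  | del e M => exact cut_mono (Multiset.le_cons_self _ _) X
  | loop a M => simp [cut_cons]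

/-- The basic obstruction: splitting $ab,bc$ into $ac$ cannot increase the number of crossings of a
set. -/
lemma Imm.cut_le {M N : Multiset (Sym2 α)} (h : Imm M N) (X : Set α) : cut N X ≤ cut M X := by
  induction h with
  | refl => exact le_rfl
  | tail _ h ih => exact (h.cut_le X).trans ih

/-! ### The graph `D_m` -/

/-- The edges of `D_m` on the vertices `x₀`, `x₁`, `u`, `v`. -/
def dEdges (m : ℕ) (x₀ x₁ u v : α) : Multiset (Sym2 α) :=
  (m - 2) • edge x₀ x₁ + (edge x₀ u + edge x₀ v + edge x₁ u + edge x₁ v + edge u v)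

/-- `M` has an immersion of `D_m` rooted at `x₀`, `x₁`. -/
def HasD (m : ℕ) (M : Multiset (Sym2 α)) (x₀ x₁ : α) : Prop :=
  ∃ u v, u ≠ v ∧ u ≠ x₀ ∧ u ≠ x₁ ∧ v ≠ x₀ ∧ v ≠ x₁ ∧ Imm M (dEdges m x₀ x₁ u v)

lemma HasD.of_imm {m : ℕ} {M N : Multiset (Sym2 α)} {x₀ x₁ : α} (h : HasD m N x₀ x₁)
    (h' : Imm M N) : HasD m M x₀ x₁ := by
  obtain ⟨u, v, h1, h2, h3, h4, h5, h6⟩ := h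
  exact ⟨u, v, h1, h2, h3, h4, h5, h'.trans h6⟩

/-- Surplus edges between the roots can be deleted. This passes from the minimum size $k$ of a
separating cut to $m\le k$. -/
lemma HasD.mono {m n : ℕ} {M : Multiset (Sym2 α)} {x₀ x₁ : α} (h : HasD n M x₀ x₁)
    (h' : m ≤ n) : HasD m M x₀ x₁ := by
  obtain ⟨u, v, h1, h2, h3, h4, h5, h6⟩ := h
  refine ⟨u, v, h1, h2, h3, h4, h5, h6.trans (imm_of_le ?_)⟩
  exact add_le_add_left (nsmul_le_nsmul_left zero_le (by omega)) _

lemma HasD.swap {m : ℕ} {M : Multiset (Sym2 α)} {x₀ x₁ : α} (h : HasD m M x₀ x₁) :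
    HasD m M x₁ x₀ := by
  obtain ⟨u, v, h1, h2, h3, h4, h5, h6⟩ := h
  refine ⟨u, v, h1, h3, h2, h5, h4, ?_⟩
  have : dEdges m x₁ x₀ u v = dEdges m x₀ x₁ u v := by
    unfold dEdges; rw [edge_comm x₁ x₀]; abel
  rwa [this]

/-- Two trails through `u` and `v`, a rung between `u` and `v` and `m - 2` further trails. -/
lemma HasD.of_pieces {m : ℕ} {M A B C D R F : Multiset (Sym2 α)} {x₀ x₁ u v : α}
    (huv : u ≠ v) (hu0 : u ≠ x₀) (hu1 : u ≠ x₁) (hv0 : v ≠ x₀) (hv1 : v ≠ x₁)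
    (hA : Imm A (edge x₀ u)) (hB : Imm B (edge u x₁)) (hC : Imm C (edge x₀ v))
    (hD : Imm D (edge v x₁)) (hR : Imm R (edge u v)) (hF : Imm F ((m - 2) • edge x₀ x₁))
    (h : A + B + C + D + R + F ≤ M) : HasD m M x₀ x₁ := by
  refine ⟨u, v, huv, hu0, hu1, hv0, hv1, (imm_of_le h).trans ?_⟩
  have := ((((hA.add hB).add hC).add hD).add hR).add hF
  refine this.trans (imm_of_le (le_of_eq ?_))
  unfold dEdges
  rw [edge_comm x₁ u, edge_comm x₁ v]
  abel

/-! ### Walks -/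

/-- The edges of the walk visiting the vertices of a list in order. -/
def walkEdges : List α → Multiset (Sym2 α)
  | [] => 0
  | [_] => 0
  | a :: b :: l => s(a, b) ::ₘ walkEdges (b :: l)

@[simp] lemma walkEdges_nil : walkEdges ([] : List α) = 0 := rfl
@[simp] lemma walkEdges_singleton (a : α) : walkEdges [a] = 0 := rfl
@[simp] lemma walkEdges_cons_cons (a b : α) (l : List α) :
    walkEdges (a :: b :: l) = s(a, b) ::ₘ walkEdges (b :: l) := rfl

lemma walkEdges_append (l₁ : List α) (a : α) (l₂ : List α) :
    walkEdges (l₁ ++ a :: l₂) = walkEdges (l₁ ++ [a]) + walkEdges (a :: l₂) := by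
  induction l₁ with
  | nil => simp
  | cons b l ih =>
    cases l with
    | nil => simp
    | cons c l => simpa using ih

lemma walkEdges_append_append (l₁ : List α) (a b : α) (l₂ : List α) :
    walkEdges (l₁ ++ [a] ++ b :: l₂) = walkEdges (l₁ ++ [a]) + edge a b + walkEdges (b :: l₂) := by
  rw [List.append_assoc, List.singleton_append, walkEdges_append]
  simp [add_assoc]

lemma mem_of_mem_walkEdges {l : List α} {e : Sym2 α} (he : e ∈ walkEdges l) {v : α} (hv : v ∈ e) :
    v ∈ l := by
  induction l with
  | nil => simp at he
  | cons a l ih =>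
    cases l with
    | nil => simp at he
    | cons b l =>
      simp only [walkEdges_cons_cons, Multiset.mem_cons] at he
      rcases he with rfl | he
      · simp only [Sym2.mem_iff] at hv
        rcases hv with rfl | rfl <;> simp
      · exact List.mem_cons_of_mem _ (ih he)

lemma imm_walkEdges {l : List α} {a b : α} (ha : l.head? = some a) (hb : l.getLast? = some b) :
    Imm (walkEdges l) (edge a b) := by
  induction l generalizing a with
  | nil => simp at ha
  | cons c l ih =>
    simp only [List.head?_cons, Option.some.injEq] at ha
    subst ha
    cases l with
    | nil =>
      simp only [List.getLast?_singleton, Option.some.injEq] at hb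
      subst hb
      exact imm_loop _ _
    | cons d l =>
      rw [walkEdges_cons_cons, ← Multiset.singleton_add]
      exact (Imm.refl _).path (ih rfl (by simpa using hb))

/-- A walk contains a path with the same ends. -/
lemma exists_nodup_walk (l : List α) : ∃ l' : List α, l'.Nodup ∧ l'.head? = l.head? ∧
    l'.getLast? = l.getLast? ∧ walkEdges l' ≤ walkEdges l := by
  induction l with
  | nil => exact ⟨[], by simp⟩
  | cons a l ih =>
    obtain ⟨l', h1, h2, h3, h4⟩ := ih
    cases l with
    | nil => exact ⟨[a], by simp⟩
    | cons b l =>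
      by_cases ha : a ∈ l'
      · obtain ⟨s, t, rfl⟩ := List.append_of_mem ha
        refine ⟨a :: t, (List.nodup_append.1 h1).2.1, by simp, ?_, ?_⟩
        · simpa [List.getLast?_append, List.getLast?_cons] using h3
        · rw [walkEdges_append] at h4
          exact (Multiset.le_add_left _ _).trans (h4.trans (Multiset.le_cons_self _ _))
      · cases l' with
        | nil => simp at h2
        | cons c l' =>
          simp only [List.head?_cons, Option.some.injEq] at h2
          subst h2
          exact ⟨a :: c :: l', List.nodup_cons.2 ⟨ha, h1⟩, by simp, by simpa using h3,
            by simpa using h4⟩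

lemma cut_walkEdges_eq_zero {l : List α} {X : Set α} (h : (∀ v ∈ l, v ∈ X) ∨ ∀ v ∈ l, v ∉ X) :
    cut (walkEdges l) X = 0 := by
  rw [cut_eq_zero]
  rintro e he ⟨⟨v, hv, hvX⟩, w, hw, hwX⟩
  rcases h with h | h
  · exact hwX (h w (mem_of_mem_walkEdges he hw))
  · exact h v (mem_of_mem_walkEdges he hv) hvX

/-- A walk that starts outside `X` and has exactly a final part in `X` crosses once. -/
lemma cut_walkEdges_append {l₁ l₂ : List α} {X : Set α} (h₁ : l₁ ≠ []) (h₂ : l₂ ≠ [])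
    (hX₁ : ∀ v ∈ l₁, v ∉ X) (hX₂ : ∀ v ∈ l₂, v ∈ X) : cut (walkEdges (l₁ ++ l₂)) X = 1 := by
  obtain ⟨l, a, rfl⟩ : ∃ l a, l₁ = l ++ [a] := ⟨_, _, (List.dropLast_append_getLast h₁).symm⟩
  obtain ⟨b, l', rfl⟩ := List.exists_cons_of_ne_nil h₂
  rw [walkEdges_append_append, cut_add, cut_add, cut_walkEdges_eq_zero (Or.inr hX₁),
    cut_walkEdges_eq_zero (Or.inl hX₂), cut_edge]
  simp [hX₁ a (by simp), hX₂ b (by simp)]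

lemma cut_walkEdges_append_append {l₁ l₂ l₃ : List α} {X : Set α} (h₁ : l₁ ≠ []) (h₂ : l₂ ≠ [])
    (h₃ : l₃ ≠ []) (hX₁ : ∀ v ∈ l₁, v ∉ X) (hX₂ : ∀ v ∈ l₂, v ∈ X) (hX₃ : ∀ v ∈ l₃, v ∉ X) :
    cut (walkEdges (l₁ ++ l₂ ++ l₃)) X = 2 := by
  obtain ⟨b, l', rfl⟩ := List.exists_cons_of_ne_nil h₃
  obtain ⟨l, a, rfl⟩ : ∃ l a, l₂ = l ++ [a] := ⟨_, _, (List.dropLast_append_getLast h₂).symm⟩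
  rw [← List.append_assoc, walkEdges_append_append, cut_add, cut_add,
    cut_walkEdges_eq_zero (Or.inr hX₃), cut_edge, List.append_assoc,
    cut_walkEdges_append h₁ (by simp) hX₁ hX₂]
  simp [hX₃ b (by simp), hX₂ a (by simp)]

/-! ### Menger's theorem -/

/-- The number of elements of `B` in `X`, counted with multiplicity. -/
noncomputable def supply (B : Multiset α) (X : Set α) : ℕ := B.countP (· ∈ X)

@[simp] lemma supply_zero (X : Set α) : supply 0 X = 0 := rfl

lemma supply_cons (b : α) (B : Multiset α) (X : Set α) :
    supply (b ::ₘ B) X = supply B X + if b ∈ X then 1 else 0 := by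
  rw [supply, Multiset.countP_cons, supply]

lemma supply_le_card (B : Multiset α) (X : Set α) : supply B X ≤ B.card :=
  Multiset.countP_le_card _ _

lemma supply_eq_zero {B : Multiset α} {X : Set α} : supply B X = 0 ↔ ∀ b ∈ B, b ∉ X :=
  Multiset.countP_eq_zero

lemma supply_mono (B : Multiset α) {X Y : Set α} (h : X ⊆ Y) : supply B X ≤ supply B Y := by
  rw [supply, supply, Multiset.countP_eq_card_filter, Multiset.countP_eq_card_filter]
  exact Multiset.card_le_card (Multiset.monotone_filter_right _ h)

lemma supply_union_inter (B : Multiset α) (X Y : Set α) :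
    supply B (X ∪ Y) + supply B (X ∩ Y) = supply B X + supply B Y := by
  induction B using Multiset.induction_on with
  | empty => simp
  | cons b B ih =>
    simp only [supply_cons, Set.mem_union, Set.mem_inter_iff] at ih ⊢
    by_cases h1 : b ∈ X <;> by_cases h2 : b ∈ Y <;> simp [h1, h2] <;> omega

/-- Menger's theorem with supplies: if every part `Z` of `U` has at least as many edges leaving it
as there are supplies in it, then there are edge-disjoint walks leading from the supplies out
of `U`. -/
theorem exists_walks (U : Finset α) (N : Multiset (Sym2 α)) (B : Multiset α)
    (h : ∀ Z : Finset α, Z ⊆ U → supply B (Z : Set α) ≤ cut N Z) :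
    ∃ P : Multiset (List α), P.map List.head? = B.map some ∧
      (∀ l ∈ P, ∃ t, l.getLast? = some t ∧ t ∉ U) ∧ (P.map walkEdges).sum ≤ N := by
  -- Induction on the number of edges: either some edge can be deleted without violating the
  -- condition, or the first edge of a walk can be used up.
  induction hn : N.card using Nat.strong_induction_on generalizing N B with
  | _ n ih =>
  by_cases hB : ∀ b ∈ B, b ∉ U
  · refine ⟨B.map fun b => [b], by simp [Function.comp_def], ?_, by simp [Function.comp_def]⟩
    intro l hl
    obtain ⟨b, hb, rfl⟩ := Multiset.mem_map.1 hl
    exact ⟨b, by simp, hB b hb⟩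
  push Not at hB
  obtain ⟨u, huB, huU⟩ := hB
  by_cases hdel : ∃ e ∈ N, ∀ Z : Finset α, Z ⊆ U → supply B (Z : Set α) ≤ cut (N.erase e) Z
  · obtain ⟨e, he, hZ⟩ := hdel
    obtain ⟨P, h1, h2, h3⟩ := ih (N.erase e).card
      (by rw [← hn]; exact Multiset.card_erase_lt_of_mem he) (N.erase e) B hZ rfl
    exact ⟨P, h1, h2, h3.trans (Multiset.erase_le _ _)⟩
  push Not at hdel
  -- As no edge can be deleted, each edge crosses a set whose cut equals its supply.
  have key : ∀ e ∈ N, ∃ Z : Finset α, Z ⊆ U ∧ Crosses Z e ∧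
      cut N Z = supply B (Z : Set α) := by
    intro e he
    obtain ⟨Z, hZU, hZ⟩ := hdel e he
    have h1 := h Z hZU
    obtain ⟨N', rfl⟩ := Multiset.exists_cons_of_mem he
    rw [Multiset.erase_cons_head] at hZ
    have h2 : cut (e ::ₘ N') Z = cut N' Z + if Crosses Z e then 1 else 0 := by
      rw [cut, Multiset.countP_cons, cut]
    refine ⟨Z, hZU, ?_, ?_⟩
    · by_contra hc
      rw [if_neg hc] at h2
      omega
    · split_ifs at h2 <;> omega
  obtain ⟨v, Z, huv, hZU, huZ, hvZ, hZ⟩ : ∃ v, ∃ Z : Finset α, s(u, v) ∈ N ∧ Z ⊆ U ∧ u ∈ Z ∧ v ∉ Z ∧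
      cut N Z = supply B (Z : Set α) := by
    by_contra hcon
    push Not at hcon
    -- If no edge $uv$ leaves such a tight set through $u$, consider all tight sets avoiding $u$. By
    -- uncrossing, their union $W$ is again tight.
    set T := U.powerset.filter
      (fun Z : Finset α => u ∉ Z ∧ cut N Z = supply B (Z : Set α)) with hT
    have hW : T.sup id ⊆ U ∧ u ∉ T.sup id ∧
        cut N (T.sup id : Finset α) = supply B ((T.sup id : Finset α) : Set α) := by
      refine Finset.sup_induction (p := fun W : Finset α => W ⊆ U ∧ u ∉ W ∧
        cut N W = supply B (W : Set α)) ?_ ?_ ?_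
      · refine ⟨by simp, by simp, ?_⟩
        have : cut N ((⊥ : Finset α) : Set α) = 0 := by
          rw [cut_eq_zero]
          rintro e - ⟨⟨v, -, hv⟩, -⟩
          simp at hv
        rw [this]
        simp [supply]
      · rintro X ⟨hX1, hX2, hX3⟩ Y ⟨hY1, hY2, hY3⟩
        refine ⟨Finset.union_subset hX1 hY1, by simp [hX2, hY2], ?_⟩
        have h1 := cut_submodular N X Y
        have h2 := supply_union_inter B (X : Set α) Y
        have h3 := h (X ∪ Y) (Finset.union_subset hX1 hY1)
        have h4 := h (X ∩ Y) (Finset.inter_subset_left.trans hX1)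
        simp only [Finset.sup_eq_union, Finset.coe_union, Finset.coe_inter] at *
        omega
      · intro W hW
        simp only [hT, Finset.mem_filter, Finset.mem_powerset] at hW
        exact hW
    obtain ⟨hW1, hW2, hW3⟩ := hW
    set W := T.sup id
    have h1 := h (insert u W) (Finset.insert_subset huU hW1)
    -- All neighbours of $u$ lie in $W$, so adding $u$ does not increase the cut, whereas it
    -- increases the supply.
    have h2 : cut N (insert u W : Finset α) ≤ cut N W := by
      apply cut_le_of_crosses
      have aux : ∀ v, s(u, v) ∈ N → v ∈ W := by
        intro v hv
        obtain ⟨Z, hZU, hZc, hZ⟩ := key _ hv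
        rw [crosses_mk] at hZc
        have huZ : u ∉ Z := fun huZ => hcon v Z hv hZU huZ (by simpa [huZ] using hZc) hZ
        have hvZ : v ∈ Z := by simpa [huZ] using hZc
        have : Z ∈ T := by
          simp only [hT, Finset.mem_filter, Finset.mem_powerset]
          exact ⟨hZU, huZ, hZ⟩
        exact (Finset.le_sup (f := id) this) hvZ
      intro e he
      induction e with | _ a b
      simp only [crosses_mk, Finset.mem_coe, Finset.mem_insert]
      by_cases hau : a = u
      · subst hau
        have := aux b he
        simp [this]
      by_cases hbu : b = u
      · subst hbu
        have := aux a (by rwa [Sym2.eq_swap])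
        simp [this]
      simp [hau, hbu]
    have h3 : supply B (W : Set α) < supply B ((insert u W : Finset α) : Set α) := by
      obtain ⟨B', rfl⟩ := Multiset.exists_cons_of_mem huB
      rw [supply_cons, supply_cons]
      have := supply_mono B' (X := (W : Set α)) (Y := (insert u W : Finset α)) (by simp)
      simp only [Finset.mem_coe, hW2, if_false, Finset.mem_insert, true_or, if_true]
      omega
    omega
  obtain ⟨N', rfl⟩ := Multiset.exists_cons_of_mem huv
  obtain ⟨B', rfl⟩ := Multiset.exists_cons_of_mem huB
  -- The edge $uv$ is used and the supply moves from $u$ to $v$. The condition could only fail for a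
  -- set $W$ with $v\in W$ and $u\notin W$. There $uv$ joins $Z\setminus W$ to $W\setminus Z$, and
  -- uncrossing with the tight set $Z$ yields the two missing edges.
  obtain ⟨P, h1, h2, h3⟩ := ih N'.card (by rw [← hn]; simp) N' (v ::ₘ B') (by
    intro W hWU
    have hW := h W hWU
    have hsub := cut_submodular N' (Z : Set α) W
    have hmod := supply_union_inter B' (Z : Set α) W
    have hU := h (Z ∪ W) (Finset.union_subset hZU hWU)
    have hI := h (Z ∩ W) (Finset.inter_subset_left.trans hZU)
    simp only [cut_cons, supply_cons, Finset.coe_union, Finset.coe_inter, Set.mem_union,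
      Set.mem_inter_iff, Finset.mem_coe, huZ, hvZ, true_or, false_or, true_and, false_and] at *
    by_cases huW : u ∈ W <;> by_cases hvW : v ∈ W <;> simp [huW, hvW] at * <;> omega) rfl
  have hv : some v ∈ P.map List.head? := by rw [h1]; simp
  obtain ⟨l, hl, hlv⟩ := Multiset.mem_map.1 hv
  obtain ⟨P', rfl⟩ := Multiset.exists_cons_of_mem hl
  obtain ⟨l, rfl⟩ : ∃ l', l = v :: l' := by
    cases l with
    | nil => simp at hlv
    | cons c l => simp only [List.head?_cons, Option.some.injEq] at hlv; exact ⟨l, by rw [hlv]⟩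
  refine ⟨(u :: v :: l) ::ₘ P', ?_, ?_, ?_⟩
  · simpa using h1
  · intro l' hl'
    rw [Multiset.mem_cons] at hl'
    rcases hl' with rfl | hl'
    · simpa using h2 (v :: l) (by simp)
    · exact h2 l' (by simp [hl'])
  · simpa using h3

lemma exists_edge_of_mem_walk {l : List α} {v : α} (hv : v ∈ l) :
    l = [v] ∨ ∃ e ∈ walkEdges l, v ∈ e := by
  induction l with
  | nil => simp at hv
  | cons a l ih =>
    cases l with
    | nil => left; rw [List.mem_singleton.1 hv]
    | cons b l =>
      right
      rcases List.mem_cons.1 hv with rfl | hv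
      · exact ⟨s(v, b), by simp, by simp⟩
      · rcases ih hv with h | ⟨e, he, hve⟩
        · simp only [List.cons.injEq] at h
          exact ⟨s(a, b), by simp, by simp [h.1]⟩
        · exact ⟨e, by simp [he], hve⟩

lemma le_sum_of_mem {ι : Type*} {s : Multiset ι} {i : ι} (f : ι → Multiset (Sym2 α)) (h : i ∈ s) :
    f i ≤ (s.map f).sum := by
  obtain ⟨t, rfl⟩ := Multiset.exists_cons_of_mem h
  simp

/-- A path from `x₀` to `x₁`, as the list of its vertices. -/
structure IsPath (x₀ x₁ : α) (l : List α) : Prop where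
  nodup : l.Nodup
  head : l.head? = some x₀
  last : l.getLast? = some x₁

lemma IsPath.imm {x₀ x₁ : α} {l : List α} (h : IsPath x₀ x₁ l) :
    Imm (walkEdges l) (edge x₀ x₁) := imm_walkEdges h.head h.last

/-- Menger's theorem for edge-disjoint paths between two vertices. -/
theorem exists_paths {S : Finset α} {M : Multiset (Sym2 α)} (hS : ∀ e ∈ M, ∀ v ∈ e, v ∈ S)
    {x₀ x₁ : α} (hx₀ : x₀ ∈ S) {m : ℕ}
    (h : ∀ X : Finset α, X ⊆ S → x₀ ∈ X → x₁ ∉ X → m ≤ cut M X) :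
    ∃ P : Multiset (List α), P.card = m ∧ (∀ l ∈ P, IsPath x₀ x₁ l) ∧
      (P.map walkEdges).sum ≤ M := by
  -- With $m$ supplies at $x_0$, a walk that leaves $S\setminus\{x_1\}$ can only end at $x_1$.
  obtain ⟨P, h1, h2, h3⟩ := exists_walks (S.erase x₁) M (Multiset.replicate m x₀) (by
    intro Z hZ
    by_cases hx : x₀ ∈ Z
    · refine le_trans ?_ (h Z (hZ.trans (Finset.erase_subset _ _)) hx
        (fun h => by simpa using hZ h))
      exact (supply_le_card _ _).trans (by simp)
    · have : supply (Multiset.replicate m x₀) (Z : Set α) = 0 := by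
        rw [supply_eq_zero]
        intro b hb
        rw [Multiset.eq_of_mem_replicate hb]
        simpa using hx
      omega)
  have hP : ∀ l ∈ P, l.head? = some x₀ ∧ l.getLast? = some x₁ := by
    intro l hl
    have h4 : l.head? = some x₀ := by
      have := Multiset.mem_map_of_mem List.head? hl
      rw [h1, Multiset.mem_map] at this
      obtain ⟨b, hb, hb'⟩ := this
      rw [← hb', Multiset.eq_of_mem_replicate hb]
    refine ⟨h4, ?_⟩
    obtain ⟨t, ht, htU⟩ := h2 l hl
    rw [ht]
    congr 1
    by_contra hne'
    apply htU
    rw [Finset.mem_erase]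
    refine ⟨hne', ?_⟩
    rcases exists_edge_of_mem_walk (List.mem_of_getLast? ht) with h5 | ⟨e, he, hte⟩
    · rw [h5] at h4
      simp only [List.head?_cons, Option.some.injEq] at h4
      rwa [h4]
    · exact hS e (Multiset.mem_of_le ((le_sum_of_mem walkEdges hl).trans h3) he) t hte
  choose f hf using fun l : List α => exists_nodup_walk l
  refine ⟨P.map f, ?_, ?_, ?_⟩
  · have := congrArg Multiset.card h1
    simpa using this
  · intro l' hl'
    obtain ⟨l, hl, rfl⟩ := Multiset.mem_map.1 hl'
    obtain ⟨h5, h6, h7, -⟩ := hf l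
    exact ⟨h5, h6.trans (hP l hl).1, h7.trans (hP l hl).2⟩
  · refine le_trans ?_ h3
    rw [Multiset.map_map]
    apply Multiset.sum_map_le_sum_map
    intro l _
    exact (hf l).2.2.2

/-- Menger's theorem with supplies, in terms of immersions. -/
theorem exists_imm_pairs (U : Finset α) (N : Multiset (Sym2 α)) (B : Multiset α)
    (h : ∀ Z : Finset α, Z ⊆ U → supply B Z ≤ cut N Z) :
    ∃ Q : Multiset (α × α), Q.map Prod.fst = B ∧
      (∀ q ∈ Q, q.2 ∉ U ∧ (q.2 ∈ B ∨ ∃ e ∈ N, q.2 ∈ e)) ∧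
      Imm N (Q.map fun q => edge q.1 q.2).sum := by
  obtain ⟨P, h1, h2, h3⟩ := exists_walks U N B h
  have hex : ∀ l ∈ P, ∃ q : α × α, l.head? = some q.1 ∧ l.getLast? = some q.2 := by
    intro l hl
    have : l.head? ∈ B.map some := by rw [← h1]; exact Multiset.mem_map_of_mem _ hl
    obtain ⟨b, -, hb⟩ := Multiset.mem_map.1 this
    obtain ⟨t, ht, -⟩ := h2 l hl
    exact ⟨(b, t), hb.symm, ht⟩
  rcases P.empty_or_exists_mem with rfl | ⟨l₀, hl₀⟩
  · refine ⟨0, ?_, by simp, by simpa using imm_zero N⟩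
    simpa [eq_comm] using h1
  have : Nonempty (α × α) := ⟨(hex l₀ hl₀).choose⟩
  choose! f hf using hex
  refine ⟨P.map f, ?_, ?_, ?_⟩
  · have h4 : (P.map (fun l => some (f l).1)) = B.map some := by
      rw [← h1]
      exact Multiset.map_congr rfl fun l hl => ((hf l hl).1).symm
    apply Multiset.map_injective (Option.some_injective α)
    rw [← h4, Multiset.map_map, Multiset.map_map]
    rfl
  · intro q hq
    obtain ⟨l, hl, rfl⟩ := Multiset.mem_map.1 hq
    obtain ⟨t, ht, htU⟩ := h2 l hl
    have h5 : (f l).2 = t := Option.some_injective _ ((hf l hl).2.symm.trans ht)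
    rw [h5]
    refine ⟨htU, ?_⟩
    rcases exists_edge_of_mem_walk (List.mem_of_getLast? ht) with h6 | ⟨e, he, hte⟩
    · left
      have : l.head? ∈ B.map some := by rw [← h1]; exact Multiset.mem_map_of_mem _ hl
      rw [h6] at this
      simpa using this
    · exact Or.inr ⟨e, Multiset.mem_of_le ((le_sum_of_mem walkEdges hl).trans h3) he, hte⟩
  · rw [Multiset.map_map]
    exact Imm.of_le (Imm.sum fun l hl => imm_walkEdges (hf l hl).1 (hf l hl).2) h3

/-- Menger's theorem with supplies and a single sink `t`. -/
theorem imm_sink (U : Finset α) (N : Multiset (Sym2 α)) (B : Multiset α) (t : α)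
    (hB : ∀ b ∈ B, b ∈ U) (hN : ∀ e ∈ N, ∀ v ∈ e, v ∈ U ∨ v = t)
    (h : ∀ Z : Finset α, Z ⊆ U → supply B Z ≤ cut N Z) :
    Imm N (B.map fun b => edge b t).sum := by
  obtain ⟨Q, rfl, h2, h3⟩ := exists_imm_pairs U N B h
  convert h3 using 2
  rw [Multiset.map_map]
  refine Multiset.map_congr rfl fun q hq => ?_
  obtain ⟨h4, h5⟩ := h2 q hq
  have : q.2 = t := by
    rcases h5 with h5 | ⟨e, he, hq⟩
    · exact absurd (hB _ h5) h4
    · exact (hN e he _ hq).resolve_left h4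
  simp [this]

/-! ### Rooted graphs without small cuts that do not separate the roots -/

/-- A loopless multigraph on `S` with roots `x₀`, `x₁`, whose edge-cuts not separating the roots
have at least three edges, and at least four if they are internal. -/
structure Rooted (S : Finset α) (M : Multiset (Sym2 α)) (x₀ x₁ : α) : Prop where
  mem : ∀ e ∈ M, ∀ v ∈ e, v ∈ S
  loopless : ∀ e ∈ M, ¬ e.IsDiag
  mem₀ : x₀ ∈ S
  mem₁ : x₁ ∈ S
  ne : x₀ ≠ x₁
  three_le : ∀ Y : Finset α, Y ⊆ S → x₀ ∉ Y → x₁ ∉ Y → Y.Nonempty → 3 ≤ cut M Y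
  four_le : ∀ Y : Finset α, Y ⊆ S → x₀ ∉ Y → x₁ ∉ Y → 2 ≤ Y.card → 4 ≤ cut M Y

lemma Rooted.symm {S : Finset α} {M : Multiset (Sym2 α)} {x₀ x₁ : α} (h : Rooted S M x₀ x₁) :
    Rooted S M x₁ x₀ :=
  ⟨h.mem, h.loopless, h.mem₁, h.mem₀, h.ne.symm, fun Y h1 h2 h3 => h.three_le Y h1 h3 h2,
    fun Y h1 h2 h3 => h.four_le Y h1 h3 h2⟩

lemma nsmul_edge_split {m : ℕ} (hm : 2 ≤ m) (a b : α) :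
    (m - 1) • edge a b = edge a b + (m - 2) • edge a b := by
  obtain ⟨k, rfl⟩ := Nat.exists_eq_add_of_le' hm
  simp only [Nat.add_sub_cancel, show k + 2 - 1 = k + 1 by omega, succ_nsmul']

/-- If all but one of the edges at `x₀` lead to `x₁`, there is an immersion of `D_m`. -/
lemma hasD_of_one_edge {S : Finset α} {M N : Multiset (Sym2 α)} {x₀ x₁ v : α} {m : ℕ}
    (hR : Rooted S M x₀ x₁) (hm : 2 ≤ m) (hv0 : v ≠ x₀) (hv1 : v ≠ x₁)
    (hM : M = edge x₀ v + (m - 1) • edge x₀ x₁ + N) (hN : ∀ e ∈ N, x₀ ∉ e) (hS : 4 ≤ S.card) :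
    HasD m M x₀ x₁ := by
  have hvS : v ∈ S := hR.mem s(x₀, v) (by rw [hM]; simp) v (by simp)
  have hNS : ∀ e ∈ N, ∀ w ∈ e, w ∈ S := fun e he => hR.mem e (by rw [hM]; simp [he])
  have hNd : ∀ e ∈ N, ¬ e.IsDiag := fun e he => hR.loopless e (by rw [hM]; simp [he])
  have hcut : ∀ Z : Finset α, x₀ ∉ Z → x₁ ∉ Z →
      cut M Z = cut N Z + if v ∈ Z then 1 else 0 := by
    intro Z h0 h1
    rw [hM]
    simp only [cut_add, cut_nsmul, cut_edge, Finset.mem_coe, h0, h1, false_iff, ite_not, if_true,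
      mul_zero, add_zero]
    omega
  by_cases hw : ∃ w, w ≠ x₁ ∧ s(v, w) ∈ N
  · obtain ⟨w, hw1, hw⟩ := hw
    have hw0 : w ≠ x₀ := by
      rintro rfl
      exact hN _ hw (by simp)
    have hvw : v ≠ w := by
      have := hNd _ hw
      simpa using this
    have hwS := hNS _ hw w (by simp)
    obtain ⟨N', rfl⟩ := Multiset.exists_cons_of_mem hw
    -- The edge $vw$ is reserved as the rung. The rest must carry one walk from $v$ and two from $w$
    -- to $x_1$. A set containing both $v$ and $w$ has at least four edges, of which only $x_0v$ is
    -- unavailable. A set containing one of them loses $vw$, and also $x_0v$ if it contains $v$.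
    have key := imm_sink ((S.erase x₀).erase x₁) N' {v, w, w} x₁
      (by simp [hv0, hv1, hvS, hw0, hw1, hwS])
      (by
        intro e he u hu
        by_cases hu1 : u = x₁
        · exact Or.inr hu1
        · left
          have : u ≠ x₀ := by
            rintro rfl
            exact hN e (by simp [he]) hu
          simp [hu1, this, hNS e (by simp [he]) u hu])
      (by
        intro Z hZ
        have h0 : x₀ ∉ Z := fun h => by simpa using hZ h
        have h1 : x₁ ∉ Z := fun h => by simpa using hZ h
        have hZS : Z ⊆ S := fun z hz => by
          have := hZ hz
          simp only [Finset.mem_erase] at this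
          exact this.2.2
        have h := hcut Z h0 h1
        rw [cut_cons] at h
        have h3 := hR.three_le Z hZS h0 h1
        have h4 := hR.four_le Z hZS h0 h1
        simp only [Multiset.insert_eq_cons, ← Multiset.cons_zero, supply_cons, supply_zero,
          Finset.mem_coe] at h ⊢
        by_cases hvZ : v ∈ Z <;> by_cases hwZ : w ∈ Z <;>
          simp only [hvZ, hwZ, if_true, if_false, iff_true, iff_false, not_true]
            at h ⊢
        · have := h4 (Finset.one_lt_card.2 ⟨v, hvZ, w, hwZ, hvw⟩)
          omega
        · have := h3 ⟨v, hvZ⟩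
          omega
        · have := h3 ⟨w, hwZ⟩
          omega
        · omega)
    simp only [Multiset.insert_eq_cons, Multiset.map_cons, Multiset.map_singleton,
      Multiset.sum_cons, Multiset.sum_singleton] at key
    refine HasD.of_imm (N := edge x₀ v + (m - 1) • edge x₀ x₁ + edge v w +
      (edge v x₁ + (edge w x₁ + edge w x₁))) ?_ ?_
    -- The trail from $x_0$ to $w$ goes through $x_1$, using one of the $m-1$ edges between the
    -- roots and one of the walks from $w$.
    · refine HasD.of_pieces hvw hv0 hv1 hw0 hw1 (.refl _) (.refl (edge v x₁))
        (imm_path x₀ x₁ w) (.refl (edge w x₁)) (.refl (edge v w)) (.refl _) (le_of_eq ?_)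
      rw [nsmul_edge_split hm, edge_comm x₁ w]
      abel
    · rw [hM, ← Multiset.singleton_add, ← add_assoc]
      exact (Imm.refl _).add key
  · push Not at hw
    -- Now $v$ has no neighbours but the roots, and by its degree it has at least two edges to
    -- $x_1$. Any further vertex $w$ will do.
    have hcard : ∃ w ∈ S, w ≠ x₀ ∧ w ≠ x₁ ∧ w ≠ v := by
      by_contra hcon
      push Not at hcon
      have : S ⊆ {x₀, x₁, v} := by
        intro w hw
        simp only [Finset.mem_insert, Finset.mem_singleton]
        by_contra h
        push Not at h
        exact h.2.2 (hcon w hw h.1 h.2.1)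
      have := (Finset.card_le_card this).trans Finset.card_le_three
      omega
    obtain ⟨w, hwS, hw0, hw1, hwv⟩ := hcard
    set N₁ := N.filter (v ∈ ·)
    set N₂ := N.filter (v ∉ ·)
    have hNN : N₁ + N₂ = N := Multiset.filter_add_not _ _
    have hN₁ : ∀ e ∈ N₁, e = s(v, x₁) := by
      intro e he
      obtain ⟨heN, hve⟩ := Multiset.mem_filter.1 he
      obtain ⟨y, rfl⟩ := Sym2.mem_iff_exists.1 hve
      by_cases hy : y = x₁
      · rw [hy]
      · exact absurd heN (hw y hy)
    have hN₁' : N₁ = N₁.card • edge v x₁ := by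
      rw [Multiset.nsmul_singleton]
      exact Multiset.eq_replicate_card.2 hN₁
    have hk : 2 ≤ N₁.card := by
      have h1 := hcut {v} (by simpa using hv0.symm) (by simpa using hv1.symm)
      have h2 := hR.three_le {v} (by simpa using hvS) (by simpa using hv0.symm)
        (by simpa using hv1.symm) (by simp)
      have h3 : cut N₂ ({v} : Finset α) = 0 := by
        rw [cut_eq_zero]
        rintro e he ⟨⟨y, hy, hyv⟩, -⟩
        simp only [Finset.coe_singleton, Set.mem_singleton_iff] at hyv
        subst hyv
        exact (Multiset.mem_filter.1 he).2 hy
      have h4 : cut N₁ ({v} : Finset α) ≤ N₁.card := Multiset.countP_le_card _ _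
      rw [← hNN, cut_add] at h1
      simp only [Finset.mem_singleton, if_true] at h1
      omega
    have key := imm_sink (((S.erase x₀).erase x₁).erase v) N₂ {w, w, w} x₁
      (by simp [hw0, hw1, hwS, hwv])
      (by
        intro e he u hu
        obtain ⟨heN, hve⟩ := Multiset.mem_filter.1 he
        by_cases hu1 : u = x₁
        · exact Or.inr hu1
        · left
          have h1 : u ≠ x₀ := by
            rintro rfl
            exact hN e heN hu
          have h2 : u ≠ v := by
            rintro rfl
            exact hve hu
          simp [hu1, h1, h2, hNS e heN u hu])
      (by
        intro Z hZ
        have h0 : x₀ ∉ Z := fun h => by simpa using hZ h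
        have h1 : x₁ ∉ Z := fun h => by simpa using hZ h
        have h2 : v ∉ Z := fun h => by simpa using hZ h
        have hZS : Z ⊆ S := fun z hz => by
          have := hZ hz
          simp only [Finset.mem_erase] at this
          exact this.2.2.2
        have h := hcut Z h0 h1
        rw [← hNN, cut_add, hN₁', cut_nsmul] at h
        simp only [cut_edge, Finset.mem_coe, h1, h2, if_true, if_false, mul_zero, zero_add,
          add_zero] at h
        by_cases hwZ : w ∈ Z
        · have h3 := hR.three_le Z hZS h0 h1 ⟨w, hwZ⟩
          refine (supply_le_card _ _).trans ?_
          simp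
          omega
        · rw [supply_eq_zero.2 (by simpa using hwZ)]
          omega)
    simp only [Multiset.insert_eq_cons, Multiset.map_cons, Multiset.map_singleton,
      Multiset.sum_cons, Multiset.sum_singleton] at key
    refine HasD.of_imm (N := edge x₀ v + (m - 1) • edge x₀ x₁ + 2 • edge v x₁ +
      (edge w x₁ + (edge w x₁ + edge w x₁))) ?_ ?_
    -- One of the three walks from $w$ gives the rung $v$–$x_1$–$w$, one continues the edge $x_0x_1$
    -- to $w$, and one leads from $w$ to $x_1$.
    · refine HasD.of_pieces hwv.symm hv0 hv1 hw0 hw1 (.refl _) (.refl (edge v x₁))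
        (imm_path x₀ x₁ w) (.refl (edge w x₁)) (imm_path v x₁ w) (.refl _) (le_of_eq ?_)
      rw [nsmul_edge_split hm, edge_comm x₁ w, two_nsmul]
      abel
    · rw [hM, ← hNN, ← add_assoc]
      refine ((Imm.refl _).add (imm_of_le ?_)).add key
      rw [hN₁']
      exact nsmul_le_nsmul_left zero_le hk

/-- If all edges at `x₀` lead to `x₁`, there is an immersion of `D_m`. -/
lemma hasD_of_no_edge {S : Finset α} {M H : Multiset (Sym2 α)} {x₀ x₁ : α} {m : ℕ}
    (hR : Rooted S M x₀ x₁) (hm : 2 ≤ m) (hM : M = m • edge x₀ x₁ + H)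
    (hH : ∀ e ∈ H, x₀ ∉ e) (hS : 4 ≤ S.card) : HasD m M x₀ x₁ := by
  have hC : ((S.erase x₀).erase x₁).Nonempty := by
    rw [← Finset.card_pos, Finset.card_erase_of_mem (by simp [hR.mem₁, hR.ne.symm]),
      Finset.card_erase_of_mem hR.mem₀]
    omega
  have h3 := hR.three_le _ ((Finset.erase_subset _ _).trans (Finset.erase_subset _ _))
    (by simp) (by simp) hC
  -- The set of all non-root vertices is left by at least three edges, none of which ends at $x_0$.
  obtain ⟨v, hv1, hv⟩ : ∃ v, v ≠ x₁ ∧ s(v, x₁) ∈ H := by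
    by_contra hcon
    push Not at hcon
    have : cut M ((S.erase x₀).erase x₁ : Finset α) = 0 := by
      rw [hM, cut_add, cut_nsmul, cut_edge]
      simp only [Finset.mem_coe, Finset.mem_erase, ne_eq, not_true, false_and, and_false, if_true,
        mul_zero, zero_add]
      rw [cut_eq_zero]
      rintro e he ⟨⟨y, hy, hyC⟩, z, hz, hzC⟩
      have h0 : z ≠ x₀ := by
        rintro rfl
        exact hH e he hz
      simp only [Finset.mem_coe, Finset.mem_erase] at hyC hzC
      have h1 : z = x₁ := by
        by_contra h1
        exact hzC ⟨h1, h0, hR.mem e (by rw [hM]; simp [he]) z hz⟩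
      have : e = s(y, z) := (Sym2.mem_and_mem_iff (by rw [h1]; exact hyC.1)).1 ⟨hy, hz⟩
      rw [this, h1] at he
      exact hcon y hyC.1 he
    omega
  have hv0 : v ≠ x₀ := by
    rintro rfl
    exact hH _ hv (by simp)
  obtain ⟨H', rfl⟩ := Multiset.exists_cons_of_mem hv
  have hsplit : m • edge x₀ x₁ = edge x₀ x₁ + (m - 1) • edge x₀ x₁ := by
    obtain ⟨k, rfl⟩ := Nat.exists_eq_add_of_le' hm
    rw [show k + 2 - 1 = k + 1 by omega, ← succ_nsmul']
  have hvS : v ∈ S := hR.mem s(v, x₁) (by rw [hM]; simp) v (by simp)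
  -- Splitting off $x_0x_1$ and $x_1v$ creates an edge $x_0v$. Cuts around sets without roots do not
  -- change, so the case of one edge applies.
  have hR' : Rooted S (edge x₀ v + (m - 1) • edge x₀ x₁ + H') x₀ x₁ := by
    have hc : ∀ Y : Finset α, x₀ ∉ Y → x₁ ∉ Y →
        cut (edge x₀ v + (m - 1) • edge x₀ x₁ + H') Y = cut M Y := by
      intro Y h0 h1
      rw [hM]
      simp [cut_cons, h0, h1]
    have hmem : ∀ e ∈ edge x₀ v + (m - 1) • edge x₀ x₁ + H', e ∈ M ∨ e = s(x₀, v) := by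
      intro e he
      rw [hM, hsplit]
      simp only [Multiset.mem_add, Multiset.mem_cons, Multiset.mem_singleton] at he ⊢
      tauto
    refine ⟨?_, ?_, hR.mem₀, hR.mem₁, hR.ne, ?_, ?_⟩
    · intro e he w hw
      rcases hmem e he with h | rfl
      · exact hR.mem e h w hw
      · simp only [Sym2.mem_iff] at hw
        rcases hw with rfl | rfl
        exacts [hR.mem₀, hvS]
    · intro e he
      rcases hmem e he with h | rfl
      · exact hR.loopless e h
      · simpa using hv0.symm
    · intro Y h1 h2 h3 h4
      rw [hc Y h2 h3]
      exact hR.three_le Y h1 h2 h3 h4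
    · intro Y h1 h2 h3 h4
      rw [hc Y h2 h3]
      exact hR.four_le Y h1 h2 h3 h4
  refine (hasD_of_one_edge hR' hm hv0 hv1 rfl (fun e he => hH e (by simp [he])) hS).of_imm ?_
  rw [hM, hsplit, ← Multiset.singleton_add]
  have : Imm (edge x₀ x₁ + edge x₁ v + ((m - 1) • edge x₀ x₁ + H'))
      (edge x₀ v + ((m - 1) • edge x₀ x₁ + H')) := (imm_path x₀ x₁ v).add (.refl _)
  rw [edge_comm x₁ v] at this
  convert this using 1 <;> abel

/-- A tripod from `u` to the roots and to a vertex on another path gives `D_m`. -/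
lemma hasD_of_tripod {M K : Multiset (Sym2 α)} {Q : Multiset (List α)} {q : List α}
    {x₀ x₁ u z : α} {m : ℕ} (hQ : ∀ q ∈ Q, IsPath x₀ x₁ q) (hcard : Q.card + 1 = m)
    (hq : q ∈ Q) (hz : z ∈ q) (hz0 : z ≠ x₀) (hz1 : z ≠ x₁) (hu0 : u ≠ x₀) (hu1 : u ≠ x₁)
    (huz : u ≠ z) (hK : Imm K (edge u x₀ + edge u x₁ + edge u z))
    (hM : K + (Q.map walkEdges).sum ≤ M) : HasD m M x₀ x₁ := by
  obtain ⟨Q', rfl⟩ := Multiset.exists_cons_of_mem hq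
  obtain ⟨l₁, l₂, rfl⟩ := List.append_of_mem hz
  have hq' := hQ _ hq
  have h1 : Imm (walkEdges (l₁ ++ [z])) (edge x₀ z) := by
    apply imm_walkEdges
    · have := hq'.head
      cases l₁ <;> simpa using this
    · simp
  have h2 : Imm (walkEdges (z :: l₂)) (edge z x₁) := by
    apply imm_walkEdges
    · simp
    · simpa [List.getLast?_append, List.getLast?_cons] using hq'.last
  have h3 : Imm (Q'.map walkEdges).sum ((m - 2) • edge x₀ x₁) := by
    have := Imm.sum (s := Q') (f := walkEdges) (g := fun _ => edge x₀ x₁)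
      (fun l hl => (hQ l (by simp [hl])).imm)
    simp only [Multiset.card_cons] at hcard
    have hc : m - 2 = Q'.card := by omega
    simpa [hc] using this
  refine HasD.of_imm (N := (edge u x₀ + edge u x₁ + edge u z) +
    (walkEdges (l₁ ++ [z]) + walkEdges (z :: l₂) + (Q'.map walkEdges).sum)) ?_ ?_
  · refine HasD.of_pieces huz hu0 hu1 hz0 hz1 (.refl _) (.refl _) h1 h2 (.refl _) h3
      (le_of_eq ?_)
    rw [edge_comm u x₀]
    abel
  · refine (imm_of_le hM).trans (hK.add (imm_of_le (le_of_eq ?_)))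
    rw [Multiset.map_cons, Multiset.sum_cons, walkEdges_append l₁ z l₂]

/-- The edges of `N` with both ends in `Y`. -/
noncomputable def inside (N : Multiset (Sym2 α)) (Y : Finset α) : Multiset (Sym2 α) :=
  N.filter fun e => ∀ v ∈ e, v ∈ Y

lemma inside_add (N K : Multiset (Sym2 α)) (Y : Finset α) :
    inside (N + K) Y = inside N Y + inside K Y := Multiset.filter_add _ _ _

lemma inside_le (N : Multiset (Sym2 α)) (Y : Finset α) : inside N Y ≤ N := Multiset.filter_le _ _

lemma inside_eq_zero {N : Multiset (Sym2 α)} {Y : Finset α} (h : ∀ e ∈ N, ∃ v ∈ e, v ∉ Y) :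
    inside N Y = 0 := by
  rw [inside, Multiset.filter_eq_nil]
  intro e he hY
  obtain ⟨v, hv, hvY⟩ := h e he
  exact hvY (hY v hv)

lemma inside_eq_self {N : Multiset (Sym2 α)} {Y : Finset α} (h : ∀ e ∈ N, ∀ v ∈ e, v ∈ Y) :
    inside N Y = N := Multiset.filter_eq_self.2 h

lemma exists_mem_left_of_mem_walkEdges {l : List α} {a : α} {e : Sym2 α}
    (he : e ∈ walkEdges (l ++ [a])) : ∃ v ∈ e, v ∈ l := by
  induction l with
  | nil => simp at he
  | cons b l ih =>
    cases l with
    | nil =>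
      simp only [List.cons_append, List.nil_append, walkEdges_cons_cons, walkEdges_singleton,
        Multiset.cons_zero, Multiset.mem_singleton] at he
      exact ⟨b, by simp [he], by simp⟩
    | cons c l =>
      simp only [List.cons_append, walkEdges_cons_cons, Multiset.mem_cons] at he
      rcases he with rfl | he
      · exact ⟨b, by simp, by simp⟩
      · obtain ⟨v, hv, hvl⟩ := ih he
        exact ⟨v, hv, List.mem_cons_of_mem _ hvl⟩

lemma exists_mem_right_of_mem_walkEdges {l : List α} {a : α} {e : Sym2 α}
    (he : e ∈ walkEdges (a :: l)) : ∃ v ∈ e, v ∈ l := by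
  induction l generalizing a with
  | nil => simp at he
  | cons b l ih =>
    simp only [walkEdges_cons_cons, Multiset.mem_cons] at he
    rcases he with rfl | he
    · exact ⟨b, by simp, by simp⟩
    · obtain ⟨v, hv, hvl⟩ := ih he
      exact ⟨v, hv, List.mem_cons_of_mem _ hvl⟩

/-- A set `Y` meeting the path `l = l₁ ++ s ++ l₂` in the segment `s` from `a` to `b` such that
every `y ∈ Y` has a tripod to `a`, `b`, `y` inside `Y`. -/
structure Tripods (S : Finset α) (x₀ x₁ : α) (l : List α) (H : Multiset (Sym2 α)) (Y : Finset α)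
    (l₁ s l₂ : List α) (a b : α) : Prop where
  eq : l = l₁ ++ s ++ l₂
  ne_nil : l₁ ≠ []
  head : s.head? = some a
  last : s.getLast? = some b
  subset : Y ⊆ S
  mem : ∀ v ∈ s, v ∈ Y
  notMem₁ : ∀ v ∈ l₁, v ∉ Y
  notMem₂ : ∀ v ∈ l₂, v ∉ Y
  -- The centre $u$ may coincide with $a$, $b$ or $y$, the leg being a loop then. Since $x_0\notin
  -- Y$ follows from the other fields, `u ≠ x₁` ensures that $u$ is not a root.
  tripod : ∀ y ∈ Y, ∃ u ∈ Y, u ≠ x₁ ∧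
    Imm (inside (walkEdges l + H) Y) (edge u a + edge u b + edge u y)

/-! ### Growing a set with tripods along a path -/

section Grow

variable {S : Finset α} {M H : Multiset (Sym2 α)} {x₀ x₁ : α} {m : ℕ} {l : List α}
  {Q : Multiset (List α)} {Y : Finset α} {l₁ s l₂ : List α} {a b : α}

lemma Tripods.walkEdges_eq (hT : Tripods S x₀ x₁ l H Y l₁ s l₂ a b) :
    walkEdges l = walkEdges (l₁ ++ [a]) + walkEdges s + walkEdges (b :: l₂) := by
  obtain ⟨s', rfl⟩ : ∃ s', s = a :: s' := by
    have := hT.head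
    cases s with
    | nil => simp at this
    | cons c s => simp only [List.head?_cons, Option.some.injEq] at this; exact ⟨s, by rw [this]⟩
  obtain ⟨s'', h⟩ : ∃ s'', a :: s' = s'' ++ [b] := by
    have := hT.last
    rw [List.getLast?_eq_some_iff] at this
    exact this
  rw [hT.eq, List.append_assoc, List.cons_append, walkEdges_append, ← List.cons_append, h,
    List.append_assoc, List.singleton_append, walkEdges_append s'' b l₂, add_assoc]

/-- The edges inside `Y`, the two parts of the path outside and an edge leaving `Y` are
disjoint. -/
lemma Tripods.inside_add_le (hT : Tripods S x₀ x₁ l H Y l₁ s l₂ a b) {y z : α}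
    (hyz : s(y, z) ∈ H) (hz : z ∉ Y) :
    inside (walkEdges l + H) Y + walkEdges (l₁ ++ [a]) + walkEdges (b :: l₂) + edge y z ≤
      walkEdges l + H := by
  obtain ⟨H', rfl⟩ := Multiset.exists_cons_of_mem hyz
  have h1 : inside (walkEdges (l₁ ++ [a])) Y = 0 := inside_eq_zero fun e he => by
    obtain ⟨v, hv, hvl⟩ := exists_mem_left_of_mem_walkEdges he
    exact ⟨v, hv, hT.notMem₁ v hvl⟩
  have h2 : inside (walkEdges (b :: l₂)) Y = 0 := inside_eq_zero fun e he => by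
    obtain ⟨v, hv, hvl⟩ := exists_mem_right_of_mem_walkEdges he
    exact ⟨v, hv, hT.notMem₂ v hvl⟩
  have h3 : inside (edge y z) Y = 0 := inside_eq_zero fun e he => by
    rw [Multiset.mem_singleton.1 he]
    exact ⟨z, by simp, hz⟩
  rw [hT.walkEdges_eq, ← Multiset.singleton_add]
  simp only [inside_add, h1, h2, h3, add_zero, zero_add]
  calc _ ≤ walkEdges s + H' + walkEdges (l₁ ++ [a]) + walkEdges (b :: l₂) + edge y z := by
        gcongr <;> exact inside_le _ _
    _ = _ := by abel

lemma Tripods.imm_left (hT : Tripods S x₀ x₁ l H Y l₁ s l₂ a b) (hl : IsPath x₀ x₁ l) :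
    Imm (walkEdges (l₁ ++ [a])) (edge x₀ a) := by
  refine imm_walkEdges ?_ (by simp)
  have h1 := hl.head
  rw [hT.eq] at h1
  obtain ⟨c, l', rfl⟩ := List.exists_cons_of_ne_nil hT.ne_nil
  simpa using h1

lemma Tripods.imm_right (hT : Tripods S x₀ x₁ l H Y l₁ s l₂ a b) (hl : IsPath x₀ x₁ l) :
    Imm (walkEdges (b :: l₂)) (edge b x₁) := by
  refine imm_walkEdges (by simp) ?_
  have h1 := hl.last
  rw [hT.eq] at h1
  have h2 := hT.last
  rw [List.getLast?_eq_some_iff] at h2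
  obtain ⟨s', rfl⟩ := h2
  simpa [List.getLast?_append, List.getLast?_cons] using h1

lemma Tripods.x₀_notMem (hT : Tripods S x₀ x₁ l H Y l₁ s l₂ a b) (hl : IsPath x₀ x₁ l) :
    x₀ ∉ Y := by
  apply hT.notMem₁
  have h1 := hl.head
  rw [hT.eq] at h1
  obtain ⟨c, l', rfl⟩ := List.exists_cons_of_ne_nil hT.ne_nil
  simp only [List.cons_append, List.head?_cons, Option.some.injEq] at h1
  simp [h1]

/-- Adding a vertex off the path. -/
lemma Tripods.insert_free (hT : Tripods S x₀ x₁ l H Y l₁ s l₂ a b) {y z : α}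
    (hyz : s(y, z) ∈ H) (hy : y ∈ Y) (hz : z ∉ Y) (hzS : z ∈ S) (hzl : z ∉ l) :
    Tripods S x₀ x₁ l H (insert z Y) l₁ s l₂ a b := by
  have hle : inside (walkEdges l + H) Y + edge y z ≤ inside (walkEdges l + H) (insert z Y) := by
    have h1 := hT.inside_add_le hyz hz
    have h2 : inside (inside (walkEdges l + H) Y + edge y z) (insert z Y) =
        inside (walkEdges l + H) Y + edge y z := by
      refine inside_eq_self fun e he v hv => ?_
      rw [Multiset.mem_add] at he
      rcases he with he | he
      · exact Finset.mem_insert_of_mem ((Multiset.mem_filter.1 he).2 v hv)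
      · rw [Multiset.mem_singleton.1 he] at hv
        rcases Sym2.mem_iff.1 hv with rfl | rfl <;> simp [hy]
    rw [← h2]
    refine Multiset.filter_le_filter _ (le_trans ?_ h1)
    rw [add_assoc (inside _ _)]
    gcongr
    exact Multiset.le_add_right _ _
  have hzl' : z ∉ l₁ ∧ z ∉ l₂ := by
    rw [hT.eq] at hzl
    simp only [List.mem_append, not_or] at hzl
    exact ⟨hzl.1.1, hzl.2⟩
  refine ⟨hT.eq, hT.ne_nil, hT.head, hT.last, Finset.insert_subset hzS hT.subset,
    fun v hv => Finset.mem_insert_of_mem (hT.mem v hv), ?_, ?_, ?_⟩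
  · intro v hv
    rw [Finset.mem_insert, not_or]
    exact ⟨by rintro rfl; exact hzl'.1 hv, hT.notMem₁ v hv⟩
  · intro v hv
    rw [Finset.mem_insert, not_or]
    exact ⟨by rintro rfl; exact hzl'.2 hv, hT.notMem₂ v hv⟩
  · intro y' hy'
    rw [Finset.mem_insert] at hy'
    rcases hy' with rfl | hy'
    -- The new vertex takes over the tripod of $y$, prolonged by the edge $yz$.
    · obtain ⟨u, huY, hu1, hu⟩ := hT.tripod y hy
      refine ⟨u, Finset.mem_insert_of_mem huY, hu1, (imm_of_le hle).trans ?_⟩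
      refine (hu.add (.refl _)).trans ?_
      rw [add_assoc]
      exact (Imm.refl _).add (imm_path u y _)
    · obtain ⟨u, huY, hu1, hu⟩ := hT.tripod y' hy'
      exact ⟨u, Finset.mem_insert_of_mem huY, hu1,
        (imm_of_le ((Multiset.le_add_right _ _).trans hle)).trans hu⟩

/-- Adding a segment of the path behind `Y`. -/
lemma Tripods.extend_right {l₃ l₄ : List α} {y z : α}
    (hT : Tripods S x₀ x₁ l H Y l₁ s (l₃ ++ z :: l₄) a b) (hl : l.Nodup)
    (hyz : s(y, z) ∈ H) (hy : y ∈ Y) (hlS : ∀ v ∈ l, v ∈ S) :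
    Tripods S x₀ x₁ l H (Y ∪ (l₃ ++ [z]).toFinset) l₁ (s ++ (l₃ ++ [z])) l₄ a z := by
  have hz : z ∉ Y := hT.notMem₂ z (by simp)
  have hle : inside (walkEdges l + H) Y + walkEdges (b :: l₃ ++ [z]) + edge y z ≤
      inside (walkEdges l + H) (Y ∪ (l₃ ++ [z]).toFinset) := by
    have h1 := hT.inside_add_le hyz hz
    have h2 : inside (inside (walkEdges l + H) Y + walkEdges (b :: l₃ ++ [z]) + edge y z)
        (Y ∪ (l₃ ++ [z]).toFinset) =
        inside (walkEdges l + H) Y + walkEdges (b :: l₃ ++ [z]) + edge y z := by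
      refine inside_eq_self fun e he v hv => ?_
      rw [Multiset.mem_add, Multiset.mem_add] at he
      rcases he with (he | he) | he
      · exact Finset.mem_union_left _ ((Multiset.mem_filter.1 he).2 v hv)
      · have := mem_of_mem_walkEdges he hv
        simp only [List.cons_append, List.mem_cons] at this
        rcases this with rfl | h
        · exact Finset.mem_union_left _ (hT.mem _ (List.mem_of_getLast? hT.last))
        · exact Finset.mem_union_right _ (List.mem_toFinset.2 h)
      · rw [Multiset.mem_singleton.1 he] at hv
        rcases Sym2.mem_iff.1 hv with rfl | rfl
        · exact Finset.mem_union_left _ hy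
        · simp
    rw [← h2]
    refine Multiset.filter_le_filter _ (le_trans ?_ h1)
    rw [← List.cons_append, walkEdges_append (b :: l₃) z l₄]
    have : ∀ A B C D E : Multiset (Sym2 α), A + B + E ≤ A + C + (B + D) + E := by
      intro A B C D E
      calc A + B + E ≤ A + B + E + (C + D) := Multiset.le_add_right _ _
        _ = _ := by abel
    exact this _ _ _ _ _
  have hdisj := hl
  rw [hT.eq] at hdisj
  have himm : Imm (walkEdges (b :: l₃ ++ [z])) (edge b z) :=
    imm_walkEdges (by simp) (by simp [List.getLast?_cons])
  refine ⟨by rw [hT.eq]; simp, hT.ne_nil, ?_, by simp, ?_, ?_, ?_, ?_, ?_⟩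
  · have := hT.head
    cases s <;> simp_all
  · refine Finset.union_subset hT.subset fun v hv => hlS v ?_
    rw [hT.eq]
    simp only [List.mem_toFinset, List.mem_append, List.mem_singleton] at hv
    rcases hv with h | h <;> simp [h]
  · intro v hv
    rw [List.mem_append] at hv
    rcases hv with h | h
    · exact Finset.mem_union_left _ (hT.mem v h)
    · exact Finset.mem_union_right _ (List.mem_toFinset.2 h)
  · intro v hv h
    rw [Finset.mem_union] at h
    rcases h with h | h
    · exact hT.notMem₁ v hv h
    · simp only [List.nodup_append, List.mem_append, List.mem_cons] at hdisj
      simp only [List.mem_toFinset, List.mem_append, List.mem_singleton] at h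
      refine hdisj.2.2 v (Or.inl hv) v ?_ rfl
      tauto
  · intro v hv h
    rw [Finset.mem_union] at h
    rcases h with h | h
    · exact hT.notMem₂ v (by simp [hv]) h
    · simp only [List.nodup_append, List.nodup_cons, List.mem_cons] at hdisj
      simp only [List.mem_toFinset, List.mem_append, List.mem_singleton] at h
      rcases h with h | rfl
      · exact hdisj.2.1.2.2 v h v (Or.inr hv) rfl
      · exact hdisj.2.1.2.1.1 hv
  · intro y' hy'
    rw [Finset.mem_union] at hy'
    rcases hy' with hy' | hy'
    -- For an old vertex, the leg to $b$ is prolonged along the path to the new end $z$.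
    · obtain ⟨u, huY, hu1, hu⟩ := hT.tripod y' hy'
      refine ⟨u, Finset.mem_union_left _ huY, hu1, (imm_of_le hle).trans ?_⟩
      have := ((hu.add himm).of_le (Multiset.le_add_right _ (edge y z)))
      refine this.trans ?_
      have h3 := ((Imm.refl (edge u a)).add (imm_path u b z)).add (Imm.refl (edge u y'))
      convert h3 using 1
      abel
    -- For a new vertex, the tripod of $y$ is used and both the edge $yz$ and the path from $b$ are
    -- available. If the vertex lies before $z$, then $z$ is reached through $y$ and the vertex
    -- through $b$. If it is $z$ itself, both routes lead to it.
    · obtain ⟨u, huY, hu1, hu⟩ := hT.tripod y hy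
      refine ⟨u, Finset.mem_union_left _ huY, hu1, (imm_of_le hle).trans ?_⟩
      rw [List.mem_toFinset, List.mem_append, List.mem_singleton] at hy'
      rcases hy' with hy' | rfl
      · obtain ⟨l₅, l₆, rfl⟩ := List.append_of_mem hy'
        have h4 : Imm (walkEdges (b :: (l₅ ++ y' :: l₆) ++ [z])) (edge b y') := by
          rw [List.cons_append, List.append_assoc, List.cons_append, ← List.cons_append,
            walkEdges_append]
          exact (imm_walkEdges (by simp) (by simp [List.getLast?_cons])).of_le (Multiset.le_add_right _ _)
        refine ((hu.add h4).add (.refl _)).trans ?_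
        have h3 := ((Imm.refl (edge u a)).add (imm_path u y z)).add (imm_path u b y')
        convert h3 using 1
        abel
      · refine ((hu.add himm).add (.refl _)).trans ?_
        have h3 := ((Imm.refl (edge u a)).add (imm_path u b y')).add (imm_path u y y')
        convert h3 using 1
        abel

/-- Adding a segment of the path in front of `Y`. -/
lemma Tripods.extend_left {l₃ l₄ : List α} {y z : α}
    (hT : Tripods S x₀ x₁ l H Y (l₃ ++ z :: l₄) s l₂ a b) (hl : l.Nodup) (hl₃ : l₃ ≠ [])
    (hyz : s(y, z) ∈ H) (hy : y ∈ Y) (hlS : ∀ v ∈ l, v ∈ S) :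
    Tripods S x₀ x₁ l H (Y ∪ (z :: l₄).toFinset) l₃ (z :: l₄ ++ s) l₂ z b := by
  have hz : z ∉ Y := hT.notMem₁ z (by simp)
  have hle : inside (walkEdges l + H) Y + walkEdges (z :: l₄ ++ [a]) + edge y z ≤
      inside (walkEdges l + H) (Y ∪ (z :: l₄).toFinset) := by
    have h1 := hT.inside_add_le hyz hz
    have h2 : inside (inside (walkEdges l + H) Y + walkEdges (z :: l₄ ++ [a]) + edge y z)
        (Y ∪ (z :: l₄).toFinset) =
        inside (walkEdges l + H) Y + walkEdges (z :: l₄ ++ [a]) + edge y z := by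
      refine inside_eq_self fun e he v hv => ?_
      rw [Multiset.mem_add, Multiset.mem_add] at he
      rcases he with (he | he) | he
      · exact Finset.mem_union_left _ ((Multiset.mem_filter.1 he).2 v hv)
      · have := mem_of_mem_walkEdges he hv
        rw [List.mem_append, List.mem_singleton] at this
        rcases this with h | rfl
        · exact Finset.mem_union_right _ (List.mem_toFinset.2 h)
        · exact Finset.mem_union_left _ (hT.mem _ (List.mem_of_head? hT.head))
      · rw [Multiset.mem_singleton.1 he] at hv
        rcases Sym2.mem_iff.1 hv with rfl | rfl
        · exact Finset.mem_union_left _ hy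
        · simp
    rw [← h2]
    refine Multiset.filter_le_filter _ (le_trans ?_ h1)
    rw [List.append_assoc l₃, List.cons_append, walkEdges_append l₃ z]
    have : ∀ A B C D E : Multiset (Sym2 α), A + B + E ≤ A + (C + B) + D + E := by
      intro A B C D E
      calc A + B + E ≤ A + B + E + (C + D) := Multiset.le_add_right _ _
        _ = _ := by abel
    exact this _ _ _ _ _
  have hdisj := hl
  rw [hT.eq] at hdisj
  have himm : Imm (walkEdges (z :: l₄ ++ [a])) (edge a z) :=
    (imm_walkEdges (by simp) (by simp [List.getLast?_cons])).comm
  refine ⟨by rw [hT.eq]; simp, hl₃, by simp, ?_, ?_, ?_, ?_, ?_, ?_⟩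
  · have := hT.last
    rw [List.getLast?_append, this]
    rfl
  · refine Finset.union_subset hT.subset fun v hv => hlS v ?_
    rw [hT.eq]
    simp only [List.mem_toFinset, List.mem_cons] at hv
    rcases hv with h | h <;> simp [h]
  · intro v hv
    rw [List.mem_append] at hv
    rcases hv with h | h
    · exact Finset.mem_union_right _ (List.mem_toFinset.2 h)
    · exact Finset.mem_union_left _ (hT.mem v h)
  · intro v hv h
    rw [Finset.mem_union] at h
    rcases h with h | h
    · exact hT.notMem₁ v (by simp [hv]) h
    · rw [List.append_assoc, List.append_assoc] at hdisj
      rw [List.mem_toFinset] at h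
      exact (List.nodup_append.1 hdisj).2.2 v hv v (List.mem_append_left _ h) rfl
  · intro v hv h
    rw [Finset.mem_union] at h
    rcases h with h | h
    · exact hT.notMem₂ v hv h
    · rw [List.mem_toFinset] at h
      exact (List.nodup_append.1 hdisj).2.2 v
        (List.mem_append_left _ (List.mem_append_right _ h)) v hv rfl
  · intro y' hy'
    rw [Finset.mem_union] at hy'
    rcases hy' with hy' | hy'
    · obtain ⟨u, huY, hu1, hu⟩ := hT.tripod y' hy'
      refine ⟨u, Finset.mem_union_left _ huY, hu1, (imm_of_le hle).trans ?_⟩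
      have := ((hu.add himm).of_le (Multiset.le_add_right _ (edge y z)))
      refine this.trans ?_
      have h3 := ((imm_path u a z).add (Imm.refl (edge u b))).add (Imm.refl (edge u y'))
      convert h3 using 1
      abel
    · obtain ⟨u, huY, hu1, hu⟩ := hT.tripod y hy
      refine ⟨u, Finset.mem_union_left _ huY, hu1, (imm_of_le hle).trans ?_⟩
      rw [List.mem_toFinset, List.mem_cons] at hy'
      rcases hy' with rfl | hy'
      · refine ((hu.add himm).add (.refl _)).trans ?_
        have h3 := ((imm_path u a y').add (Imm.refl (edge u b))).add (imm_path u y y')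
        convert h3 using 1
        abel
      · obtain ⟨l₅, l₆, rfl⟩ := List.append_of_mem hy'
        have h4 : Imm (walkEdges (z :: (l₅ ++ y' :: l₆) ++ [a])) (edge a y') := by
          rw [List.cons_append, List.append_assoc, List.cons_append, ← List.cons_append,
            walkEdges_append]
          exact (Imm.comm (imm_walkEdges (a := y') (b := a) (by simp)
            (by simp [List.getLast?_cons, List.getLast?_append]))).of_le
            (Multiset.le_add_left _ _)
        refine ((hu.add h4).add (.refl _)).trans ?_
        have h3 := ((imm_path u y z).add (Imm.refl (edge u b))).add (imm_path u a y')
        convert h3 using 1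
        abel

end Grow

lemma IsPath.exists_eq {x₀ x₁ : α} {l : List α} (h : IsPath x₀ x₁ l) (hne : x₀ ≠ x₁) :
    ∃ l', l = x₀ :: l' ++ [x₁] := by
  have h1 := h.head
  have h2 := h.last
  cases l with
  | nil => simp at h1
  | cons a l =>
    simp only [List.head?_cons, Option.some.injEq] at h1
    subst h1
    rw [List.getLast?_eq_some_iff] at h2
    obtain ⟨l', hl'⟩ := h2
    cases l' with
    | nil => simp at hl'; exact absurd hl'.1 hne
    | cons b l' =>
      simp only [List.cons_append, List.cons.injEq] at hl'
      exact ⟨l', by rw [hl'.2]; simp⟩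

lemma IsPath.mem_of_le {S : Finset α} {M : Multiset (Sym2 α)} {x₀ x₁ : α} {l : List α}
    (h : IsPath x₀ x₁ l) (hR : Rooted S M x₀ x₁) (hM : walkEdges l ≤ M) : ∀ v ∈ l, v ∈ S := by
  intro v hv
  rcases exists_edge_of_mem_walk hv with h1 | ⟨e, he, hve⟩
  · have h2 := h.head
    rw [h1] at h2
    simp only [List.head?_cons, Option.some.injEq] at h2
    rw [h2]
    exact hR.mem₀
  · exact hR.mem e (Multiset.mem_of_le hM he) v hve

lemma sum_paths_cut {Q : Multiset (List α)} {X : Set α} {k : ℕ}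
    (h : ∀ q ∈ Q, cut (walkEdges q) X = k) : cut (Q.map walkEdges).sum X = Q.card * k := by
  induction Q using Multiset.induction_on with
  | empty => simp
  | cons q Q ih =>
    rw [Multiset.map_cons, Multiset.sum_cons, cut_add, h q (by simp),
      ih fun q hq => h q (by simp [hq]), Multiset.card_cons]
    ring

/-- A path whose only vertex in `X` is its last one crosses `X` once. -/
lemma IsPath.cut_eq_one {x₀ x₁ : α} {l : List α} {X : Set α} (h : IsPath x₀ x₁ l) (hne : x₀ ≠ x₁)
    (h1 : x₁ ∈ X) (hX : ∀ v ∈ l, v ∈ X → v = x₁) : cut (walkEdges l) X = 1 := by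
  obtain ⟨l', rfl⟩ := h.exists_eq hne
  apply cut_walkEdges_append (by simp) (by simp)
  · intro v hv hvX
    have := hX v (by rw [List.mem_append]; exact Or.inl hv) hvX
    subst this
    have := h.nodup
    rw [List.nodup_append] at this
    exact this.2.2 v hv v (by simp) rfl
  · simpa using h1

lemma sum_direct {Q : Multiset (List α)} {x₀ x₁ : α} (h : ∀ q ∈ Q, q = [x₀, x₁]) :
    (Q.map walkEdges).sum = Q.card • edge x₀ x₁ := by
  have : Q = Multiset.replicate Q.card [x₀, x₁] := Multiset.eq_replicate_card.2 h
  rw [this]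
  simp [Multiset.nsmul_singleton]

/-- A path all of whose vertices are roots is a single edge. -/
lemma IsPath.eq_pair {x₀ x₁ : α} {l : List α} (h : IsPath x₀ x₁ l) (hne : x₀ ≠ x₁)
    (hl : ∀ v ∈ l, v = x₀ ∨ v = x₁) : l = [x₀, x₁] := by
  obtain ⟨l', rfl⟩ := h.exists_eq hne
  cases l' with
  | nil => rfl
  | cons c l' =>
    have h1 := h.nodup
    rcases hl c (by simp) with rfl | rfl <;> simp at h1

/-! ### A vertex that lies on exactly one of the paths -/

section

variable {S : Finset α} {M H : Multiset (Sym2 α)} {x₀ x₁ : α} {m : ℕ} {l : List α}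
  {Q : Multiset (List α)}

/-- A set containing `x₁` but not `x₀` with only `m` edges leaving it is everything but `x₀`. -/
lemma sdiff_eq_of_cut_le (hR : Rooted S M x₀ x₁)
    (hint : ∀ X : Finset α, X ⊆ S → x₀ ∈ X → x₁ ∉ X → 2 ≤ X.card → 2 ≤ (S \ X).card →
      m + 1 ≤ cut M X)
    {Y : Finset α} (hY : Y ⊆ S) (h0 : x₀ ∉ Y) (h1 : x₁ ∈ Y) (hcard : 2 ≤ Y.card)
    (hcut : cut M Y ≤ m) : ∀ v ∈ S, v ≠ x₀ → v ∈ Y := by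
  intro v hv hv0
  by_contra hvY
  have hc : cut M (S \ Y : Finset α) = cut M Y := by
    rw [← cut_compl]
    apply cut_congr
    intro e he w hw
    simp [hR.mem e he w hw]
  have := hint (S \ Y) Finset.sdiff_subset (by simp [hR.mem₀, h0]) (by simp [h1])
    (Finset.one_lt_card.2 ⟨x₀, by simp [hR.mem₀, h0], v, by simp [hv, hvY], hv0.symm⟩)
    (by rwa [Finset.sdiff_sdiff_eq_self hY])
  omega

/-- Grow $Y$ along edges of $H$ leaving it. As soon as a tripod can reach a non-root vertex of
another path, `hasD_of_tripod` gives $D_m$; otherwise $Y$ still meets the other paths only in $x_1$,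
and the induction continues. When no edge of $H$ leaves $Y$, two cases remain. If $x_1\notin Y$,
only two edges of $l$ leave $Y$, which is too few. If $x_1\in Y$, exactly $m$ edges leave $Y$, so
$Y$ is everything but $x_0$, the other paths are single edges, and `hasD_of_one_edge` applies. -/
lemma hasD_of_tripods (hR : Rooted S M x₀ x₁) (hm : 2 ≤ m) (hS : 4 ≤ S.card)
    (hint : ∀ X : Finset α, X ⊆ S → x₀ ∈ X → x₁ ∉ X → 2 ≤ X.card → 2 ≤ (S \ X).card →
      m + 1 ≤ cut M X)
    (hM : M = walkEdges l + H + (Q.map walkEdges).sum) (hl : IsPath x₀ x₁ l)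
    (hQ : ∀ q ∈ Q, IsPath x₀ x₁ q) (hcard : Q.card + 1 = m) (hH : ∀ e ∈ H, x₀ ∉ e) {w : α}
    (hw0 : w ≠ x₀) (hw1 : w ≠ x₁) {Y : Finset α} {l₁ s l₂ : List α} {a b : α}
    (hT : Tripods S x₀ x₁ l H Y l₁ s l₂ a b) (hws : w ∈ s)
    (hQY : ∀ q ∈ Q, ∀ v ∈ q, v ∈ Y → v = x₁) : HasD m M x₀ x₁ := by
  induction hn : S.card - Y.card using Nat.strong_induction_on generalizing Y l₁ s l₂ a b with
  | _ n ih =>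
  have hlM : walkEdges l ≤ M := by
    rw [hM, add_assoc]
    exact Multiset.le_add_right _ _
  have hlS := hl.mem_of_le hR hlM
  have hne := hR.ne
  have h0Y := hT.x₀_notMem hl
  have hl0 : ∀ v ∈ s ++ l₂, v ≠ x₀ := by
    intro v hv
    rintro rfl
    have h1 := hl.nodup
    have h2 := hl.head
    obtain ⟨c, l', rfl⟩ := List.exists_cons_of_ne_nil hT.ne_nil
    rw [hT.eq] at h1 h2
    simp only [List.cons_append, List.head?_cons, Option.some.injEq] at h2
    subst h2
    simp only [List.cons_append, List.nodup_cons, List.mem_append, not_or] at h1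
    rw [List.mem_append] at hv
    tauto
  by_contra hD
  by_cases hcr : ∃ y ∈ Y, ∃ z, z ∉ Y ∧ s(y, z) ∈ H
  · obtain ⟨y, hy, z, hz, hyz⟩ := hcr
    have hz0 : z ≠ x₀ := by
      rintro rfl
      exact hH _ hyz (by simp)
    have hzS : z ∈ S := hR.mem s(y, z) (by rw [hM]; simp [hyz]) z (by simp)
    have hrec : ∀ {Y' : Finset α} {l₁' s' l₂' : List α} {a' b' : α},
        Tripods S x₀ x₁ l H Y' l₁' s' l₂' a' b' → w ∈ s' →
        (∀ q ∈ Q, ∀ v ∈ q, v ∈ Y' → v = x₁) → Y ⊆ Y' → z ∈ Y' → False := by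
      intro Y' l₁' s' l₂' a' b' hT' hws' hQY' hYY' hzY'
      refine hD (ih _ ?_ hT' hws' hQY' rfl)
      have h1 : Y.card < Y'.card :=
        Finset.card_lt_card (Finset.ssubset_iff_subset_ne.2 ⟨hYY', by
          rintro rfl
          exact hz hzY'⟩)
      have h2 := Finset.card_le_card hT'.subset
      omega
    -- If the tripod of $y$, the two outer parts of $l$ and the edge $yz$ can be rerouted to a
    -- tripod from $u$ to the roots and $v$, then $v$ lies on no other path.
    have hrung : ∀ v, v ≠ x₀ → v ≠ x₁ → v ∉ Y → (∀ u, Imm (edge u a + edge u b + edge u y +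
        (walkEdges (l₁ ++ [a]) + walkEdges (b :: l₂) + edge y z))
        (edge u x₀ + edge u x₁ + edge u v)) → ∀ q ∈ Q, v ∉ q := by
      intro v hv0 hv1 hvY himm q hq hvq
      obtain ⟨u, huY, hu1, hu⟩ := hT.tripod y hy
      refine hD (hasD_of_tripod hQ hcard hq hvq hv0 hv1 (by rintro rfl; exact h0Y huY) hu1
        (by rintro rfl; exact hvY huY) ((hu.add (.refl _)).trans (himm u)) ?_)
      rw [hM]
      gcongr ?_ + _
      rw [← add_assoc, ← add_assoc]
      exact hT.inside_add_le hyz hz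
    have hleft := hT.imm_left hl
    have hright := hT.imm_right hl
    have hzQ : z ≠ x₁ → ∀ q ∈ Q, z ∉ q := by
      intro hz1
      refine hrung z hz0 hz1 hz fun u => ?_
      have h1 := ((imm_path u a x₀).add (imm_path u b x₁)).add (imm_path u y z)
      refine (((Imm.refl (edge u a + edge u b + edge u y)).add
        ((hleft.comm.add hright).add (.refl (edge y z))))).trans ?_
      convert h1 using 1
      abel
    by_cases hzl : z ∈ l
    · rw [hT.eq, List.append_assoc, List.mem_append, List.mem_append] at hzl
      rcases hzl with hzl | hzl | hzl
      · obtain ⟨l₃, l₄, rfl⟩ := List.append_of_mem hzl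
        have hl₃ : l₃ ≠ [] := by
          rintro rfl
          have h2 := hl.head
          rw [hT.eq] at h2
          simp only [List.nil_append, List.cons_append, List.head?_cons, Option.some.injEq] at h2
          exact hz0 h2
        have hnd := hl.nodup
        rw [hT.eq] at hnd
        have hx1 : ∀ v ∈ z :: l₄, v ≠ x₁ := by
          rintro v hv rfl
          have h2 : v ∈ s ++ l₂ := by
            apply List.mem_of_getLast?
            have h3 := hl.last
            have h4 : s ++ l₂ ≠ [] := by
              intro h
              rw [List.append_eq_nil_iff] at h
              rw [h.1] at hws
              simp at hws
            obtain ⟨t, c, hc⟩ : ∃ t c, s ++ l₂ = t ++ [c] :=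
              ⟨_, _, (List.dropLast_append_getLast h4).symm⟩
            rw [hT.eq, List.append_assoc, hc] at h3
            rw [hc]
            simpa [List.getLast?_append, List.getLast?_cons] using h3
          rw [List.append_assoc] at hnd
          exact (List.nodup_append.1 hnd).2.2 v (List.mem_append_right _ hv) v h2 rfl
        have hx0 : ∀ v ∈ z :: l₄, v ≠ x₀ := by
          rintro v hv rfl
          have h2 := hl.head
          obtain ⟨c, l', rfl⟩ := List.exists_cons_of_ne_nil hl₃
          rw [hT.eq] at h2
          simp only [List.cons_append, List.head?_cons, Option.some.injEq] at h2
          subst h2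
          rw [List.append_assoc, List.append_assoc] at hnd
          exact (List.nodup_append.1 hnd).2.2 c (by simp) c (List.mem_append_left _ hv) rfl
        refine hrec (hT.extend_left hl.nodup hl₃ hyz hy hlS) (List.mem_append_right _ hws) ?_
          Finset.subset_union_left (by simp)
        intro q hq v hvq hv
        rw [Finset.mem_union] at hv
        rcases hv with hv | hv
        · exact hQY q hq v hvq hv
        exfalso
        rw [List.mem_toFinset] at hv
        rcases List.mem_cons.1 hv with rfl | hv'
        · exact hzQ (hx1 v hv) q hq hvq
        -- For a vertex $v$ of $l$ between $z$ and $Y$ the two routes are exchanged: $u$ reaches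
        -- $x_0$ through $y$ and $z$, which frees the leg to $a$ to continue back along $l$ to $v$.
        refine hrung v (hx0 v hv) (hx1 v hv) (hT.notMem₁ v (List.mem_append_right _ hv))
          (fun u => ?_) q hq hvq
        obtain ⟨l₅, l₆, rfl⟩ := List.append_of_mem hv'
        have h3 : Imm (walkEdges (l₃ ++ z :: (l₅ ++ v :: l₆) ++ [a])) (edge x₀ z + edge v a) := by
          have h4 : walkEdges (l₃ ++ z :: (l₅ ++ v :: l₆) ++ [a]) = walkEdges (l₃ ++ [z]) +
              walkEdges (z :: l₅ ++ [v]) + walkEdges (v :: l₆ ++ [a]) := by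
            rw [List.append_assoc, List.cons_append, walkEdges_append, List.append_assoc,
              List.cons_append, ← List.cons_append, walkEdges_append (z :: l₅), add_assoc]
          rw [h4, add_right_comm]
          refine Imm.of_le (Imm.add (imm_walkEdges ?_ (by simp)) (imm_walkEdges (by simp)
            (by simp [List.getLast?_cons]))) (Multiset.le_add_right _ _)
          have h5 := hl.head
          rw [hT.eq] at h5
          obtain ⟨c, l', rfl⟩ := List.exists_cons_of_ne_nil hl₃
          simpa using h5
        have h1 := (((imm_path u y z).path (.refl (edge z x₀))).add (imm_path u b x₁)).add
          (imm_path u a v)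
        refine (((Imm.refl (edge u a + edge u b + edge u y)).add
          ((h3.add hright).add (.refl (edge y z))))).trans ?_
        rw [edge_comm x₀ z, edge_comm v a]
        convert h1 using 1
        abel
      · exact absurd (hT.mem z hzl) hz
      · obtain ⟨l₃, l₄, rfl⟩ := List.append_of_mem hzl
        have hnd := hl.nodup
        rw [hT.eq] at hnd
        have hx1 : ∀ v ∈ l₃, v ≠ x₁ := by
          rintro v hv rfl
          have h2 : v ∈ z :: l₄ := by
            apply List.mem_of_getLast?
            have h3 := hl.last
            rw [hT.eq] at h3
            simpa [List.getLast?_append, List.getLast?_cons] using h3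
          rw [← List.append_assoc] at hnd
          exact (List.nodup_append.1 hnd).2.2 v (List.mem_append_right _ hv) v h2 rfl
        refine hrec (hT.extend_right hl.nodup hyz hy hlS) (List.mem_append_left _ hws) ?_
          Finset.subset_union_left (by simp)
        intro q hq v hvq hv
        rw [Finset.mem_union] at hv
        rcases hv with hv | hv
        · exact hQY q hq v hvq hv
        rw [List.mem_toFinset, List.mem_append, List.mem_singleton] at hv
        rcases hv with hv | rfl
        swap
        · by_contra hv1
          exact hzQ hv1 q hq hvq
        exfalso
        -- The mirror image: $x_1$ is reached through $y$ and $z$, and $v$ through $b$.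
        refine hrung v (hl0 v (by simp [hv])) (hx1 v hv) (hT.notMem₂ v (by simp [hv]))
          (fun u => ?_) q hq hvq
        obtain ⟨l₅, l₆, rfl⟩ := List.append_of_mem hv
        have h3 : Imm (walkEdges (b :: (l₅ ++ v :: l₆ ++ z :: l₄))) (edge b v + edge z x₁) := by
          have h4 : walkEdges (b :: (l₅ ++ v :: l₆ ++ z :: l₄)) = walkEdges (b :: l₅ ++ [v]) +
              walkEdges (v :: l₆ ++ [z]) + walkEdges (z :: l₄) := by
            rw [List.append_assoc, List.cons_append, ← List.cons_append, walkEdges_append (b :: l₅),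
              ← List.cons_append, walkEdges_append (v :: l₆), add_assoc]
          rw [h4, add_right_comm]
          refine Imm.of_le (Imm.add (imm_walkEdges (by simp) (by simp [List.getLast?_cons]))
            (imm_walkEdges (by simp) ?_)) (Multiset.le_add_right _ _)
          have h5 := hl.last
          rw [hT.eq] at h5
          simpa [List.getLast?_append, List.getLast?_cons] using h5
        have h1 := ((imm_path u a x₀).add ((imm_path u y z).path (.refl (edge z x₁)))).add
          (imm_path u b v)
        refine (((Imm.refl (edge u a + edge u b + edge u y)).add
          ((hleft.comm.add h3).add (.refl (edge y z))))).trans ?_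
        convert h1 using 1
        abel
    · refine hrec (hT.insert_free hyz hy hz hzS hzl) hws ?_ (Finset.subset_insert _ _) (by simp)
      intro q hq v hvq hv
      rw [Finset.mem_insert] at hv
      rcases hv with rfl | hv
      · by_contra hv1
        exact hzQ hv1 q hq hvq
      · exact hQY q hq v hvq hv
  · push Not at hcr
    have hHcut : cut H Y = 0 := by
      rw [cut_eq_zero]
      rintro e he ⟨⟨y, hy, hyY⟩, z, hz, hzY⟩
      have : e = s(y, z) := (Sym2.mem_and_mem_iff (by
        rintro rfl
        exact hzY hyY)).1 ⟨hy, hz⟩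
      exact hcr y hyY z hzY (this ▸ he)
    have hs : s ≠ [] := by
      rintro rfl
      simp at hws
    by_cases hx1 : x₁ ∈ Y
    · have hl₂ : l₂ = [] := by
        by_contra h
        obtain ⟨t, c, rfl⟩ : ∃ t c, l₂ = t ++ [c] := ⟨_, _, (List.dropLast_append_getLast h).symm⟩
        have h2 := hl.last
        rw [hT.eq] at h2
        rw [← List.append_assoc, List.getLast?_append] at h2
        simp only [List.getLast?_singleton, Option.some_or, Option.some.injEq] at h2
        exact hT.notMem₂ c (by simp) (h2 ▸ hx1)
      subst hl₂
      have hlcut : cut (walkEdges l) Y = 1 := by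
        rw [hT.eq, List.append_nil]
        exact cut_walkEdges_append hT.ne_nil hs hT.notMem₁ hT.mem
      have hQcut := sum_paths_cut (Q := Q) (X := (Y : Set α)) (k := 1)
        fun q hq => (hQ q hq).cut_eq_one hne hx1 (hQY q hq)
      have hall := sdiff_eq_of_cut_le hR hint hT.subset h0Y hx1
        (Finset.one_lt_card.2 ⟨x₁, hx1, w, hT.mem w hws, hw1.symm⟩) (by
          rw [hM, cut_add, cut_add, hHcut, hlcut, hQcut]
          omega)
      -- As $Y$ contains every vertex except $x_0$ and meets these paths only in $x_1$, they have no
      -- inner vertices.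
      have hQd : ∀ q ∈ Q, q = [x₀, x₁] := by
        intro q hq
        refine (hQ q hq).eq_pair hne fun v hv => ?_
        by_cases hv0 : v = x₀
        · exact Or.inl hv0
        · refine Or.inr (hQY q hq v hv (hall v ?_ hv0))
          refine (hQ q hq).mem_of_le hR ?_ v hv
          rw [hM]
          exact (le_sum_of_mem walkEdges hq).trans (Multiset.le_add_left _ _)
      obtain ⟨l', rfl⟩ := hl.exists_eq hne
      cases l' with
      | nil =>
        have : w ∈ x₀ :: [] ++ [x₁] := by
          rw [hT.eq]
          simp [hws]
        simp at this
        tauto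
      | cons c l' =>
        have hnd := hl.nodup
        simp only [List.cons_append, List.nodup_cons, List.mem_cons, List.mem_append, not_or,
          List.not_mem_nil, not_false_eq_true] at hnd
        -- The one remaining edge at $x_0$ is the first edge of $l$. Its end $c$ is not $x_1$
        -- because $l$ is a path that continues after $c$.
        refine hD (hasD_of_one_edge (v := c) (N := walkEdges (c :: l' ++ [x₁]) + H) hR hm
          (Ne.symm hnd.1.1) hnd.2.1.2.1 ?_ ?_ hS)
        · rw [hM, sum_direct hQd, show Q.card = m - 1 by omega, List.cons_append, List.cons_append,
            walkEdges_cons_cons, ← Multiset.singleton_add, ← List.cons_append]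
          abel
        · intro e he h0
          rw [Multiset.mem_add] at he
          rcases he with he | he
          · have := mem_of_mem_walkEdges he h0
            simp only [List.mem_append, List.mem_cons, List.not_mem_nil, or_false] at this
            tauto
          · exact hH e he h0
    · have hl₂ : l₂ ≠ [] := by
        rintro rfl
        apply hx1
        have h2 := hl.last
        rw [hT.eq, List.append_nil, List.getLast?_append] at h2
        rw [hT.last] at h2
        simp only [Option.some_or, Option.some.injEq] at h2
        exact h2 ▸ hT.mem _ (List.mem_of_getLast? hT.last)
      have hlcut : cut (walkEdges l) Y = 2 := by
        rw [hT.eq]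
        exact cut_walkEdges_append_append hT.ne_nil hs hl₂ hT.notMem₁ hT.mem hT.notMem₂
      have hQcut := sum_paths_cut (Q := Q) (X := (Y : Set α)) (k := 0)
        fun q hq => cut_walkEdges_eq_zero (Or.inr fun v hv hvY =>
          hx1 (hQY q hq v hv hvY ▸ hvY))
      have := hR.three_le Y hT.subset h0Y hx1 ⟨w, hT.mem w hws⟩
      rw [hM, cut_add, cut_add, hHcut, hlcut, hQcut] at this
      omega

/-- If a vertex other than the roots lies on exactly one of the `m` paths, there is an immersion
of `D_m`. -/
lemma hasD_of_unique_path (hR : Rooted S M x₀ x₁) (hm : 2 ≤ m) (hS : 4 ≤ S.card)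
    (hint : ∀ X : Finset α, X ⊆ S → x₀ ∈ X → x₁ ∉ X → 2 ≤ X.card → 2 ≤ (S \ X).card →
      m + 1 ≤ cut M X)
    (hM : M = walkEdges l + H + (Q.map walkEdges).sum) (hl : IsPath x₀ x₁ l)
    (hQ : ∀ q ∈ Q, IsPath x₀ x₁ q) (hcard : Q.card + 1 = m) (hH : ∀ e ∈ H, x₀ ∉ e) {w : α}
    (hw0 : w ≠ x₀) (hw1 : w ≠ x₁) (hwl : w ∈ l) (hwQ : ∀ q ∈ Q, w ∉ q) : HasD m M x₀ x₁ := by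
  have hlM : walkEdges l ≤ M := by
    rw [hM, add_assoc]
    exact Multiset.le_add_right _ _
  have hlS := hl.mem_of_le hR hlM
  obtain ⟨l₁, l₂, rfl⟩ := List.append_of_mem hwl
  have hnd := hl.nodup
  rw [List.nodup_append, List.nodup_cons] at hnd
  refine hasD_of_tripods (Y := {w}) (s := [w]) (l₁ := l₁) (l₂ := l₂) (a := w) (b := w) hR hm hS hint
    hM hl hQ hcard hH hw0 hw1 ⟨by simp, ?_, rfl, rfl, by simpa using hlS w hwl, by simp, ?_, ?_, ?_⟩
    (by simp) ?_
  · rintro rfl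
    have := hl.head
    simp only [List.nil_append, List.head?_cons, Option.some.injEq] at this
    exact hw0 this
  · intro v hv h
    rw [Finset.mem_singleton] at h
    exact hnd.2.2 v hv w (by simp) h
  · intro v hv h
    rw [Finset.mem_singleton] at h
    exact hnd.2.1.1 (h ▸ hv)
  · intro y hy
    rw [Finset.mem_singleton] at hy
    subst hy
    -- The initial tripod at $w$ consists of three loops.
    refine ⟨y, by simp, hw1, ?_⟩
    have := ((imm_loop y 0).add (imm_loop y 0)).add (imm_loop y 0)
    exact (imm_zero _).trans this
  · intro q hq v hv h
    rw [Finset.mem_singleton] at h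
    exact absurd (h ▸ hv) (hwQ q hq)

end

lemma exists_sum_add_of_le {M N : Multiset (Sym2 α)} (h : N ≤ M) : ∃ H, M = N + H :=
  Multiset.le_iff_exists_add.1 h

lemma IsPath.imm_through {x₀ x₁ a : α} {l : List α} (h : IsPath x₀ x₁ l) (ha : a ∈ l) :
    Imm (walkEdges l) (edge x₀ a + edge a x₁) := by
  obtain ⟨l₁, l₂, rfl⟩ := List.append_of_mem ha
  rw [walkEdges_append]
  refine (imm_walkEdges ?_ (by simp)).add (imm_walkEdges (by simp) ?_)
  · have := h.head
    cases l₁ <;> simpa using this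
  · simpa [List.getLast?_append, List.getLast?_cons] using h.last

/-- Vertices joined by a walk in `H` are joined by a path in `H`. -/
lemma imm_of_reach {S : Finset α} {H : Multiset (Sym2 α)} (hH : ∀ e ∈ H, ∀ v ∈ e, v ∈ S) {y z : α}
    (h : ReflTransGen (fun a b => s(a, b) ∈ H) y z) : Imm H (edge y z) := by
  by_cases hyz : y = z
  · subst hyz
    exact imm_loop _ _
  have hyS : y ∈ S := by
    rcases h.cases_head with h | ⟨w, hw, -⟩
    · exact absurd h hyz
    · exact hH _ hw y (by simp)
  have := imm_sink (S.erase z) H {y} z (by simpa using ⟨hyz, hyS⟩)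
    (fun e he v hv => by
      by_cases hvz : v = z
      · exact Or.inr hvz
      · exact Or.inl (Finset.mem_erase.2 ⟨hvz, hH e he v hv⟩))
    (by
      intro Z hZ
      by_cases hyZ : y ∈ Z
      · refine (supply_le_card _ _).trans ?_
        simp only [Multiset.card_singleton]
        by_contra hcon
        have h0 : cut H Z = 0 := by omega
        rw [cut_eq_zero] at h0
        have hzZ : z ∈ Z := by
          clear hyz hZ
          induction h with
          | refl => exact hyZ
          | tail _ hab ih =>
            have := h0 _ hab
            rw [crosses_mk, not_not] at this
            exact this.1 ih
        have := hZ hzZ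
        simp at this
      · rw [supply_eq_zero.2 (by simpa using hyZ)]
        omega)
  simpa using this

/-- The slack in submodularity comes only from edges between $X\setminus Y$ and $Y\setminus X$. -/
lemma cut_modular {M : Multiset (Sym2 α)} {X Y : Set α}
    (h : ∀ a ∈ X \ Y, ∀ b ∈ Y \ X, s(a, b) ∉ M) :
    cut M X + cut M Y ≤ cut M (X ∪ Y) + cut M (X ∩ Y) := by
  induction M using Multiset.induction_on with
  | empty => simp
  | cons e M ih =>
    have ih := ih fun a ha b hb hM => h a ha b hb (Multiset.mem_cons_of_mem hM)
    induction e with | _ a b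
    have h1 := h a
    have h2 := h b
    simp only [cut_cons, Set.mem_union, Set.mem_inter_iff]
    have h3 : a ∈ X → a ∉ Y → b ∈ Y → b ∈ X := by
      intro h3 h4 h5
      by_contra h6
      exact h1 ⟨h3, h4⟩ b ⟨h5, h6⟩ (by simp)
    have h4 : b ∈ X → b ∉ Y → a ∈ Y → a ∈ X := by
      intro h3 h4 h5
      by_contra h6
      exact h2 ⟨h3, h4⟩ a ⟨h5, h6⟩ (by rw [Sym2.eq_swap]; simp)
    by_cases h5 : a ∈ X <;> by_cases h6 : b ∈ X <;> by_cases h7 : a ∈ Y <;>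
      by_cases h8 : b ∈ Y <;> simp_all <;> omega

/-- Two trails through `a` and three edge-disjoint walks from `z` to `{a, x₁}` give `D_m`, provided
that `a` and `x₁` are joined by a further walk if the three walks all lead to `x₁`. -/
lemma hasD_of_theta {M K : Multiset (Sym2 α)} {x₀ x₁ a z : α} {m : ℕ}
    (ha0 : a ≠ x₀) (ha1 : a ≠ x₁) (hz0 : z ≠ x₀) (hz1 : z ≠ x₁) (haz : a ≠ z)
    (hM : Imm M (2 • (edge x₀ a + edge a x₁) + (m - 2) • edge x₀ x₁ + K))
    (hK : Imm K (edge z a + edge z a + edge z a) ∨ Imm K (edge z a + edge z a + edge z x₁) ∨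
      Imm K (edge z a + edge z x₁ + edge z x₁) ∨
      Imm K (edge z x₁ + edge z x₁ + edge z x₁ + edge a x₁)) : HasD m M x₀ x₁ := by
  rcases hK with hK | hK | hK | hK <;>
    refine HasD.of_imm ?_ (hM.trans ((Imm.refl _).add hK)) <;> rw [two_nsmul]
  · refine HasD.of_pieces haz ha0 ha1 hz0 hz1 (.refl (edge x₀ a)) (.refl (edge a x₁))
      (imm_path x₀ a z) (imm_path z a x₁) (.refl (edge a z)) (.refl _) (le_of_eq ?_)
    rw [edge_comm a z]
    abel
  · refine HasD.of_pieces haz ha0 ha1 hz0 hz1 (.refl (edge x₀ a)) (.refl (edge a x₁))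
      (imm_path x₀ a z) (.refl (edge z x₁)) (.refl (edge a z)) (.refl _)
      ((Multiset.le_add_right _ (edge a x₁)).trans (le_of_eq ?_))
    rw [edge_comm a z]
    abel
  · refine HasD.of_pieces haz ha0 ha1 hz0 hz1 (.refl (edge x₀ a)) (.refl (edge a x₁))
      (imm_path x₀ a z) (.refl (edge z x₁)) (imm_path a x₁ z) (.refl _) (le_of_eq ?_)
    rw [edge_comm a z, edge_comm x₁ z]
    abel
  -- Here the whole second trail through $a$ serves to reach $z$ via $x_1$, and the additional walk
  -- from $a$ to $x_1$ makes the rung possible.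
  · refine HasD.of_pieces haz ha0 ha1 hz0 hz1 (.refl (edge x₀ a)) (.refl (edge a x₁))
      ((imm_path x₀ a x₁).path (.refl (edge x₁ z))) (.refl (edge z x₁)) (imm_path a x₁ z) (.refl _)
      (le_of_eq ?_)
    rw [edge_comm x₁ z]
    abel

/-! ### Paths whose inner vertices are all shared -/

section

variable {S : Finset α} {M H : Multiset (Sym2 α)} {x₀ x₁ : α} {m : ℕ} {P : Multiset (List α)}

/-- Let $Y$ be a component of the left-over graph $H$ that contains an edge. Two distinct non-root
path vertices in $Y$ are joined by a rung in $H$, which gives $D_m$ since the second one lies on a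
further path. If $Y$ contains none, counting the edges leaving $Y$ forces all paths to be single
edges and `hasD_of_no_edge` applies. So exactly one such vertex $a$ remains, and two paths pass
through it. Subsets of $Y$ avoiding $a$ and $x_1$ are left only by edges of $H$, hence by at least
three, and Menger's theorem provides the walks for `hasD_of_theta`. -/
lemma hasD_of_shared (hR : Rooted S M x₀ x₁) (hm : 2 ≤ m) (hS : 4 ≤ S.card)
    (hint : ∀ X : Finset α, X ⊆ S → x₀ ∈ X → x₁ ∉ X → 2 ≤ X.card → 2 ≤ (S \ X).card →
      m + 1 ≤ cut M X)
    (hM : M = (P.map walkEdges).sum + H) (hP : ∀ q ∈ P, IsPath x₀ x₁ q) (hcard : P.card = m)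
    (hH : ∀ e ∈ H, x₀ ∉ e) (hH0 : H ≠ 0)
    (hsh : ∀ l Q, P = l ::ₘ Q → ∀ v ∈ l, v ≠ x₀ → v ≠ x₁ → ∃ q ∈ Q, v ∈ q) :
    HasD m M x₀ x₁ := by
  have hHM : H ≤ M := by
    rw [hM]
    exact Multiset.le_add_left _ _
  have hHS : ∀ e ∈ H, ∀ v ∈ e, v ∈ S := fun e he => hR.mem e (Multiset.mem_of_le hHM he)
  have hHd : ∀ e ∈ H, ¬ e.IsDiag := fun e he => hR.loopless e (Multiset.mem_of_le hHM he)
  have hPS : ∀ q ∈ P, ∀ v ∈ q, v ∈ S := fun q hq => (hP q hq).mem_of_le hR (by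
    rw [hM]
    exact (le_sum_of_mem walkEdges hq).trans (Multiset.le_add_right _ _))
  have hne := hR.ne
  obtain ⟨y, y', hyy', hy1, hyy⟩ : ∃ y y', s(y, y') ∈ H ∧ y ≠ x₁ ∧ y ≠ y' := by
    obtain ⟨e, he⟩ := Multiset.exists_mem_of_ne_zero hH0
    induction e with | _ y y'
    have hyy := hHd _ he
    rw [Sym2.mk_isDiag_iff] at hyy
    by_cases hy : y = x₁
    · exact ⟨y', y, by rwa [Sym2.eq_swap], fun h => hyy (hy.trans h.symm), Ne.symm hyy⟩
    · exact ⟨y, y', he, hy, hyy⟩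
  set Y := S.filter (fun z => ReflTransGen (fun a b => s(a, b) ∈ H) y z) with hY
  have hYS : Y ⊆ S := Finset.filter_subset _ _
  have hyY : y ∈ Y := Finset.mem_filter.2 ⟨hHS _ hyy' y (by simp), .refl⟩
  have hclosed : ∀ z ∈ Y, ∀ w, s(z, w) ∈ H → w ∈ Y := by
    intro z hz w hw
    exact Finset.mem_filter.2 ⟨hHS _ hw w (by simp), (Finset.mem_filter.1 hz).2.tail hw⟩
  have hy'Y : y' ∈ Y := hclosed y hyY y' hyy'
  have hsymm : ∀ {z w : α}, ReflTransGen (fun a b => s(a, b) ∈ H) z w →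
      ReflTransGen (fun a b => s(a, b) ∈ H) w z := by
    intro z w h
    have : Std.Symm (fun a b => s(a, b) ∈ H) := ⟨fun a b hab => by rwa [Sym2.eq_swap]⟩
    exact Std.Symm.symm _ _ h
  have hconn : ∀ z ∈ Y, ∀ w ∈ Y, ReflTransGen (fun a b => s(a, b) ∈ H) z w := by
    intro z hz w hw
    exact (hsymm (Finset.mem_filter.1 hz).2).trans (Finset.mem_filter.1 hw).2
  have h0Y : x₀ ∉ Y := by
    intro h
    have h1 := (hconn x₀ h y hyY)
    rcases h1.cases_head with h1 | ⟨w, hw, -⟩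
    · exact hH _ hyy' (by simp [h1])
    · exact hH _ hw (by simp)
  have hHcut : cut H Y = 0 := by
    rw [cut_eq_zero]
    rintro e he ⟨⟨y, hy, hyY⟩, z, hz, hzY⟩
    have : e = s(y, z) := (Sym2.mem_and_mem_iff (by
      rintro rfl
      exact hzY hyY)).1 ⟨hy, hz⟩
    exact hzY (hclosed y hyY z (this ▸ he))
  -- a rung between two vertices of a path
  have hrung : ∀ l Q, P = l ::ₘ Q → ∀ a z, a ≠ z → z ≠ x₀ → z ≠ x₁ → a ≠ x₀ → a ≠ x₁ →
      (∃ q ∈ P, z ∈ q) → Imm (walkEdges l + H) (edge a x₀ + edge a x₁ + edge a z) →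
      HasD m M x₀ x₁ := by
    rintro l Q rfl a z haz hz0 hz1 ha0 ha1 ⟨q, hq, hzq⟩ himm
    have : ∃ q ∈ Q, z ∈ q := by
      rcases Multiset.mem_cons.1 hq with rfl | hq
      · exact hsh q Q rfl z hzq hz0 hz1
      · exact ⟨q, hq, hzq⟩
    obtain ⟨q, hq, hzq⟩ := this
    refine hasD_of_tripod (fun q hq => hP q (by simp [hq])) (by simpa using hcard) hq hzq hz0 hz1
      ha0 ha1 haz himm (le_of_eq ?_)
    rw [hM, Multiset.map_cons, Multiset.sum_cons]
    abel
  by_cases hA : ∃ a ∈ Y, a ≠ x₁ ∧ ∃ l ∈ P, a ∈ l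
  swap
  · push Not at hA
    by_cases hx1 : x₁ ∈ Y
    · have hPcut := sum_paths_cut (Q := P) (X := (Y : Set α)) (k := 1)
        fun q hq => (hP q hq).cut_eq_one hne hx1 (fun v hv hvY => by
          by_contra hv1
          exact hA v hvY hv1 q hq hv)
      have hall := sdiff_eq_of_cut_le hR hint hYS h0Y hx1
        (Finset.one_lt_card.2 ⟨x₁, hx1, y, hyY, hy1.symm⟩) (by
          rw [hM, cut_add, hHcut, hPcut]
          omega)
      have hPd : ∀ q ∈ P, q = [x₀, x₁] := by
        intro q hq
        refine (hP q hq).eq_pair hne fun v hv => ?_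
        by_contra hv'
        push Not at hv'
        exact hA v (hall v (hPS q hq v hv) hv'.1) hv'.2 q hq hv
      refine hasD_of_no_edge hR hm ?_ hH hS
      rw [hM, sum_direct hPd, hcard]
    · exfalso
      have hPcut := sum_paths_cut (Q := P) (X := (Y : Set α)) (k := 0)
        fun q hq => cut_walkEdges_eq_zero (Or.inr fun v hv hvY =>
          hA v hvY (by rintro rfl; exact hx1 hvY) q hq hv)
      have := hR.three_le Y hYS h0Y hx1 ⟨y, hyY⟩
      rw [hM, cut_add, hHcut, hPcut] at this
      omega
  obtain ⟨a, haY, ha1, l, hl, hal⟩ := hA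
  have ha0 : a ≠ x₀ := by
    rintro rfl
    exact h0Y haY
  obtain ⟨Q, hPl⟩ := Multiset.exists_cons_of_mem hl
  have hthrough : ∀ q ∈ P, a ∈ q → Imm (walkEdges q) (edge a x₀ + edge a x₁) := by
    intro q hq haq
    rw [edge_comm a x₀]
    exact (hP q hq).imm_through haq
  by_contra hD
  -- A second path vertex $v\in Y$ would be joined to $a$ in $H$, giving a tripod from $a$ to the
  -- roots and $v$.
  have huniq : ∀ v ∈ Y, v ≠ x₁ → (∃ q ∈ P, v ∈ q) → v = a := by
    intro v hv hv1 hvP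
    by_contra hva
    exact hD (hrung l Q hPl a v (Ne.symm hva) (by rintro rfl; exact h0Y hv) hv1 ha0 ha1 hvP
      ((hthrough l hl hal).add (imm_of_reach hHS (hconn a haY v hv))))
  obtain ⟨l', hl', hal'⟩ := hsh l Q hPl a hal ha0 ha1
  obtain ⟨Q', hQ'⟩ := Multiset.exists_cons_of_mem hl'
  have hMimm : ∀ {K}, K ≤ H →
      Imm M (2 • (edge x₀ a + edge a x₁) + (m - 2) • edge x₀ x₁ + K) := by
    intro K hK
    have h1 : M = walkEdges l + walkEdges l' + (Q'.map walkEdges).sum + H := by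
      rw [hM, hPl, hQ', Multiset.map_cons, Multiset.sum_cons, Multiset.map_cons, Multiset.sum_cons]
      abel
    have h2 : Imm (Q'.map walkEdges).sum ((m - 2) • edge x₀ x₁) := by
      have := Imm.sum (s := Q') (f := walkEdges) (g := fun _ => edge x₀ x₁)
        (fun l hl => (hP l (by rw [hPl, hQ']; simp [hl])).imm)
      have hc : m - 2 = Q'.card := by
        rw [hPl, hQ', Multiset.card_cons, Multiset.card_cons] at hcard
        omega
      simpa [hc] using this
    rw [h1, two_nsmul]
    exact ((((hP l hl).imm_through hal).add ((hP l' (by rw [hPl]; simp [hl'])).imm_through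
      hal')).add h2).add (imm_of_le hK)
  have hcutH : ∀ Z : Finset α, (∀ z ∈ Z, z ∈ Y ∧ z ≠ a ∧ z ≠ x₁) → cut M Z = cut H Z := by
    intro Z hZ
    rw [hM, cut_add, sum_paths_cut (k := 0), mul_zero, zero_add]
    intro q hq
    refine cut_walkEdges_eq_zero (Or.inr fun v hv hvZ => ?_)
    obtain ⟨h1, h2, h3⟩ := hZ v hvZ
    exact h2 (huniq v h1 h3 ⟨q, hq, hv⟩)
  have hcut3 : ∀ Z : Finset α, (∀ z ∈ Z, z ∈ Y ∧ z ≠ a ∧ z ≠ x₁) → Z.Nonempty → 3 ≤ cut H Z := by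
    intro Z hZ hZne
    rw [← hcutH Z hZ]
    exact hR.three_le Z (fun z hz => hYS (hZ z hz).1) (fun h => h0Y (hZ _ h).1)
      (fun h => (hZ _ h).2.2 rfl) hZne
  by_cases hx1 : x₁ ∈ Y
  -- If the vertex $w$ after $a$ on a path is not $x_1$, then $a$ reaches $x_1$ within $H$ instead,
  -- and the edge $aw$ of the path becomes the rung. Hence each path through $a$ continues directly
  -- to $x_1$.
  · have hend : ∀ q ∈ P, a ∈ q → ∃ t, q = t ++ [a, x₁] := by
      intro q hq haq
      obtain ⟨q₁, q₂, rfl⟩ := List.append_of_mem haq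
      have hq' := hP _ hq
      cases q₂ with
      | nil =>
        have := hq'.last
        simp only [List.getLast?_append, List.getLast?_singleton, Option.some_or,
          Option.some.injEq] at this
        exact absurd this ha1
      | cons w q₃ =>
        have hnd := hq'.nodup
        have hlast := hq'.last
        by_cases hw1 : w = x₁
        · subst hw1
          refine ⟨q₁, ?_⟩
          cases q₃ with
          | nil => rfl
          | cons c q₃ =>
            exfalso
            have h1 : w ∈ c :: q₃ := by
              apply List.mem_of_getLast?
              simpa [List.getLast?_append, List.getLast?_cons] using hlast
            simp only [List.nodup_append, List.nodup_cons] at hnd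
            exact hnd.2.1.2.1 h1
        · exfalso
          have hw0 : w ≠ x₀ := by
            rintro rfl
            have := hq'.head
            cases q₁ with
            | nil =>
              simp only [List.nil_append, List.head?_cons, Option.some.injEq] at this
              exact ha0 this
            | cons c q₁ =>
              simp only [List.cons_append, List.head?_cons, Option.some.injEq] at this
              subst this
              simp at hnd
          have haw : a ≠ w := by
            rintro rfl
            simp [List.nodup_append] at hnd
          obtain ⟨R, hPR⟩ := Multiset.exists_cons_of_mem hq
          refine hD (hrung _ R hPR a w haw hw0 hw1 ha0 ha1 ⟨_, hq, by simp⟩ ?_)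
          have h1 : Imm (walkEdges (q₁ ++ [a])) (edge a x₀) := by
            apply Imm.comm
            refine imm_walkEdges ?_ (by simp)
            have := hq'.head
            cases q₁ <;> simpa using this
          rw [walkEdges_append, walkEdges_cons_cons, ← Multiset.singleton_add]
          have h2 := ((h1.add (imm_of_reach hHS (hconn a haY x₁ hx1))).add
            (.refl (edge a w))).add (imm_zero (walkEdges (w :: q₃)))
          rw [add_zero] at h2
          convert h2 using 1
          abel
    -- Each path enters $Y$ once, at $a$ or at $x_1$, and stays there. So $m$ edges leave $Y$, and
    -- $Y$ is everything but $x_0$.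
    have hPcut := sum_paths_cut (Q := P) (X := (Y : Set α)) (k := 1) (by
      intro q hq
      by_cases haq : a ∈ q
      · obtain ⟨t, rfl⟩ := hend q hq haq
        have hnd := (hP _ hq).nodup
        refine cut_walkEdges_append ?_ (by simp) ?_ (by simp [haY, hx1])
        · rintro rfl
          have := (hP _ hq).head
          simp only [List.nil_append, List.head?_cons, Option.some.injEq] at this
          exact ha0 this
        · intro v hv hvY
          rw [List.nodup_append] at hnd
          by_cases hv1 : v = x₁
          · exact hnd.2.2 v hv x₁ (by simp) hv1
          · exact hnd.2.2 v hv a (by simp) (huniq v hvY hv1 ⟨_, hq, by simp [hv]⟩)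
      · refine (hP q hq).cut_eq_one hne hx1 fun v hv hvY => ?_
        by_contra hv1
        exact haq (huniq v hvY hv1 ⟨q, hq, hv⟩ ▸ hv))
    have hall := sdiff_eq_of_cut_le hR hint hYS h0Y hx1
      (Finset.one_lt_card.2 ⟨x₁, hx1, a, haY, ha1.symm⟩) (by
        rw [hM, cut_add, hHcut, hPcut]
        omega)
    set U := ((S.erase x₀).erase x₁).erase a with hU
    have hUmem : ∀ z, z ∈ U ↔ z ≠ a ∧ z ≠ x₁ ∧ z ≠ x₀ ∧ z ∈ S := by
      intro z
      simp [hU]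
    have hUY : ∀ Z : Finset α, Z ⊆ U → ∀ z ∈ Z, z ∈ Y ∧ z ≠ a ∧ z ≠ x₁ := by
      intro Z hZ z hz
      have := (hUmem z).1 (hZ hz)
      exact ⟨hall z this.2.2.2 this.2.2.1, this.1, this.2.1⟩
    have hsinks : ∀ (H' : Multiset (Sym2 α)) (z t : α), H' ≤ H → z ∈ U → t ∉ U →
        (t = z ∨ ∃ e ∈ H', t ∈ e) → t = a ∨ t = x₁ := by
      intro H' z t hle hzU htU ht
      rcases ht with rfl | ⟨e, he, hte⟩
      · exact absurd hzU htU
      · have h1 := hHS e (Multiset.mem_of_le hle he) t hte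
        have h2 : t ≠ x₀ := by
          rintro rfl
          exact hH e (Multiset.mem_of_le hle he) hte
        rw [hUmem] at htU
        tauto
    -- An edge $za$ is reserved, so that at least one of the three walks from $z$ ends at $a$. This
    -- excludes the last alternative of `hasD_of_theta`.
    by_cases hza : ∃ z ∈ U, s(z, a) ∈ H
    · obtain ⟨z, hzU, hz⟩ := hza
      obtain ⟨hz2, hz1, hz0, hzS⟩ := (hUmem z).1 hzU
      obtain ⟨H', hH'⟩ := Multiset.exists_cons_of_mem hz
      obtain ⟨T, hT1, hT2, hT3⟩ := exists_imm_pairs U H' {z, z} (by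
        intro Z hZ
        by_cases hzZ : z ∈ Z
        · refine (supply_le_card _ _).trans ?_
          have h1 := hcut3 Z (hUY Z hZ) ⟨z, hzZ⟩
          rw [hH', cut_cons] at h1
          split_ifs at h1 <;> simp <;> omega
        · rw [supply_eq_zero.2 (by simpa using hzZ)]
          omega)
      have hTc : T.card = 2 := by
        have := congrArg Multiset.card hT1
        simpa using this
      obtain ⟨p, q, rfl⟩ := Multiset.card_eq_two.1 hTc
      have hfst : ∀ r ∈ ({p, q} : Multiset (α × α)), r.1 = z := by
        intro r hr
        have := Multiset.mem_map_of_mem Prod.fst hr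
        rw [hT1] at this
        simpa using this
      have hsnd : ∀ r ∈ ({p, q} : Multiset (α × α)), r.2 = a ∨ r.2 = x₁ := by
        intro r hr
        obtain ⟨h1, h2⟩ := hT2 r hr
        refine hsinks H' z r.2 (by rw [hH']; exact Multiset.le_cons_self _ _) hzU h1 ?_
        simpa using h2
      have hHimm : Imm H (edge z a + (edge z p.2 + edge z q.2)) := by
        rw [hH', ← Multiset.singleton_add]
        refine (Imm.refl _).add ?_
        simpa [hfst p (by simp), hfst q (by simp)] using hT3
      refine hD (hasD_of_theta ha0 ha1 hz0 hz1 (Ne.symm hz2) (hMimm le_rfl) ?_)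
      rcases hsnd p (by simp) with h1 | h1 <;> rcases hsnd q (by simp) with h2 | h2 <;>
        rw [h1, h2] at hHimm
      · left
        convert hHimm using 1
        abel
      · right; left
        convert hHimm using 1
        abel
      · right; left
        convert hHimm using 1
        abel
      · right; right; left
        convert hHimm using 1
        abel
    · push Not at hza
      obtain ⟨z, hzU⟩ : U.Nonempty := by
        rw [← Finset.card_pos, hU, Finset.card_erase_of_mem (by simp [ha0, ha1, hYS haY]),
          Finset.card_erase_of_mem (by simp [hR.mem₁, hne.symm]), Finset.card_erase_of_mem hR.mem₀]
        omega
      obtain ⟨hz2, hz1, hz0, hzS⟩ := (hUmem z).1 hzU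
      -- In $H$, $a$ has no neighbour but $x_1$. The edge $ax_1$ crosses no subset of $U$ and can be
      -- kept apart as the additional walk, in case all three walks from $z$ end at $x_1$.
      have hax : s(a, x₁) ∈ H := by
        rcases (hconn a haY x₁ hx1).cases_head with h1 | ⟨b, hb, -⟩
        · exact absurd h1 ha1
        · have hb1 : b = x₁ := by
            by_contra hb1
            refine hza b ((hUmem b).2 ⟨?_, hb1, ?_, hHS _ hb b (by simp)⟩) (by rwa [Sym2.eq_swap])
            · rintro rfl
              exact hHd _ hb (by simp)
            · rintro rfl
              exact hH _ hb (by simp)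
          rwa [hb1] at hb
      obtain ⟨H', hH'⟩ := Multiset.exists_cons_of_mem hax
      obtain ⟨T, hT1, hT2, hT3⟩ := exists_imm_pairs U H' {z, z, z} (by
        intro Z hZ
        by_cases hzZ : z ∈ Z
        · refine (supply_le_card _ _).trans ?_
          have h1 := hcut3 Z (hUY Z hZ) ⟨z, hzZ⟩
          have h2 : a ∉ Z := fun h => (hUY Z hZ a h).2.1 rfl
          have h3 : x₁ ∉ Z := fun h => (hUY Z hZ x₁ h).2.2 rfl
          rw [hH', cut_cons, if_pos (by simp [h2, h3])] at h1
          simpa using h1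
        · rw [supply_eq_zero.2 (by simpa using hzZ)]
          omega)
      have hTc : T.card = 3 := by
        have := congrArg Multiset.card hT1
        simpa using this
      obtain ⟨p, q, r, rfl⟩ := Multiset.card_eq_three.1 hTc
      have hfst : ∀ s ∈ ({p, q, r} : Multiset (α × α)), s.1 = z := by
        intro s hs
        have := Multiset.mem_map_of_mem Prod.fst hs
        rw [hT1] at this
        simpa using this
      have hsnd : ∀ s ∈ ({p, q, r} : Multiset (α × α)), s.2 = a ∨ s.2 = x₁ := by
        intro s hs
        obtain ⟨h1, h2⟩ := hT2 s hs
        refine hsinks H' z s.2 (by rw [hH']; exact Multiset.le_cons_self _ _) hzU h1 ?_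
        simpa using h2
      have hHimm' : Imm H (edge a x₁ + (edge z p.2 + (edge z q.2 + edge z r.2))) := by
        rw [hH', ← Multiset.singleton_add]
        refine (Imm.refl _).add ?_
        simpa [hfst p (by simp), hfst q (by simp), hfst r (by simp)] using hT3
      have hHimm : Imm H (edge z p.2 + (edge z q.2 + edge z r.2)) :=
        hHimm'.trans (imm_of_le (Multiset.le_add_left _ _))
      refine hD (hasD_of_theta ha0 ha1 hz0 hz1 (Ne.symm hz2) (hMimm le_rfl) ?_)
      rcases hsnd p (by simp) with h1 | h1 <;> rcases hsnd q (by simp) with h2 | h2 <;>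
        rcases hsnd r (by simp) with h3 | h3 <;> rw [h1, h2, h3] at hHimm hHimm'
      · left; convert hHimm using 1; abel
      · right; left; convert hHimm using 1; abel
      · right; left; convert hHimm using 1; abel
      · right; right; left; convert hHimm using 1; abel
      · right; left; convert hHimm using 1; abel
      · right; right; left; convert hHimm using 1; abel
      · right; right; left; convert hHimm using 1; abel
      · right; right; right; convert hHimm' using 1; abel
  · obtain ⟨z, hzY, hza⟩ : ∃ z ∈ Y, z ≠ a := by
      by_cases h : y = a
      · exact ⟨y', hy'Y, fun h' => hyy (h.trans h'.symm)⟩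
      · exact ⟨y, hyY, h⟩
    have hz1 : z ≠ x₁ := by
      rintro rfl
      exact hx1 hzY
    -- Without $x_1$ in $Y$, all three walks from $z$ end at $a$. Restricting to edges inside $Y$
    -- makes $a$ the only sink and loses no edge that meets $Y$.
    have key := imm_sink (Y.erase a) (inside H Y) {z, z, z} a (by simp [hza, hzY])
      (by
        intro e he v hv
        by_cases hva : v = a
        · exact Or.inr hva
        · exact Or.inl (Finset.mem_erase.2 ⟨hva, (Multiset.mem_filter.1 he).2 v hv⟩))
      (by
        intro Z hZ
        have hZY : ∀ w ∈ Z, w ∈ Y ∧ w ≠ a ∧ w ≠ x₁ := by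
          intro w hw
          have := Finset.mem_erase.1 (hZ hw)
          refine ⟨this.2, this.1, ?_⟩
          rintro rfl
          exact hx1 this.2
        have hcut : cut H Z ≤ cut (inside H Y) Z := by
          have h1 : cut (H.filter fun e => ¬ ∀ v ∈ e, v ∈ Y) Z = 0 := by
            rw [cut_eq_zero]
            rintro e he ⟨⟨w, hw, hwZ⟩, -⟩
            obtain ⟨he, hout⟩ := Multiset.mem_filter.1 he
            apply hout
            intro v hv
            obtain ⟨w', rfl⟩ := Sym2.mem_iff_exists.1 hw
            have hwY := (hZY w hwZ).1
            rcases Sym2.mem_iff.1 hv with rfl | rfl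
            · exact hwY
            · exact hclosed w hwY v he
          have h2 : cut H Z = cut (inside H Y) Z +
              cut (H.filter fun e => ¬ ∀ v ∈ e, v ∈ Y) Z := by
            rw [← cut_add, inside, Multiset.filter_add_not]
          omega
        by_cases hzZ : z ∈ Z
        · refine (supply_le_card _ _).trans ?_
          have h1 := hcut3 Z hZY ⟨z, hzZ⟩
          simp
          omega
        · rw [supply_eq_zero.2 (by simpa using hzZ)]
          omega)
    refine hD (hasD_of_theta ha0 ha1 (by rintro rfl; exact h0Y hzY) hz1 (Ne.symm hza)
      (hMimm (inside_le H Y)) (Or.inl ?_))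
    simpa [add_assoc] using key

/-- If `d(x₀) = m` and all internal edge-cuts separating the roots have more than `m` edges, there
is an immersion of `D_m`. -/
theorem hasD_of_internal (hR : Rooted S M x₀ x₁) (hm : 2 ≤ m) (hS : 4 ≤ S.card)
    (hint : ∀ X : Finset α, X ⊆ S → x₀ ∈ X → x₁ ∉ X → 2 ≤ X.card → 2 ≤ (S \ X).card →
      m + 1 ≤ cut M X)
    (h0 : cut M {x₀} = m) (h1 : m ≤ cut M {x₁}) : HasD m M x₀ x₁ := by
  have hne := hR.ne
  have hx1cut : ∀ X : Finset α, X ⊆ S → x₁ ∉ X → (S \ X).card ≤ 1 → ∀ N ≤ M,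
      cut N X = cut N {x₁} := by
    intro X hX hx1 hc N hN
    have hSX : S \ X = {x₁} := by
      have h2 : x₁ ∈ S \ X := Finset.mem_sdiff.2 ⟨hR.mem₁, hx1⟩
      exact Finset.eq_singleton_iff_unique_mem.2
        ⟨h2, fun v hv => Finset.card_le_one.1 hc v hv x₁ h2⟩
    rw [← cut_compl]
    apply cut_congr
    intro e he v hv
    have h2 : v ∈ S \ X ↔ v = x₁ := by rw [hSX, Finset.mem_singleton]
    have h3 := hR.mem e (Multiset.mem_of_le hN he) v hv
    simp only [Finset.mem_sdiff, h3, true_and] at h2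
    simpa using h2
  have hx0cut : ∀ X : Finset α, x₀ ∈ X → X.card ≤ 1 → X = {x₀} := by
    intro X hx0 hc
    exact Finset.eq_singleton_iff_unique_mem.2
      ⟨hx0, fun v hv => Finset.card_le_one.1 hc v hv x₀ hx0⟩
  -- A system of $m$ paths that leaves some edge over.
  have hsys : ∃ P : Multiset (List α), P.card = m ∧ (∀ l ∈ P, IsPath x₀ x₁ l) ∧
      ∃ H, M = (P.map walkEdges).sum + H ∧ H ≠ 0 := by
    by_cases he : ∃ e ∈ M, x₀ ∉ e ∧ x₁ ∉ e
    · obtain ⟨e, he, he0, he1⟩ := he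
      obtain ⟨N, rfl⟩ := Multiset.exists_cons_of_mem he
      obtain ⟨P, hP1, hP2, hP3⟩ := exists_paths (S := S) (M := N) (m := m)
        (fun e he => hR.mem e (by simp [he])) hR.mem₀ (x₁ := x₁) (by
          intro X hX hx0 hx1
          have hle : cut (e ::ₘ N) X ≤ cut N X + 1 := by
            rw [cut, Multiset.countP_cons, cut]
            split_ifs <;> omega
          have hnc : ∀ x : α, x ∉ e → cut (e ::ₘ N) {x} = cut N {x} := by
            intro x hx
            rw [cut, Multiset.countP_cons, if_neg, add_zero, cut]
            rintro ⟨⟨v, hv, hvx⟩, -⟩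
            exact hx (Set.mem_singleton_iff.1 hvx ▸ hv)
          by_cases hc0 : X.card ≤ 1
          · rw [hx0cut X hx0 hc0, Finset.coe_singleton, ← hnc x₀ he0, h0]
          · by_cases hc1 : (S \ X).card ≤ 1
            · rw [hx1cut X hX hx1 hc1 N (Multiset.le_cons_self _ _), ← hnc x₁ he1]
              exact h1
            · have := hint X hX hx0 hx1 (by omega) (by omega)
              omega)
      obtain ⟨H, hH⟩ := exists_sum_add_of_le hP3
      refine ⟨P, hP1, hP2, e ::ₘ H, ?_, by simp⟩
      rw [hH, Multiset.add_cons]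
    · push Not at he
      obtain ⟨P, hP1, hP2, hP3⟩ := exists_paths (S := S) (M := M) (m := m) hR.mem hR.mem₀
        (x₁ := x₁) (by
          intro X hX hx0 hx1
          by_cases hc0 : X.card ≤ 1
          · rw [hx0cut X hx0 hc0, Finset.coe_singleton, h0]
          · by_cases hc1 : (S \ X).card ≤ 1
            · rw [hx1cut X hX hx1 hc1 M le_rfl]
              exact h1
            · have := hint X hX hx0 hx1 (by omega) (by omega)
              omega)
      obtain ⟨H, hH⟩ := exists_sum_add_of_le hP3
      refine ⟨P, hP1, hP2, H, hH, ?_⟩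
      rintro rfl
      -- If every edge meets a root and the paths use up all edges, $x_1$ has degree $m$ too. For a
      -- non-root $c$, the sets $\{x_0,c\}$ and $S\setminus\{x_1,c\}$ both have cuts of size at
      -- least $m+1$. Since $c$ has only roots as neighbours, they are modular, but their union and
      -- intersection have cuts of size $m$.
      have hcut1 : cut M {x₁} = m := by
        rw [hH, add_zero, sum_paths_cut (k := 1), hP1, mul_one]
        intro q hq
        exact (hP2 q hq).cut_eq_one hne rfl fun v _ hv => hv
      obtain ⟨c, hc⟩ : ((S.erase x₀).erase x₁).Nonempty := by
        rw [← Finset.card_pos, Finset.card_erase_of_mem (by simp [hR.mem₁, hne.symm]),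
          Finset.card_erase_of_mem hR.mem₀]
        omega
      simp only [Finset.mem_erase] at hc
      obtain ⟨hc1, hc0, hcS⟩ := hc
      have hX1 := hint {x₀, c} (by
        intro v hv
        simp only [Finset.mem_insert, Finset.mem_singleton] at hv
        rcases hv with rfl | rfl
        exacts [hR.mem₀, hcS]) (by simp) (by simp [hne.symm, Ne.symm hc1])
        (by rw [Finset.card_pair (Ne.symm hc0)]) (by
          have := Finset.le_card_sdiff {x₀, c} S
          rw [Finset.card_pair (Ne.symm hc0)] at this
          omega)
      have hX2 := hint ((S.erase x₁).erase c)
        ((Finset.erase_subset _ _).trans (Finset.erase_subset _ _))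
        (by simp [hR.mem₀, hne, Ne.symm hc0]) (by simp) (by
          rw [Finset.card_erase_of_mem (by simp [hcS, hc1]), Finset.card_erase_of_mem hR.mem₁]
          omega)
        (Finset.one_lt_card.2 ⟨x₁, by simp [hR.mem₁], c, by simp [hcS], Ne.symm hc1⟩)
      have hmod := cut_modular (M := M) (X := (({x₀, c} : Finset α) : Set α))
        (Y := (((S.erase x₁).erase c : Finset α) : Set α)) (by
          rintro a ⟨ha, ha'⟩ b ⟨hb, hb'⟩ hM
          simp only [Finset.coe_insert, Finset.coe_singleton, Set.mem_insert_iff,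
            Set.mem_singleton_iff, Finset.mem_coe, Finset.mem_erase, not_or] at ha ha' hb hb'
          have hac : a = c := by
            rcases ha with rfl | rfl
            · exact absurd ⟨Ne.symm hc0, hne, hR.mem₀⟩ ha'
            · rfl
          subst hac
          have h3 := he _ hM (by simp [Ne.symm hc0, Ne.symm hb'.1])
          simp only [Sym2.mem_iff] at h3
          rcases h3 with h3 | h3
          · exact hc1 h3.symm
          · exact hb.2.1 h3.symm)
      have hU : cut M (({x₀, c} : Finset α) ∪ ((S.erase x₁).erase c : Finset α) : Set α) = m := by
        rw [← hcut1, ← cut_compl]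
        apply cut_congr
        intro e he v hv
        have hvS := hR.mem e he v hv
        simp only [Set.mem_compl_iff, Set.mem_union, Finset.mem_coe, Finset.mem_insert,
          Finset.mem_singleton, Finset.mem_erase, hvS, Set.mem_singleton_iff, and_true]
        constructor
        · intro h
          tauto
        · rintro rfl
          simp [hne.symm, Ne.symm hc1]
      have hI : cut M (({x₀, c} : Finset α) ∩ ((S.erase x₁).erase c : Finset α) : Set α) = m := by
        rw [← h0]
        apply cut_congr
        intro e he v hv
        have hvS := hR.mem e he v hv
        simp only [Set.mem_inter_iff, Finset.mem_coe, Finset.mem_insert,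
          Finset.mem_singleton, Finset.mem_erase, hvS, Set.mem_singleton_iff, and_true]
        constructor
        · intro h
          tauto
        · rintro rfl
          simp [hne, Ne.symm hc0]
      omega
  obtain ⟨P, hP1, hP2, H, hH, hH0⟩ := hsys
  have hHM : H ≤ M := by
    rw [hH]
    exact Multiset.le_add_left _ _
  -- The $m$ paths use all $m$ edges at $x_0$.
  have hHx : ∀ e ∈ H, x₀ ∉ e := by
    have h2 := h0
    rw [hH, cut_add, ← cut_compl, sum_paths_cut (k := 1), hP1, mul_one] at h2
    · have h3 : cut H {x₀} = 0 := by omega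
      rw [cut_eq_zero] at h3
      intro e he hx
      apply h3 e he
      obtain ⟨y, rfl⟩ := Sym2.mem_iff_exists.1 hx
      have h4 := hR.loopless _ (Multiset.mem_of_le hHM he)
      rw [Sym2.mk_isDiag_iff] at h4
      simpa using Ne.symm h4
    · intro q hq
      obtain ⟨l', hl'⟩ := (hP2 q hq).exists_eq hne
      have hnd := (hP2 q hq).nodup
      rw [hl'] at hnd ⊢
      rw [List.cons_append, List.nodup_cons] at hnd
      exact cut_walkEdges_append (l₁ := [x₀]) (by simp) (by simp) (by simp) fun v hv hvx =>
        hnd.1 (Set.mem_singleton_iff.1 hvx ▸ hv)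
  by_cases hpriv : ∃ l Q, P = l ::ₘ Q ∧ ∃ v ∈ l, v ≠ x₀ ∧ v ≠ x₁ ∧ ∀ q ∈ Q, v ∉ q
  · obtain ⟨l, Q, rfl, v, hvl, hv0, hv1, hvQ⟩ := hpriv
    refine hasD_of_unique_path (l := l) (Q := Q) (H := H) hR hm hS hint ?_ (hP2 l (by simp))
      (fun q hq => hP2 q (by simp [hq])) (by simpa using hP1) hHx hv0 hv1 hvl hvQ
    rw [hH, Multiset.map_cons, Multiset.sum_cons]
    abel
  · push Not at hpriv
    exact hasD_of_shared hR hm hS hint hH hP2 hP1 hHx hH0 fun l Q hPl v hv h2 h3 =>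
      hpriv l Q hPl v hv h2 h3

end

/-! ### Contraction of one side of an edge-cut -/

/-- The map that moves all vertices of `W` to `r`. -/
noncomputable def collapse (W : Finset α) (r : α) (v : α) : α := if v ∈ W then r else v

/-- The multigraph obtained by identifying the vertices of `W` with `r`, without loops. -/
noncomputable def contract (W : Finset α) (r : α) (M : Multiset (Sym2 α)) : Multiset (Sym2 α) :=
  (M.map (Sym2.map (collapse W r))).filter fun e => ¬ e.IsDiag

lemma contract_add (W : Finset α) (r : α) (M N : Multiset (Sym2 α)) :
    contract W r (M + N) = contract W r M + contract W r N := by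
  simp [contract, Multiset.filter_add]

lemma cut_contract (W : Finset α) (r : α) (M : Multiset (Sym2 α)) (X : Set α) :
    cut (contract W r M) X = cut M (collapse W r ⁻¹' X) := by
  induction M using Multiset.induction_on with
  | empty => simp [contract]
  | cons e M ih =>
    induction e with | _ a b
    rw [← Multiset.singleton_add, contract_add, cut_add, cut_add, ih]
    congr 1
    by_cases h : collapse W r a = collapse W r b
    · rw [contract, Multiset.map_singleton, Multiset.filter_singleton]
      simp [h]
    · rw [contract, Multiset.map_singleton, Multiset.filter_singleton]
      simp [h, cut_cons, ← Multiset.cons_zero]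

/-- If `W` contains no smaller edge-cut around `r` than `δ(W)`, contracting `W` to `r` is an
immersion. -/
theorem imm_contract {M : Multiset (Sym2 α)} {W : Finset α} {r : α} (hr : r ∈ W)
    (h : ∀ Z : Finset α, Z ⊆ W → r ∈ Z → cut M W ≤ cut M Z) : Imm M (contract W r M) := by
  -- The edges inside $W$, crossing $\delta(W)$ and outside $W$ are `I`, `D` and `O`; `b` and `y`
  -- are the ends of a crossing edge in and outside $W$.
  set I := M.filter (fun e => ∀ v ∈ e, v ∈ W) with hI
  set M' := M.filter (fun e => ¬ ∀ v ∈ e, v ∈ W) with hM'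
  set D := M'.filter (fun e => ∃ v ∈ e, v ∈ W) with hD
  set O := M'.filter (fun e => ¬ ∃ v ∈ e, v ∈ W) with hO
  have hM : M = I + (D + O) := by
    rw [hD, hO, Multiset.filter_add_not, hM', Multiset.filter_add_not]
  have hIW : ∀ e ∈ I, ∀ v ∈ e, v ∈ W := fun e he => (Multiset.mem_filter.1 he).2
  have hDW : ∀ e : Sym2 α, ∃ b y : α, e ∈ D → e = s(b, y) ∧ b ∈ W ∧ y ∉ W := by
    intro e
    by_cases he : e ∈ D
    · obtain ⟨he', v, hve, hv⟩ := Multiset.mem_filter.1 he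
      have h2 := (Multiset.mem_filter.1 he').2
      push Not at h2
      obtain ⟨w, hwe, hw⟩ := h2
      exact ⟨v, w, fun _ => ⟨(Sym2.mem_and_mem_iff (by rintro rfl; exact hw hv)).1 ⟨hve, hwe⟩,
        hv, hw⟩⟩
    · exact ⟨r, r, fun h => absurd h he⟩
  choose b y hby using hDW
  have hOW : ∀ e ∈ O, ∀ v ∈ e, v ∉ W := fun e he v hv hvW =>
    (Multiset.mem_filter.1 he).2 ⟨v, hv, hvW⟩
  -- The inequality $d(W)\le d(W\setminus Z)$ is Menger's condition: replacing $W$ by $W\setminus Z$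
  -- loses the crossing edges with an end in $Z$ and gains the inner edges leaving $Z$.
  have hpairs : ∀ Z : Finset α, Z ⊆ W.erase r → supply (D.map b) Z ≤ cut I Z := by
    intro Z hZ
    have hZW : Z ⊆ W := hZ.trans (Finset.erase_subset _ _)
    have h1 := h (W \ Z) Finset.sdiff_subset
      (Finset.mem_sdiff.2 ⟨hr, fun h => by simpa using hZ h⟩)
    rw [hM] at h1
    simp only [cut_add] at h1
    have hO0 : ∀ X : Finset α, X ⊆ W → cut O X = 0 := by
      intro X hX
      rw [cut_eq_zero]
      rintro e he ⟨⟨v, hv, hvX⟩, -⟩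
      exact hOW e he v hv (hX hvX)
    have hI1 : cut I W = 0 := by
      rw [cut_eq_zero]
      rintro e he ⟨-, v, hv, hvX⟩
      exact hvX (hIW e he v hv)
    have hI2 : cut I (W \ Z : Finset α) = cut I Z := by
      rw [← cut_compl]
      apply cut_congr
      intro e he v hv
      simp [hIW e he v hv]
    have hD1 : cut D W = D.card := by
      rw [cut, Multiset.countP_eq_card]
      intro e he
      obtain ⟨h2, h3, h4⟩ := hby e he
      rw [h2, crosses_mk]
      simp [h3, h4]
    have hD2 : cut D (W \ Z : Finset α) + supply (D.map b) Z = D.card := by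
      rw [cut, supply, Multiset.countP_map,
        Multiset.card_eq_countP_add_countP (fun e => Crosses ((W \ Z : Finset α) : Set α) e) D]
      congr 1
      rw [← Multiset.countP_eq_card_filter]
      obtain ⟨Z', hZ'⟩ : ∃ Z' : Set α, Z' = Z := ⟨_, rfl⟩
      rw [← hZ']
      refine Multiset.countP_congr rfl fun e he => propext ?_
      obtain ⟨h2, h3, h4⟩ := hby e he
      have h5 : Crosses ((W \ Z : Finset α) : Set α) e ↔ b e ∉ Z := by
        nth_rewrite 1 [h2]
        rw [crosses_mk]
        simp [h3, h4]
      simp only [hZ', h5, Finset.mem_coe, not_not]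
    rw [hO0 W subset_rfl, hO0 _ Finset.sdiff_subset, hI1, hI2, hD1] at h1
    omega
  obtain ⟨Q, hQ1, hQ2, hQ3⟩ := exists_imm_pairs (W.erase r) I (D.map b) hpairs
  have hQr : ∀ q ∈ Q, q.2 = r := by
    intro q hq
    obtain ⟨h1, h2⟩ := hQ2 q hq
    have hW : q.2 ∈ W := by
      rcases h2 with h2 | ⟨e, he, hqe⟩
      · obtain ⟨e, he, h3⟩ := Multiset.mem_map.1 h2
        rw [← h3]
        exact (hby e he).2.1
      · exact hIW e he _ hqe
    by_contra hne
    exact h1 (Finset.mem_erase.2 ⟨hne, hW⟩)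
  have hI3 : Imm I (D.map fun e => edge (b e) r).sum := by
    convert hQ3 using 2
    have h1 : Q.map (fun q => edge q.1 q.2) = (Q.map Prod.fst).map (fun c => edge c r) := by
      rw [Multiset.map_map]
      exact Multiset.map_congr rfl fun q hq => by simp [hQr q hq]
    rw [h1, hQ1, Multiset.map_map]
    rfl
  have hDsum : D = (D.map fun e => ({e} : Multiset (Sym2 α))).sum := by
    rw [Multiset.sum_map_singleton]
  have hcI : contract W r I = 0 := by
    rw [contract, Multiset.filter_eq_nil]
    intro e he
    obtain ⟨e', he', rfl⟩ := Multiset.mem_map.1 he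
    induction e' with | _ p q
    have h1 := hIW _ he' p (by simp)
    have h2 := hIW _ he' q (by simp)
    simp [collapse, h1, h2]
  have hcD : contract W r D ≤ (D.map fun e => edge r (y e)).sum := by
    refine (Multiset.filter_le _ _).trans (le_of_eq ?_)
    have : (D.map fun e => edge r (y e)) = (D.map fun e => s(r, y e)).map fun e => {e} := by
      rw [Multiset.map_map]
      rfl
    rw [this, Multiset.sum_map_singleton]
    refine Multiset.map_congr rfl fun e he => ?_
    obtain ⟨h1, h2, h3⟩ := hby e he
    rw [h1, Sym2.map_mk, ← h1]
    simp [collapse, h2, h3]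
  have hcO : contract W r O ≤ O := by
    refine (Multiset.filter_le _ _).trans (le_of_eq ?_)
    nth_rewrite 2 [← Multiset.map_id O]
    refine Multiset.map_congr rfl fun e he => ?_
    induction e with | _ p q
    have h1 := hOW _ he p (by simp)
    have h2 := hOW _ he q (by simp)
    simp [collapse, h1, h2]
  -- Each crossing edge is prolonged by a walk in $W$ from its end `b e` to $r$.
  have key : Imm (I + D) (D.map fun e => edge r (y e)).sum := by
    refine (hI3.add (imm_of_le (le_of_eq hDsum.symm))).trans ?_
    rw [← Multiset.sum_map_add]
    refine Imm.sum fun e he => ?_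
    obtain ⟨h1, h2, h3⟩ := hby e he
    have h4 : ({e} : Multiset (Sym2 α)) = edge (b e) (y e) := by rw [edge, ← h1]
    rw [h4, edge_comm (b e) r]
    exact imm_path _ _ _
  have hfin : contract W r M = 0 + (contract W r D + contract W r O) := by
    nth_rewrite 1 [hM]
    rw [contract_add, contract_add, hcI]
  rw [hfin, zero_add]
  nth_rewrite 1 [hM]
  rw [← add_assoc]
  exact (key.add (.refl O)).trans (imm_of_le (add_le_add hcD hcO))

section

variable {S : Finset α} {M : Multiset (Sym2 α)} {x₀ x₁ : α} {k : ℕ}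

lemma cut_contract_of_notMem {W Y : Finset α} {r : α}
    (hr : r ∉ Y) (hY : Disjoint Y W) : cut (contract W r M) Y = cut M Y := by
  rw [cut_contract]
  apply cut_congr
  intro e he v hv
  simp only [Set.mem_preimage, collapse, Finset.mem_coe]
  split_ifs with h
  · simp only [hr, false_iff]
    exact fun h' => Finset.disjoint_left.1 hY h' h
  · rfl

lemma cut_contract_of_mem {W Y : Finset α} {r : α} (hr : r ∈ Y) :
    cut (contract W r M) Y = cut M (Y ∪ W : Finset α) := by
  rw [cut_contract]
  congr 1
  ext v
  simp only [Set.mem_preimage, collapse, Finset.mem_coe, Finset.mem_union]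
  split_ifs with h <;> simp [h, hr]

/-- Sets avoiding the roots are disjoint from the contracted set, so their cuts are the same as
before. -/
lemma Rooted.contract (hR : Rooted S M x₀ x₁) {W : Finset α} (h0 : x₀ ∈ W) (h1 : x₁ ∉ W) :
    Rooted (insert x₀ (S \ W)) (contract W x₀ M) x₀ x₁ := by
  have hsub : insert x₀ (S \ W) ⊆ S := Finset.insert_subset hR.mem₀ Finset.sdiff_subset
  have hdis : ∀ Y : Finset α, Y ⊆ insert x₀ (S \ W) → x₀ ∉ Y → Disjoint Y W := by
    intro Y hY h
    rw [Finset.disjoint_left]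
    intro v hv
    have := hY hv
    rw [Finset.mem_insert] at this
    rcases this with rfl | h2
    · exact absurd hv h
    · exact (Finset.mem_sdiff.1 h2).2
  refine ⟨?_, ?_, by simp, by simp [hR.mem₁, h1], hR.ne, ?_, ?_⟩
  · intro e he v hv
    obtain ⟨e', he', rfl⟩ := Multiset.mem_map.1 (Multiset.mem_filter.1 he).1
    obtain ⟨w, hw, rfl⟩ := Sym2.mem_map.1 hv
    have := hR.mem e' he' w hw
    simp only [collapse]
    split_ifs with h <;> simp [h, this]
  · intro e he
    exact (Multiset.mem_filter.1 he).2
  · intro Y hY h2 h3 h4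
    rw [cut_contract_of_notMem h2 (hdis Y hY h2)]
    exact hR.three_le Y (hY.trans hsub) h2 h3 h4
  · intro Y hY h2 h3 h4
    rw [cut_contract_of_notMem h2 (hdis Y hY h2)]
    exact hR.four_le Y (hY.trans hsub) h2 h3 h4

/-! ### Chains of tight edge-cuts -/

/-- `δ(X)` is an edge-cut with `k` edges that separates `x₀ ∈ X` from `x₁`. -/
structure Tight (S : Finset α) (M : Multiset (Sym2 α)) (x₀ x₁ : α) (k : ℕ) (X : Finset α) :
    Prop where
  subset : X ⊆ S
  mem : x₀ ∈ X
  notMem : x₁ ∉ X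
  cut_eq : cut M X = k

/-- `Y` is tight and arises from `X` by adding one vertex. -/
def TightStep (S : Finset α) (M : Multiset (Sym2 α)) (x₀ x₁ : α) (k : ℕ) (X Y : Finset α) : Prop :=
  ∃ v, v ∉ X ∧ Y = insert v X ∧ Tight S M x₀ x₁ k Y

/-- Type `A_k` for multisets of edges. -/
def TypeA (S : Finset α) (M : Multiset (Sym2 α)) (x₀ x₁ : α) (k : ℕ) : Prop :=
  ∃ X Y, Tight S M x₀ x₁ k X ∧ X.card ≤ 2 ∧ (S \ Y).card ≤ 2 ∧
    ReflTransGen (TightStep S M x₀ x₁ k) X Y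

lemma Tight.of_reach {X Y : Finset α} (hX : Tight S M x₀ x₁ k X)
    (h : ReflTransGen (TightStep S M x₀ x₁ k) X Y) : Tight S M x₀ x₁ k Y := by
  cases h with
  | refl => exact hX
  | tail _ h => exact h.choose_spec.2.2

lemma cut_sdiff (hM : ∀ e ∈ M, ∀ v ∈ e, v ∈ S) (X : Finset α) :
    cut M (S \ X : Finset α) = cut M X := by
  rw [← cut_compl]
  apply cut_congr
  intro e he v hv
  simp [hM e he v hv]

/-- A set `Y ⊆ X` with at most one vertex less than the tight set `X`. -/
lemma tightStep_of_card {X Y : Finset α} (hX : Tight S M x₀ x₁ k X) (hYX : Y ⊆ X)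
    (hc : (X \ Y).card ≤ 1) : ReflTransGen (TightStep S M x₀ x₁ k) Y X := by
  by_cases h : X \ Y = ∅
  · rw [Finset.sdiff_eq_empty_iff_subset] at h
    rw [hYX.antisymm h]
  · obtain ⟨v, hv⟩ := Finset.nonempty_iff_ne_empty.2 h
    have h2 : X \ Y = {v} := Finset.eq_singleton_iff_unique_mem.2
      ⟨hv, fun w hw => Finset.card_le_one.1 hc w hw v hv⟩
    refine ReflTransGen.single ⟨v, (Finset.mem_sdiff.1 hv).2, ?_, hX⟩
    rw [Finset.insert_eq, ← h2, Finset.sdiff_union_of_subset hYX]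

/-- The separating edge-cuts of minimum size form a chain, unless `D_k` can be immersed. -/
theorem hasD_or_typeA (hR : Rooted S M x₀ x₁) (hk : 2 ≤ k) (hS : 4 ≤ S.card)
    (hsep : ∀ X : Finset α, X ⊆ S → x₀ ∈ X → x₁ ∉ X → k ≤ cut M X)
    (hex : ∃ X, Tight S M x₀ x₁ k X) : HasD k M x₀ x₁ ∨ TypeA S M x₀ x₁ k := by
  induction hn : S.card using Nat.strong_induction_on generalizing S M with
  | _ n ih =>
  by_cases hint : ∃ X, Tight S M x₀ x₁ k X ∧ 2 ≤ X.card ∧ 2 ≤ (S \ X).card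
  · obtain ⟨X, hX, hX2, hX3⟩ := hint
    have hcard := Finset.card_sdiff_add_card_eq_card hX.subset
    by_cases hD : HasD k M x₀ x₁
    · exact Or.inl hD
    right
    -- The part of the chain inside $X$ comes from contracting $S\setminus X$ to $x_1$. If $|X|\ge
    -- 3$, the contraction still has four vertices, and fewer than before.
    have hleft : ∃ X₁, Tight S M x₀ x₁ k X₁ ∧ X₁.card ≤ 2 ∧
        ReflTransGen (TightStep S M x₀ x₁ k) X₁ X := by
      by_cases hXc : X.card ≤ 2
      · exact ⟨X, hX, hXc, .refl⟩
      have hx1 : x₁ ∈ S \ X := Finset.mem_sdiff.2 ⟨hR.mem₁, hX.notMem⟩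
      have hR' := (hR.symm.contract hx1 (by simp [hX.mem])).symm
      have hSX : insert x₁ (S \ (S \ X)) = insert x₁ X := by
        rw [Finset.sdiff_sdiff_eq_self hX.subset]
      rw [hSX] at hR'
      have hcut : ∀ Z : Finset α, Z ⊆ insert x₁ X → x₁ ∉ Z →
          cut (contract (S \ X) x₁ M) Z = cut M Z ∧ Z ⊆ X := by
        intro Z hZ h1
        have hZX : Z ⊆ X := (Finset.subset_insert_iff_of_notMem h1).1 hZ
        exact ⟨cut_contract_of_notMem h1
          (Finset.disjoint_of_subset_left hZX Finset.disjoint_sdiff), hZX⟩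
      have himm : Imm M (contract (S \ X) x₁ M) := by
        refine imm_contract hx1 fun Z hZ h1 => ?_
        rw [cut_sdiff hR.mem, hX.cut_eq, ← cut_sdiff hR.mem Z]
        refine hsep _ Finset.sdiff_subset (Finset.mem_sdiff.2 ⟨hR.mem₀, fun h => ?_⟩) (by simp [h1])
        exact (Finset.mem_sdiff.1 (hZ h)).2 hX.mem
      have hc1 : (insert x₁ X).card = X.card + 1 := Finset.card_insert_of_notMem hX.notMem
      have htight : ∀ Z, Tight (insert x₁ X) (contract (S \ X) x₁ M) x₀ x₁ k Z →
          Tight S M x₀ x₁ k Z ∧ Z ⊆ X := by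
        intro Z hZ
        obtain ⟨h1, h2⟩ := hcut Z hZ.subset hZ.notMem
        exact ⟨⟨h2.trans hX.subset, hZ.mem, hZ.notMem, h1 ▸ hZ.cut_eq⟩, h2⟩
      rcases ih (insert x₁ X).card (by omega) hR' (by omega) (by
          intro Z hZ h0 h1
          obtain ⟨h2, h3⟩ := hcut Z hZ h1
          rw [h2]
          exact hsep Z (h3.trans hX.subset) h0 h1)
          ⟨X, Finset.subset_insert _ _, hX.mem, hX.notMem, by
            rw [(hcut X (Finset.subset_insert _ _) hX.notMem).1, hX.cut_eq]⟩ rfl with h | h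
      · exact absurd (h.of_imm himm) hD
      · obtain ⟨X₁, X₂, h1, h2, h3, h4⟩ := h
        refine ⟨X₁, (htight X₁ h1).1, h2, ?_⟩
        have h5 := h1.of_reach h4
        -- The chain ends with at most two vertices of the contraction outside $X_2$, one of them
        -- being $x_1$. So $X_2$ lacks at most one vertex of $X$, and one more step reaches $X$.
        refine ReflTransGen.trans (ReflTransGen.mono ?_ _ _ h4) (tightStep_of_card hX (htight X₂ h5).2 ?_)
        · rintro A B ⟨v, hv, hB, hBt⟩
          exact ⟨v, hv, hB, (htight B hBt).1⟩
        · have : insert x₁ (X \ X₂) ⊆ insert x₁ X \ X₂ := by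
            intro v hv
            simp only [Finset.mem_insert, Finset.mem_sdiff] at hv ⊢
            rcases hv with rfl | hv
            · exact ⟨Or.inl rfl, h5.notMem⟩
            · exact ⟨Or.inr hv.1, hv.2⟩
          have h6 := Finset.card_le_card this
          rw [Finset.card_insert_of_notMem (by simp [hX.notMem])] at h6
          omega
    have hright : ∃ X₂, (S \ X₂).card ≤ 2 ∧ ReflTransGen (TightStep S M x₀ x₁ k) X X₂ := by
      by_cases hXc : (S \ X).card ≤ 2
      · exact ⟨X, hXc, .refl⟩
      have hR' := hR.contract hX.mem hX.notMem
      have himm : Imm M (contract X x₀ M) := by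
        refine imm_contract hX.mem fun Z hZ h1 => ?_
        rw [hX.cut_eq]
        exact hsep Z (hZ.trans hX.subset) h1 fun h => hX.notMem (hZ h)
      have hc1 : (insert x₀ (S \ X)).card = (S \ X).card + 1 :=
        Finset.card_insert_of_notMem (by simp [hX.mem])
      have hsub : ∀ Z : Finset α, Z ⊆ insert x₀ (S \ X) → Z ∪ X ⊆ S := fun Z hZ =>
        Finset.union_subset (hZ.trans (Finset.insert_subset hR.mem₀ Finset.sdiff_subset)) hX.subset
      have htight : ∀ Z, Tight (insert x₀ (S \ X)) (contract X x₀ M) x₀ x₁ k Z →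
          Tight S M x₀ x₁ k (Z ∪ X) := by
        intro Z hZ
        refine ⟨hsub Z hZ.subset, by simp [hX.mem], by simp [hX.notMem, hZ.notMem], ?_⟩
        rw [← cut_contract_of_mem hZ.mem, hZ.cut_eq]
      rcases ih (insert x₀ (S \ X)).card (by omega) hR' (by omega) (by
          intro Z hZ h0 h1
          rw [cut_contract_of_mem h0]
          exact hsep _ (hsub Z hZ) (by simp [h0]) (by simp [h1, hX.notMem]))
          ⟨{x₀}, by simp, by simp, by simp [hR.ne.symm], by
            rw [cut_contract_of_mem (by simp), Finset.union_eq_right.2 (by simp [hX.mem]),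
              hX.cut_eq]⟩ rfl with h | h
      · exact absurd (h.of_imm himm) hD
      · obtain ⟨X₁, X₂, h1, h2, h3, h4⟩ := h
        refine ⟨X₂ ∪ X, ?_, (tightStep_of_card (htight X₁ h1) Finset.subset_union_right ?_).trans ?_⟩
        · refine (Finset.card_le_card ?_).trans h3
          intro v hv
          simp only [Finset.mem_sdiff, Finset.mem_union, not_or, Finset.mem_insert] at hv ⊢
          tauto
        · have : insert x₀ ((X₁ ∪ X) \ X) ⊆ X₁ := by
            intro v hv
            simp only [Finset.mem_insert, Finset.mem_sdiff, Finset.mem_union] at hv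
            rcases hv with rfl | hv
            · exact h1.mem
            · tauto
          have h6 := Finset.card_le_card this
          rw [Finset.card_insert_of_notMem (by simp [hX.mem])] at h6
          omega
        · clear h3
          induction h4 with
          | refl => exact .refl
          | @tail A B hA hAB ih' =>
            have hAt := h1.of_reach hA
            obtain ⟨v, hv, rfl, hB⟩ := hAB
            refine ih'.tail ⟨v, ?_, by rw [Finset.insert_union], htight _ hB⟩
            rw [Finset.mem_union, not_or]
            refine ⟨hv, fun hvX => ?_⟩
            have h7 := hB.subset (Finset.mem_insert_self v A)
            rw [Finset.mem_insert, Finset.mem_sdiff] at h7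
            rcases h7 with rfl | h7
            · exact hv hAt.mem
            · exact h7.2 hvX
    obtain ⟨X₁, h1, h2, h3⟩ := hleft
    obtain ⟨X₂, h4, h5⟩ := hright
    exact ⟨X₁, X₂, h1, h2, h4, h3.trans h5⟩
  · left
    -- Otherwise no minimum cut is internal, one of the roots has degree $k$, and `hasD_of_internal`
    -- applies to $x_0$ or, with the roots exchanged, to $x_1$.
    have hint' : ∀ X : Finset α, X ⊆ S → x₀ ∈ X → x₁ ∉ X → 2 ≤ X.card → 2 ≤ (S \ X).card →
        k + 1 ≤ cut M X := by
      intro X h1 h2 h3 h4 h5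
      have := hsep X h1 h2 h3
      rcases this.lt_or_eq with h | h
      · exact h
      · exact absurd ⟨X, ⟨h1, h2, h3, h.symm⟩, h4, h5⟩ hint
    have hc0 : k ≤ cut M {x₀} := by
      have := hsep {x₀} (by simpa using hR.mem₀) (by simp) (by simp [hR.ne.symm])
      simpa using this
    have hc1 : k ≤ cut M {x₁} := by
      have := hsep (S \ {x₁}) Finset.sdiff_subset (by simp [hR.mem₀, hR.ne]) (by simp)
      rw [cut_sdiff hR.mem] at this
      simpa using this
    obtain ⟨X, hX⟩ := hex
    by_cases h2 : 2 ≤ X.card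
    · by_cases h3 : 2 ≤ (S \ X).card
      · exact absurd ⟨X, hX, h2, h3⟩ hint
      · have hx1 : x₁ ∈ S \ X := Finset.mem_sdiff.2 ⟨hR.mem₁, hX.notMem⟩
        have h4 : S \ X = {x₁} := Finset.eq_singleton_iff_unique_mem.2
          ⟨hx1, fun v hv => Finset.card_le_one.1 (by omega) v hv x₁ hx1⟩
        have h5 := hX.cut_eq
        rw [← cut_sdiff hR.mem, h4, Finset.coe_singleton] at h5
        refine (hasD_of_internal hR.symm hk hS ?_ h5 hc0).swap
        intro Y h6 h7 h8 h9 h10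
        have := hint' (S \ Y) Finset.sdiff_subset (Finset.mem_sdiff.2 ⟨hR.mem₀, h8⟩) (by simp [h7])
          h10 (by rwa [Finset.sdiff_sdiff_eq_self h6])
        rwa [cut_sdiff hR.mem] at this
    · have h4 : X = {x₀} := Finset.eq_singleton_iff_unique_mem.2
        ⟨hX.mem, fun v hv => Finset.card_le_one.1 (by omega) v hv x₀ hX.mem⟩
      have h5 := hX.cut_eq
      rw [h4, Finset.coe_singleton] at h5
      exact hasD_of_internal hR hk hS hint' h5 hc1

end

/-! ### Graphs with four vertices -/

/-- The multigraph on `x₀`, `x₁`, `u`, `v` with given edge multiplicities. -/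
def four (x₀ x₁ u v : α) (e p s t t' p' : ℕ) : Multiset (Sym2 α) :=
  e • edge x₀ x₁ + p • edge x₀ u + s • edge u v + t • edge u x₁ + t' • edge x₀ v + p' • edge v x₁

lemma four_hasD {x₀ x₁ u v : α} {e p s t t' p' m : ℕ} {A B C D R : Multiset (Sym2 α)}
    (huv : u ≠ v) (hu0 : u ≠ x₀) (hu1 : u ≠ x₁) (hv0 : v ≠ x₀) (hv1 : v ≠ x₁)
    (ce cs ct ct' : ℕ) {e1 p1 s1 t1 t1' p1' : ℕ}
    (hA : Imm A (edge x₀ u)) (hB : Imm B (edge u x₁)) (hC : Imm C (edge x₀ v))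
    (hD : Imm D (edge v x₁)) (hR : Imm R (edge u v))
    (h : four x₀ x₁ u v e1 p1 s1 t1 t1' p1' = A + B + C + D + R)
    (hm : m - 2 ≤ ce + cs + ct + ct') (he : e1 + ce ≤ e) (hp : p1 + cs + ct ≤ p)
    (hs : s1 + cs ≤ s) (ht : t1 + ct ≤ t) (ht' : t1' + ct' ≤ t') (hp' : p1' + cs + ct' ≤ p') :
    HasD m (four x₀ x₁ u v e p s t t' p') x₀ x₁ := by
  have h1 : Imm (edge x₀ u + edge u v + edge v x₁) (edge x₀ x₁) :=
    ((Imm.refl (edge x₀ u)).path (.refl (edge u v))).path (.refl (edge v x₁))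
  have h2 := imm_path x₀ u x₁
  have h3 := imm_path x₀ v x₁
  have hF : Imm (ce • edge x₀ x₁ + cs • (edge x₀ u + edge u v + edge v x₁) +
      ct • (edge x₀ u + edge u x₁) + ct' • (edge x₀ v + edge v x₁)) ((m - 2) • edge x₀ x₁) := by
    refine (((((Imm.refl (edge x₀ x₁)).nsmul ce).add (h1.nsmul cs)).add (h2.nsmul ct)).add
      (h3.nsmul ct')).trans (imm_of_le ?_)
    rw [← add_nsmul, ← add_nsmul, ← add_nsmul]
    exact nsmul_le_nsmul_left zero_le hm
  refine HasD.of_pieces huv hu0 hu1 hv0 hv1 hA hB hC hD hR hF ?_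
  rw [← h]
  obtain ⟨e, rfl⟩ := Nat.exists_eq_add_of_le he
  obtain ⟨p, rfl⟩ := Nat.exists_eq_add_of_le hp
  obtain ⟨s, rfl⟩ := Nat.exists_eq_add_of_le hs
  obtain ⟨t, rfl⟩ := Nat.exists_eq_add_of_le ht
  obtain ⟨t', rfl⟩ := Nat.exists_eq_add_of_le ht'
  obtain ⟨p', rfl⟩ := Nat.exists_eq_add_of_le hp'
  rw [Multiset.le_iff_exists_add]
  refine ⟨four x₀ x₁ u v e p s t t' p', ?_⟩
  simp only [four, add_nsmul, nsmul_add]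
  abel

/-- The symmetry that exchanges the roots and also $u$ with $v$; it halves the case analysis. -/
lemma four_reverse (x₀ x₁ u v : α) (e p s t t' p' : ℕ) :
    four x₀ x₁ u v e p s t t' p' = four x₁ x₀ v u e p' s t' t p := by
  simp only [four]
  rw [edge_comm x₁ x₀, edge_comm x₁ v, edge_comm v u, edge_comm v x₀, edge_comm x₁ u,
    edge_comm u x₀]
  abel

/-- The hypotheses say that $\{x_0,u\}$ is a separating cut of size at least $m+1$, not larger than
those around $x_0$ and $x_1$, and that $u$ and $v$ have degree at least three. Each alternative
admits an explicit $D_m$; surplus trails are spent on missing legs or on the rung. -/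
lemma four_hasD_of_cases {x₀ x₁ u v : α} (huv : u ≠ v) (hu0 : u ≠ x₀) (hu1 : u ≠ x₁)
    (hv0 : v ≠ x₀) (hv1 : v ≠ x₁) {e p s t t' p' m : ℕ} (hm : 2 ≤ m)
    (hlam : m + 1 ≤ e + t + s + t') (hp : s + t ≤ p) (hp' : s + t' ≤ p') (h3 : 3 ≤ p + s + t)
    (h3' : 3 ≤ p' + s + t')
    (h : (1 ≤ s ∧ 1 ≤ t ∧ 1 ≤ t') ∨ (2 ≤ s ∧ 1 ≤ t) ∨ 3 ≤ s ∨
      (s = 2 ∧ t = 0 ∧ t' = 0 ∧ (3 ≤ p ∨ m + 2 ≤ e + t + s + t')) ∨ (s = 1 ∧ t = 0) ∨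
      (s = 0 ∧ 1 ≤ t ∧ 1 ≤ t' ∧ t < p) ∨ (s = 0 ∧ t' = 0) ∨
      (s = 0 ∧ 2 ≤ t ∧ 2 ≤ t' ∧ m + 2 ≤ e + t + s + t')) :
    HasD m (four x₀ x₁ u v e p s t t' p') x₀ x₁ := by
  have a := Imm.refl (edge x₀ u)
  have b := Imm.refl (edge u x₁)
  have c := Imm.refl (edge x₀ v)
  have d := Imm.refl (edge v x₁)
  have r := Imm.refl (edge u v)
  have f := Imm.refl (edge x₀ x₁)
  rcases h with h | h | h | ⟨h1, h2, h4, h5 | h5⟩ | ⟨h1, h2⟩ | ⟨h1, h2, h4, h5⟩ | ⟨h1, h2⟩ | h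
  · refine four_hasD huv hu0 hu1 hv0 hv1 e (s - 1) (t - 1) (t' - 1)
      (e1 := 0) (p1 := 1) (s1 := 1) (t1 := 1) (t1' := 1) (p1' := 1) a b c d r ?_ ?_ ?_ ?_ ?_ ?_ ?_ ?_
    · simp only [four]; abel
    all_goals omega
  · refine four_hasD huv hu0 hu1 hv0 hv1 e (s - 2) (t - 1) t'
      (e1 := 0) (p1 := 2) (s1 := 2) (t1 := 1) (t1' := 0) (p1' := 1) a b (a.path r) d r
      ?_ ?_ ?_ ?_ ?_ ?_ ?_ ?_
    · simp only [four]; abel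
    all_goals omega
  · refine four_hasD huv hu0 hu1 hv0 hv1 e (s - 3) t t'
      (e1 := 0) (p1 := 2) (s1 := 3) (t1 := 0) (t1' := 0) (p1' := 2) a (r.path d) (a.path r) d r
      ?_ ?_ ?_ ?_ ?_ ?_ ?_ ?_
    · simp only [four]; abel
    all_goals omega
  · refine four_hasD huv hu0 hu1 hv0 hv1 (e - 1) 0 0 0
      (e1 := 1) (p1 := 3) (s1 := 2) (t1 := 0) (t1' := 0) (p1' := 1) a (a.comm.path f) (a.path r) d r
      ?_ ?_ ?_ ?_ ?_ ?_ ?_ ?_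
    · simp only [four]; abel
    all_goals omega
  · refine four_hasD huv hu0 hu1 hv0 hv1 (e - 2) 0 0 0
      (e1 := 2) (p1 := 2) (s1 := 1) (t1 := 0) (t1' := 0) (p1' := 2) a (a.comm.path f)
      (f.path d.comm) d r ?_ ?_ ?_ ?_ ?_ ?_ ?_ ?_
    · simp only [four]; abel
    all_goals omega
  · by_cases h5 : t' = 0
    · refine four_hasD huv hu0 hu1 hv0 hv1 (e - 2) 0 0 0
        (e1 := 2) (p1 := 2) (s1 := 1) (t1 := 0) (t1' := 0) (p1' := 2) a (a.comm.path f)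
        (f.path d.comm) d r ?_ ?_ ?_ ?_ ?_ ?_ ?_ ?_
      · simp only [four]; abel
      all_goals omega
    by_cases h6 : e = 0
    · refine four_hasD huv hu0 hu1 hv0 hv1 0 0 0 (t' - 2)
        (e1 := 0) (p1 := 2) (s1 := 1) (t1 := 0) (t1' := 2) (p1' := 2) a
        ((a.comm.path c).path d) c d r ?_ ?_ ?_ ?_ ?_ ?_ ?_ ?_
      · simp only [four]; abel
      all_goals omega
    · refine four_hasD huv hu0 hu1 hv0 hv1 (e - 1) 0 0 (t' - 1)
        (e1 := 1) (p1 := 2) (s1 := 1) (t1 := 0) (t1' := 1) (p1' := 1) a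
        (a.comm.path f) c d r ?_ ?_ ?_ ?_ ?_ ?_ ?_ ?_
      · simp only [four]; abel
      all_goals omega
  · by_cases h6 : 2 ≤ t'
    · refine four_hasD huv hu0 hu1 hv0 hv1 e 0 (t - 1) (t' - 2)
        (e1 := 0) (p1 := 2) (s1 := 0) (t1 := 1) (t1' := 2) (p1' := 1) a b c d (a.comm.path c)
        ?_ ?_ ?_ ?_ ?_ ?_ ?_ ?_
      · simp only [four]; abel
      all_goals omega
    by_cases h7 : 2 ≤ t
    · refine four_hasD huv hu0 hu1 hv0 hv1 e 0 (t - 2) 0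
        (e1 := 0) (p1 := 1) (s1 := 0) (t1 := 2) (t1' := 1) (p1' := 2) a b c d (b.path d.comm)
        ?_ ?_ ?_ ?_ ?_ ?_ ?_ ?_
      · simp only [four]; abel
      all_goals omega
    · refine four_hasD huv hu0 hu1 hv0 hv1 (e - 1) 0 0 0
        (e1 := 1) (p1 := 2) (s1 := 0) (t1 := 1) (t1' := 1) (p1' := 2) a b c d
        ((a.comm.path f).path d.comm) ?_ ?_ ?_ ?_ ?_ ?_ ?_ ?_
      · simp only [four]; abel
      all_goals omega
  · by_cases h5 : t = 0
    · refine four_hasD huv hu0 hu1 hv0 hv1 (e - 3) 0 0 0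
        (e1 := 3) (p1 := 3) (s1 := 0) (t1 := 0) (t1' := 0) (p1' := 3) a (a.comm.path f)
        (f.path d.comm) d ((a.comm.path f).path d.comm) ?_ ?_ ?_ ?_ ?_ ?_ ?_ ?_
      · simp only [four]; abel
      all_goals omega
    by_cases h6 : e = 0
    · refine four_hasD huv hu0 hu1 hv0 hv1 0 0 (t - 3) 0
        (e1 := 0) (p1 := 2) (s1 := 0) (t1 := 3) (t1' := 0) (p1' := 3) a b
        ((a.path b).path d.comm) d (b.path d.comm) ?_ ?_ ?_ ?_ ?_ ?_ ?_ ?_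
      · simp only [four]; abel
      all_goals omega
    by_cases h7 : t = 1
    · refine four_hasD huv hu0 hu1 hv0 hv1 (e - 2) 0 0 0
        (e1 := 2) (p1 := 2) (s1 := 0) (t1 := 1) (t1' := 0) (p1' := 3) a b
        (f.path d.comm) d ((a.comm.path f).path d.comm) ?_ ?_ ?_ ?_ ?_ ?_ ?_ ?_
      · simp only [four]; abel
      all_goals omega
    · refine four_hasD huv hu0 hu1 hv0 hv1 (e - 1) 0 (t - 2) 0
        (e1 := 1) (p1 := 1) (s1 := 0) (t1 := 2) (t1' := 0) (p1' := 3) a b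
        (f.path d.comm) d (b.path d.comm) ?_ ?_ ?_ ?_ ?_ ?_ ?_ ?_
      · simp only [four]; abel
      all_goals omega
  · refine four_hasD huv hu0 hu1 hv0 hv1 e 0 (t - 2) (t' - 2)
      (e1 := 0) (p1 := 2) (s1 := 0) (t1 := 1) (t1' := 2) (p1' := 1) a b c d (a.comm.path c)
      ?_ ?_ ?_ ?_ ?_ ?_ ?_ ?_
    · simp only [four]; abel
    all_goals omega

/-- A graph on four vertices without an immersion of `D_m`, all of whose separating edge-cuts
have at least `m + 1` edges. -/
theorem four_of_not_hasD {x₀ x₁ u v : α} (huv : u ≠ v) (hu0 : u ≠ x₀) (hu1 : u ≠ x₁)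
    (hv0 : v ≠ x₀) (hv1 : v ≠ x₁) {e p s t t' p' m : ℕ} (hm : 2 ≤ m)
    (hlam : m + 1 ≤ e + t + s + t') (hp : s + t ≤ p) (hp' : s + t' ≤ p') (h3 : 3 ≤ p + s + t)
    (h3' : 3 ≤ p' + s + t') (hD : ¬ HasD m (four x₀ x₁ u v e p s t t' p') x₀ x₁) :
    e + t + s + t' = m + 1 ∧ p = s + t ∧ p' = s + t' ∧ (s = 0 ∨ s = 2 ∧ t = 0 ∧ t' = 0) := by
  have h1 := mt (four_hasD_of_cases huv hu0 hu1 hv0 hv1 hm hlam hp hp' h3 h3') hD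
  -- Applying the cases to the mirror image too excludes $s\ge 3$ and $s=1$: for $s=1$ both $t$ and
  -- $t'$ would be positive, which is the first alternative.
  have h2 := mt (four_hasD_of_cases (x₀ := x₁) (x₁ := x₀) (e := e) (t := t') (t' := t) (s := s) (p := p')
    (p' := p) huv.symm hv1 hv0 hu1 hu0 hm (by omega) hp' hp h3' h3) fun h => hD (by rw [four_reverse]; exact h.swap)
  clear hD
  simp only [not_or] at h1 h2
  obtain ⟨a1, a2, a3, a4, a5, a6, a7, a8⟩ := h1
  obtain ⟨-, b2, -, b4, b5, b6, b7, -⟩ := h2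
  obtain rfl | rfl | rfl : s = 0 ∨ s = 1 ∨ s = 2 := by omega
  · clear a1 a2 a3 a4 a5 b2 b4 b5
    have : p = t := by clear a8; omega
    have : p' = t' := by clear a8; omega
    omega
  · omega
  · clear a1 a3 a5 a6 a7 a8 b5 b6 b7
    obtain rfl : t = 0 := by clear a4 b4; omega
    obtain rfl : t' = 0 := by clear a4 b4; omega
    omega

/-! ### Consecutive vertices of a chain of tight edge-cuts -/

lemma cut_union {M : Multiset (Sym2 α)} {A B : Set α} (h : Disjoint A B) :
    cut M (A ∪ B) + 2 * btw M A B = cut M A + cut M B := by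
  induction M using Multiset.induction_on with
  | empty => simp
  | cons e M ih =>
    induction e with | _ a b
    have ha : ¬ (a ∈ A ∧ a ∈ B) := fun h' => Set.disjoint_left.1 h h'.1 h'.2
    have hb : ¬ (b ∈ A ∧ b ∈ B) := fun h' => Set.disjoint_left.1 h h'.1 h'.2
    simp only [cut_cons, btw_cons, Set.mem_union]
    by_cases h1 : a ∈ A <;> by_cases h2 : b ∈ A <;> by_cases h3 : a ∈ B <;>
      by_cases h4 : b ∈ B <;> simp_all <;> omega

lemma btw_union {M : Multiset (Sym2 α)} {A B C : Set α} (h : Disjoint B C) (hB : Disjoint A B)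
    (hC : Disjoint A C) : btw M A (B ∪ C) = btw M A B + btw M A C := by
  induction M using Multiset.induction_on with
  | empty => simp
  | cons e M ih =>
    induction e with | _ a b
    have h1 := fun v => @Set.disjoint_left.1 h v
    have h2 := fun v => @Set.disjoint_left.1 hB v
    have h3 := fun v => @Set.disjoint_left.1 hC v
    have ha := h1 a
    have hb := h1 b
    have ha2 := h2 a
    have hb2 := h2 b
    have ha3 := h3 a
    have hb3 := h3 b
    clear h1 h2 h3
    simp only [btw_cons, Set.mem_union, ih]
    by_cases h1 : a ∈ A <;> by_cases h2 : b ∈ A <;> by_cases h3 : a ∈ B <;>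
      by_cases h4 : b ∈ B <;> by_cases h5 : a ∈ C <;> by_cases h6 : b ∈ C <;>
      simp_all <;> omega

lemma cut_eq_btw {M : Multiset (Sym2 α)} {A B : Set α} (h : Disjoint A B)
    (hM : ∀ e ∈ M, ∀ v ∈ e, v ∈ A ∪ B) : cut M A = btw M A B := by
  have h0 : cut M (A ∪ B) = 0 := by
    rw [cut_eq_zero]
    rintro e he ⟨-, v, hv, hvX⟩
    exact hvX (hM e he v hv)
  have h1 : cut M A = cut M B := by
    rw [← cut_compl]
    apply cut_congr
    intro e he v hv
    have := hM e he v hv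
    have h2 := @Set.disjoint_left.1 h v
    simp only [Set.mem_compl_iff, Set.mem_union] at *
    tauto
  have := cut_union (M := M) h
  omega

lemma four_add (x₀ x₁ u v : α) (e p s t t' p' e1 p1 s1 t1 t1' p1' : ℕ) :
    four x₀ x₁ u v (e + e1) (p + p1) (s + s1) (t + t1) (t' + t1') (p' + p1') =
      four x₀ x₁ u v e p s t t' p' + four x₀ x₁ u v e1 p1 s1 t1 t1' p1' := by
  simp only [four, add_nsmul]
  abel

lemma exists_eq_four {x₀ x₁ u v : α} {N : Multiset (Sym2 α)} (hl : ∀ e ∈ N, ¬ e.IsDiag)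
    (hN : ∀ e ∈ N, ∀ w ∈ e, w = x₀ ∨ w = x₁ ∨ w = u ∨ w = v) :
    ∃ e p s t t' p', N = four x₀ x₁ u v e p s t t' p' := by
  induction N using Multiset.induction_on with
  | empty => exact ⟨0, 0, 0, 0, 0, 0, by simp [four]⟩
  | cons a N ih =>
    obtain ⟨e, p, s, t, t', p', rfl⟩ := ih (fun e he => hl e (by simp [he]))
      (fun e he => hN e (by simp [he]))
    have h1 := hl a (by simp)
    have h2 := hN a (by simp)
    clear hl hN ih
    induction a with | _ a b
    have ha := h2 a (by simp)
    have hb := h2 b (by simp)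
    have hab : a ≠ b := by simpa using h1
    have key : ∀ e1 p1 s1 t1 t1' p1', edge a b = four x₀ x₁ u v e1 p1 s1 t1 t1' p1' →
        ∃ e2 p2 s2 t2 t2' p2', s(a, b) ::ₘ four x₀ x₁ u v e p s t t' p' =
          four x₀ x₁ u v e2 p2 s2 t2 t2' p2' := fun e1 p1 s1 t1 t1' p1' h =>
      ⟨e1 + e, p1 + p, s1 + s, t1 + t, t1' + t', p1' + p', by
        rw [four_add, ← h, Multiset.singleton_add]⟩
    rcases ha with rfl | rfl | rfl | rfl <;> rcases hb with rfl | rfl | rfl | rfl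
    all_goals first
      | exact absurd rfl hab
      | (refine key 1 0 0 0 0 0 ?_; simp [four]; done)
      | (refine key 0 1 0 0 0 0 ?_; simp [four]; done)
      | (refine key 0 0 1 0 0 0 ?_; simp [four]; done)
      | (refine key 0 0 0 1 0 0 ?_; simp [four]; done)
      | (refine key 0 0 0 0 1 0 ?_; simp [four]; done)
      | (refine key 0 0 0 0 0 1 ?_; simp [four])

lemma cut_four (x₀ x₁ u v : α) (e p s t t' p' : ℕ) (Y : Set α) :
    cut (four x₀ x₁ u v e p s t t' p') Y = e * (if (x₀ ∈ Y ↔ x₁ ∈ Y) then 0 else 1) +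
      p * (if (x₀ ∈ Y ↔ u ∈ Y) then 0 else 1) + s * (if (u ∈ Y ↔ v ∈ Y) then 0 else 1) +
      t * (if (u ∈ Y ↔ x₁ ∈ Y) then 0 else 1) + t' * (if (x₀ ∈ Y ↔ v ∈ Y) then 0 else 1) +
      p' * (if (v ∈ Y ↔ x₁ ∈ Y) then 0 else 1) := by
  simp only [four, cut_add, cut_nsmul, cut_edge]

lemma cut_contract_of_saturated {W : Finset α} {r : α} {M : Multiset (Sym2 α)} {Y : Set α}
    (h : ∀ w ∈ W, (w ∈ Y ↔ r ∈ Y)) : cut (contract W r M) Y = cut M Y := by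
  rw [cut_contract]
  congr 1
  ext w
  simp only [Set.mem_preimage, collapse]
  split_ifs with h1
  · exact (h w h1).symm
  · rfl

section

variable {S X W : Finset α} {M : Multiset (Sym2 α)} {x₀ x₁ u v : α} {m k : ℕ}

/-- Contraction of both sides of two tight edge-cuts with only `u` and `v` between them. -/
lemma exists_imm_four (hR : Rooted S M x₀ x₁)
    (hsep : ∀ X : Finset α, X ⊆ S → x₀ ∈ X → x₁ ∉ X → k ≤ cut M X)
    (hS : ∀ w, w ∈ S ↔ w ∈ X ∨ w = u ∨ w = v ∨ w ∈ W) (h0 : x₀ ∈ X) (h1 : x₁ ∈ W)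
    (hXW : Disjoint X W) (hX : X = {x₀} ∨ cut M X = k) (hW : W = {x₁} ∨ cut M W = k) :
    ∃ e p s t t' p', Imm M (four x₀ x₁ u v e p s t t' p') ∧
      ∀ Y : Set α, (∀ w ∈ X, (w ∈ Y ↔ x₀ ∈ Y)) → (∀ w ∈ W, (w ∈ Y ↔ x₁ ∈ Y)) →
        cut M Y = cut (four x₀ x₁ u v e p s t t' p') Y := by
  have hXS : X ⊆ S := fun w hw => (hS w).2 (Or.inl hw)
  have hWS : W ⊆ S := fun w hw => (hS w).2 (by simp [hw])
  have h1X : x₁ ∉ X := fun h => Finset.disjoint_left.1 hXW h h1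
  have h0W : x₀ ∉ W := fun h => Finset.disjoint_left.1 hXW h0 h
  -- If $X=\{x_0\}$ nothing is contracted and no minimality is needed. This matters for the first
  -- pair of a chain, where the degree of $x_0$ is not yet known to be $k$.
  have himm1 : Imm M (contract X x₀ M) := by
    refine imm_contract h0 fun Z hZ h0Z => ?_
    rcases hX with rfl | hX
    · have : Z = {x₀} := hZ.antisymm (by simpa using h0Z)
      rw [this]
    · rw [hX]
      exact hsep Z (hZ.trans hXS) h0Z fun h => h1X (hZ h)
  have himm2 : Imm (contract X x₀ M) (contract W x₁ (contract X x₀ M)) := by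
    refine imm_contract h1 fun Z hZ h1Z => ?_
    rcases hW with rfl | hW
    · have : Z = {x₁} := hZ.antisymm (by simpa using h1Z)
      rw [this]
    · have hsat : ∀ Z ⊆ W, ∀ w ∈ X, (w ∈ (Z : Set α) ↔ x₀ ∈ (Z : Set α)) := by
        intro Z hZ w hw
        have h2 : w ∉ Z := fun h => Finset.disjoint_left.1 hXW hw (hZ h)
        have h3 : x₀ ∉ Z := fun h => h0W (hZ h)
        simp [h2, h3]
      rw [cut_contract_of_saturated (hsat W subset_rfl), cut_contract_of_saturated (hsat Z hZ), hW,
        ← cut_sdiff hR.mem]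
      exact hsep _ Finset.sdiff_subset (by simpa [hR.mem₀] using fun h => h0W (hZ h)) (by simp [h1Z])
  have hR2 := ((hR.contract h0 h1X).symm.contract (W := W) (x₀ := x₁) h1 h0W).symm
  obtain ⟨e, p, s, t, t', p', hfour⟩ := exists_eq_four (x₀ := x₀) (x₁ := x₁) (u := u) (v := v)
    hR2.loopless (by
      intro a ha w hw
      have := hR2.mem a ha w hw
      simp only [Finset.mem_insert, Finset.mem_sdiff, hS] at this
      tauto)
  refine ⟨e, p, s, t, t', p', ?_, fun Y hY1 hY2 => ?_⟩
  · rw [← hfour]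
    exact himm1.trans himm2
  · rw [← hfour, cut_contract_of_saturated hY2, cut_contract_of_saturated hY1]

/-- Contracting $X$ and $W$ leaves four vertices and preserves all cuts that split neither set. The
multiplicities can therefore be read off from cuts in $M$, and the equalities of `four_of_not_hasD`
say that $X$ and $W$ are tight as well. -/
theorem pair_of_not_hasD (hR : Rooted S M x₀ x₁) (hm : 2 ≤ m) (hk : m + 1 ≤ k)
    (hsep : ∀ X : Finset α, X ⊆ S → x₀ ∈ X → x₁ ∉ X → k ≤ cut M X) (hD : ¬ HasD m M x₀ x₁)
    (hS : ∀ w, w ∈ S ↔ w ∈ X ∨ w = u ∨ w = v ∨ w ∈ W) (h0 : x₀ ∈ X) (h1 : x₁ ∈ W)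
    (hXW : Disjoint X W) (huv : u ≠ v) (huX : u ∉ X) (huW : u ∉ W) (hvX : v ∉ X) (hvW : v ∉ W)
    (hX : X = {x₀} ∨ cut M X = k) (hW : W = {x₁} ∨ cut M W = k)
    (hXu : cut M (X ∪ {u}) = k) :
    k = m + 1 ∧ cut M X = k ∧ cut M W = k ∧
      (M.count s(u, v) = 0 ∨ M.count s(u, v) = 2 ∧ btw M {u} W = 0 ∧ btw M {v} X = 0) := by
  have hXS : X ⊆ S := fun w hw => (hS w).2 (Or.inl hw)
  have hWS : W ⊆ S := fun w hw => (hS w).2 (by simp [hw])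
  have hd : ∀ w ∈ X, w ∉ W := fun w h => Finset.disjoint_left.1 hXW h
  have hd' : ∀ w ∈ W, w ∉ X := fun w h h' => hd w h' h
  have hu0 : u ≠ x₀ := by rintro rfl; exact huX h0
  have hv0 : v ≠ x₀ := by rintro rfl; exact hvX h0
  have hu1 : u ≠ x₁ := by rintro rfl; exact huW h1
  have hv1 : v ≠ x₁ := by rintro rfl; exact hvW h1
  obtain ⟨e, p, s, t, t', p', himm, hcut⟩ := exists_imm_four hR hsep hS h0 h1 hXW hX hW
  have hXn : ∀ w ∈ X, w ≠ u ∧ w ≠ v := fun w hw =>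
    ⟨fun h => huX (h ▸ hw), fun h => hvX (h ▸ hw)⟩
  have hWn : ∀ w ∈ W, w ≠ u ∧ w ≠ v := fun w hw =>
    ⟨fun h => huW (h ▸ hw), fun h => hvW (h ▸ hw)⟩
  -- The four propositions record which of $X$, $W$, $u$, $v$ belong to $Y$.
  have key : ∀ (i0 i1 iu iv : Prop) (Y : Set α), (∀ w ∈ X, (w ∈ Y ↔ i0)) → (∀ w ∈ W, (w ∈ Y ↔ i1)) →
      (u ∈ Y ↔ iu) → (v ∈ Y ↔ iv) → cut M Y = e * (if (i0 ↔ i1) then 0 else 1) +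
      p * (if (i0 ↔ iu) then 0 else 1) + s * (if (iu ↔ iv) then 0 else 1) +
      t * (if (iu ↔ i1) then 0 else 1) + t' * (if (i0 ↔ iv) then 0 else 1) +
      p' * (if (iv ↔ i1) then 0 else 1) := by
    intro i0 i1 iu iv Y hY1 hY2 hu hv
    rw [hcut Y (fun w hw => (hY1 w hw).trans (hY1 _ h0).symm)
      (fun w hw => (hY2 w hw).trans (hY2 _ h1).symm), cut_four]
    simp only [hY1 _ h0, hY2 _ h1, hu, hv]
  have c1 := key True False False False X (by simp) (by simpa using hd') (by simpa using huX)
    (by simpa using hvX)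
  have c2 := key True False True False (X ∪ {u}) (by simp +contextual)
    (fun w hw => by simp [hd' w hw, hWn w hw]) (by simp) (by simp [hvX, huv.symm])
  have c3 := key False False True False {u} (fun w hw => by simp [hXn w hw])
    (fun w hw => by simp [hWn w hw]) (by simp) (by simp [huv.symm])
  have c4 := key False False False True {v} (fun w hw => by simp [hXn w hw])
    (fun w hw => by simp [hWn w hw]) (by simp [huv]) (by simp)
  have c5 := key False False True True ({u} ∪ {v}) (fun w hw => by simp [hXn w hw])
    (fun w hw => by simp [hWn w hw]) (by simp) (by simp)
  have c6 := key False True False False W (by simpa using hd) (by simp) (by simpa using huW)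
    (by simpa using hvW)
  have c7 := key True False False True (X ∪ {v}) (by simp +contextual)
    (fun w hw => by simp [hd' w hw, hWn w hw]) (by simp [huX, huv]) (by simp)
  have c8 := key False True True False ({u} ∪ W) (fun w hw => by simp [hd w hw, hXn w hw])
    (by simp +contextual) (by simp) (by simp [hvW, huv.symm])
  simp only [iff_false, iff_true, not_true, if_false, if_true, mul_zero, mul_one, zero_add,
    add_zero, not_false_eq_true] at c1 c2 c3 c4 c5 c6 c7 c8
  clear key hcut
  have b1 := cut_union (M := M) (A := {u}) (B := {v}) (by simpa using huv)
  have b2 := cut_union (M := M) (A := {u}) (B := W) (by simpa using huW)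
  have b3 := cut_union (M := M) (A := X) (B := {v}) (by simpa using hvX)
  rw [btw_comm M X {v}] at b3
  rw [btw_singleton] at b1
  have k1 := hsep X hXS h0 fun h => hd _ h h1
  have k2 := hsep (S \ W) Finset.sdiff_subset (by simp [hR.mem₀, hd _ h0]) (by simp [h1])
  rw [cut_sdiff hR.mem] at k2
  have d1 := hR.three_le {u} (by simp [hS]) (by simp [hu0.symm]) (by simp [hu1.symm]) (by simp)
  have d2 := hR.three_le {v} (by simp [hS]) (by simp [hv0.symm]) (by simp [hv1.symm]) (by simp)
  rw [Finset.coe_singleton] at d1 d2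
  obtain ⟨f1, f2, f3, f4⟩ := four_of_not_hasD huv hu0 hu1 hv0 hv1 hm (e := e) (p := p) (s := s)
    (t := t) (t' := t') (p' := p') (by omega) (by omega) (by omega) (by omega) (by omega)
    fun h => hD (h.of_imm himm)
  refine ⟨by omega, by omega, by omega, ?_⟩
  rcases f4 with f4 | ⟨f4, f5, f6⟩
  · left; omega
  · right; refine ⟨by omega, by omega, by omega⟩

end

/-! ### Linear orders of the vertices with tight initial segments -/

section

variable {S : Finset α} {M : Multiset (Sym2 α)} {x₀ x₁ : α} {m k : ℕ}

/-- `L` lists the vertices of `S` other than the roots. -/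
structure IsListing (S : Finset α) (x₀ x₁ : α) (L : List α) : Prop where
  nodup : L.Nodup
  mem_iff : ∀ v, v ∈ L ↔ v ∈ S ∧ v ≠ x₀ ∧ v ≠ x₁

lemma exists_list_of_reach {X Y : Finset α} (hX : Tight S M x₀ x₁ k X)
    (h : ReflTransGen (TightStep S M x₀ x₁ k) X Y) :
    ∃ L : List α, L.Nodup ∧ (∀ v ∈ L, v ∉ X) ∧ Y = X ∪ L.toFinset ∧
      ∀ P Q, L = P ++ Q → cut M (X ∪ P.toFinset : Finset α) = k := by
  induction h with
  | refl => exact ⟨[], by simp, by simp, by simp, fun P Q h => by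
      obtain ⟨rfl, rfl⟩ := List.append_eq_nil_iff.1 h.symm; simpa using hX.cut_eq⟩
  | @tail Y Z _ h ih =>
    obtain ⟨L, h1, h2, rfl, h4⟩ := ih
    obtain ⟨v, hv, rfl, hZ⟩ := h
    have hvX : v ∉ X := fun h => hv (by simp [h])
    have hvL : v ∉ L := fun h => hv (by simp [h])
    have heq : insert v (X ∪ L.toFinset) = X ∪ (L ++ [v]).toFinset := by
      ext w
      simp only [Finset.mem_insert, Finset.mem_union, List.mem_toFinset, List.mem_append,
        List.mem_singleton]
      tauto
    refine ⟨L ++ [v], by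
      simp only [List.nodup_append, h1, List.nodup_singleton, true_and, List.mem_singleton]
      rintro a ha b rfl rfl
      exact hvL ha, ?_, heq, ?_⟩
    · intro w hw
      rcases List.mem_append.1 hw with hw | hw
      · exact h2 w hw
      · rw [List.mem_singleton.1 hw]; exact hvX
    · intro P Q hPQ
      rcases List.eq_nil_or_concat Q with rfl | ⟨Q', w, rfl⟩
      · rw [List.append_nil] at hPQ
        rw [← hPQ, ← heq]
        exact hZ.cut_eq
      · rw [List.concat_eq_append, ← List.append_assoc] at hPQ
        exact h4 P Q' (List.append_inj_left' hPQ rfl)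

/-- List the vertex of $X$ other than $x_0$, then the vertices in the order in which the chain adds
them, then the vertex outside $Y$ other than $x_1$. The first and last blocks have at most one
element, so every proper nonempty initial segment belongs to the chain. The empty and the full
segment need not be tight at this point. -/
lemma exists_listing (hR : Rooted S M x₀ x₁) (hA : TypeA S M x₀ x₁ k) :
    ∃ L, IsListing S x₀ x₁ L ∧ ∀ P Q, L = P ++ Q → P ≠ [] → Q ≠ [] →
      cut M (insert x₀ P.toFinset : Finset α) = k := by
  obtain ⟨X, Y, hX, hXc, hYc, hXY⟩ := hA
  have hY := hX.of_reach hXY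
  obtain ⟨L, h1, h2, rfl, h4⟩ := exists_list_of_reach hX hXY
  have hlen : (X.erase x₀).toList.length ≤ 1 := by
    rw [Finset.length_toList, Finset.card_erase_of_mem hX.mem]
    omega
  have hlen' : ((S \ (X ∪ L.toFinset)).erase x₁).toList.length ≤ 1 := by
    rw [Finset.length_toList, Finset.card_erase_of_mem (Finset.mem_sdiff.2 ⟨hR.mem₁, hY.notMem⟩)]
    omega
  have hA : ∀ w, w ∈ (X.erase x₀).toList ↔ w ≠ x₀ ∧ w ∈ X := by simp
  have hB : ∀ w, w ∈ ((S \ (X ∪ L.toFinset)).erase x₁).toList ↔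
      w ≠ x₁ ∧ w ∈ S ∧ w ∉ X ∧ w ∉ L := by simp
  have hAn : (X.erase x₀).toList.Nodup := Finset.nodup_toList _
  have hBn : ((S \ (X ∪ L.toFinset)).erase x₁).toList.Nodup := Finset.nodup_toList _
  generalize (X.erase x₀).toList = A at *
  generalize ((S \ (X ∪ L.toFinset)).erase x₁).toList = B at *
  have hLS : ∀ w ∈ L, w ∈ S := fun w hw => hY.subset (by simp [hw])
  have hL1 : x₁ ∉ L := fun h => hY.notMem (by simp [h])
  have hL0 : x₀ ∉ L := fun h => h2 _ h hX.mem
  refine ⟨A ++ (L ++ B), ⟨?_, ?_⟩, ?_⟩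
  · rw [List.nodup_append, List.nodup_append]
    refine ⟨hAn, ⟨h1, hBn, ?_⟩, ?_⟩
    · rintro a ha b hb rfl
      exact ((hB _).1 hb).2.2.2 ha
    · rintro a ha b hb rfl
      have h5 := ((hA _).1 ha).2
      rcases List.mem_append.1 hb with hb | hb
      · exact h2 _ hb h5
      · exact ((hB _).1 hb).2.2.1 h5
  · intro v
    rw [List.mem_append, List.mem_append, hA, hB]
    constructor
    · rintro (⟨h5, h6⟩ | h5 | h5)
      · exact ⟨hX.subset h6, h5, fun h => hX.notMem (h ▸ h6)⟩
      · exact ⟨hLS v h5, fun h => hL0 (h ▸ h5), fun h => hL1 (h ▸ h5)⟩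
      · exact ⟨h5.2.1, fun h => h5.2.2.1 (h ▸ hX.mem), h5.1⟩
    · rintro ⟨h5, h6, h7⟩
      tauto
  · intro P Q hPQ hP hQ
    obtain ⟨P', rfl⟩ : ∃ P', P = A ++ P' := by
      match A, hlen with
      | [], _ => exact ⟨P, rfl⟩
      | [a], _ =>
        cases P with
        | nil => exact absurd rfl hP
        | cons p P => exact ⟨P, by simp only [List.cons_append, List.cons.injEq] at hPQ; simp [hPQ.1]⟩
    rw [List.append_assoc, List.append_cancel_left_eq] at hPQ
    obtain ⟨Q', rfl⟩ : ∃ Q', Q = Q' ++ B := by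
      match B, hlen' with
      | [], _ => exact ⟨Q, by simp⟩
      | [b], _ =>
        rcases List.eq_nil_or_concat Q with rfl | ⟨Q', w, rfl⟩
        · exact absurd rfl hQ
        · rw [List.concat_eq_append, ← List.append_assoc] at hPQ
          have := List.append_inj_right' hPQ rfl
          exact ⟨Q', by rw [List.concat_eq_append, this]⟩
    rw [← List.append_assoc, List.append_cancel_right_eq] at hPQ
    have h5 := h4 P' Q' hPQ
    rw [← h5]
    congr 2
    ext w
    simp only [Finset.mem_insert, List.mem_toFinset, List.mem_append, Finset.mem_union, hA]
    constructor
    · rintro (rfl | ⟨-, h⟩ | h)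
      · exact Or.inl hX.mem
      · exact Or.inl h
      · exact Or.inr h
    · tauto

/-- The initial segments of `L` together with `x₀` are tight. -/
structure TightList (S : Finset α) (M : Multiset (Sym2 α)) (x₀ x₁ : α) (k : ℕ) (L : List α) : Prop
    extends IsListing S x₀ x₁ L where
  tight : ∀ P Q, L = P ++ Q → cut M (insert x₀ P.toFinset : Finset α) = k

/-- The hypotheses on a rooted graph without an immersion of `D_m` whose separating edge-cuts have at
least `k > m` edges. -/
structure NoD (S : Finset α) (M : Multiset (Sym2 α)) (x₀ x₁ : α) (m k : ℕ) : Prop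
    extends Rooted S M x₀ x₁ where
  two_le : 2 ≤ m
  lt : m + 1 ≤ k
  le_cut : ∀ X : Finset α, X ⊆ S → x₀ ∈ X → x₁ ∉ X → k ≤ cut M X
  not_hasD : ¬ HasD m M x₀ x₁

/-- Besides the adjacency of $u$ and $v$, this yields tightness of the segments before $u$ and after
$v$, even where the chain does not provide it. -/
lemma NoD.pair (hR : NoD S M x₀ x₁ m k) {P Q : List α} {u v : α}
    (hL : IsListing S x₀ x₁ (P ++ u :: v :: Q))
    (ht : ∀ P' Q', P ++ u :: v :: Q = P' ++ Q' → P' ≠ [] → Q' ≠ [] →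
      cut M (insert x₀ P'.toFinset : Finset α) = k) :
    k = m + 1 ∧ cut M (insert x₀ P.toFinset : Finset α) = k ∧
      cut M (insert x₁ Q.toFinset : Finset α) = k ∧
      (M.count s(u, v) = 0 ∨ M.count s(u, v) = 2 ∧ btw M {u} (insert x₁ Q.toFinset : Finset α) = 0 ∧
        btw M {v} (insert x₀ P.toFinset : Finset α) = 0) := by
  have hmem := hL.mem_iff
  have hnd := hL.nodup
  simp only [List.mem_append, List.mem_cons] at hmem
  rw [List.nodup_append, List.nodup_cons, List.nodup_cons] at hnd
  obtain ⟨n1, ⟨n2, n3, n4⟩, n5⟩ := hnd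
  simp only [List.mem_cons, not_or] at n2
  have hu := (hmem u).1 (by simp)
  have hv := (hmem v).1 (by simp)
  have h0 : x₀ ∉ P ∧ x₀ ∉ Q := by
    have := (hmem x₀).not.2 (by simp)
    tauto
  have h1 : x₁ ∉ P ∧ x₁ ∉ Q := by
    have := (hmem x₁).not.2 (by simp)
    tauto
  have huP : u ∉ P := fun h => n5 u h u (by simp) rfl
  have hvP : v ∉ P := fun h => n5 v h v (by simp) rfl
  have hS : ∀ w, w ∈ S ↔ w ∈ insert x₀ P.toFinset ∨ w = u ∨ w = v ∨ w ∈ insert x₁ Q.toFinset := by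
    intro w
    have := hmem w
    simp only [Finset.mem_insert, List.mem_toFinset]
    by_cases h2 : w = x₀
    · simp [h2, hR.mem₀]
    by_cases h3 : w = x₁
    · simp [h3, hR.mem₁]
    tauto
  refine pair_of_not_hasD hR.toRooted hR.two_le hR.lt hR.le_cut hR.not_hasD hS (by simp) (by simp)
    ?_ n2.1 ?_ ?_ ?_ ?_ ?_ ?_ ?_
  · rw [Finset.disjoint_left]
    intro w hw hw'
    simp only [Finset.mem_insert, List.mem_toFinset] at hw hw'
    rcases hw with rfl | hw <;> rcases hw' with rfl | hw'
    · exact hR.ne rfl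
    · exact h0.2 hw'
    · exact h1.1 hw
    · exact n5 w hw w (by simp [hw']) rfl
  · simp [hu.2.1, huP]
  · simp [hu.2.2, n2.2]
  · simp [hv.2.1, hvP]
  · simp [hv.2.2, n3]
  · by_cases hP : P = []
    · left; simp [hP]
    · right
      exact ht P (u :: v :: Q) rfl hP (by simp)
  · by_cases hQ : Q = []
    · left; simp [hQ]
    · right
      rw [← ht (P ++ [u, v]) Q (by simp) (by simp) hQ, ← cut_sdiff hR.mem]
      congr 2
      ext w
      simp only [Finset.mem_sdiff, hS, Finset.mem_insert, List.mem_toFinset, List.mem_append,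
        List.mem_cons, List.not_mem_nil, or_false]
      constructor
      · tauto
      · rintro (rfl | h2 | rfl | rfl)
        · exact ⟨by simp, by simp [hR.ne, h0.2]⟩
        · exact ⟨by simp [h2], by
            rintro (rfl | h3)
            · exact h1.1 h2
            · exact n5 w h2 w (by simp [h3]) rfl⟩
        · exact ⟨by simp, by simp [hu.2.2, n2.2]⟩
        · exact ⟨by simp, by simp [hv.2.2, n3]⟩
  · rw [← ht (P ++ [u]) (v :: Q) (by simp) (by simp) (by simp)]
    congr 1
    ext w
    simp only [Finset.coe_insert, List.coe_toFinset, Set.mem_union, Set.mem_insert_iff,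
      Set.mem_ofPred_eq, Set.mem_singleton_iff, List.mem_append, List.mem_singleton]
    tauto

/-- The first pair shows that $\{x_0\}$ is tight, the last pair that $S\setminus\{x_1\}$ is. -/
theorem NoD.exists_tightList (hR : NoD S M x₀ x₁ m k) (hS : 4 ≤ S.card)
    (hA : TypeA S M x₀ x₁ k) : k = m + 1 ∧ ∃ L, TightList S M x₀ x₁ k L := by
  obtain ⟨L, hL, ht⟩ := exists_listing hR.toRooted hA
  have hlen : 2 ≤ L.length := by
    have h1 : S = insert x₀ (insert x₁ L.toFinset) := by
      ext w
      simp only [Finset.mem_insert, List.mem_toFinset, hL.mem_iff]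
      constructor
      · tauto
      · rintro (rfl | rfl | h)
        · exact hR.mem₀
        · exact hR.mem₁
        · exact h.1
    have h2 := Finset.card_insert_le x₀ (insert x₁ L.toFinset)
    have h3 := Finset.card_insert_le x₁ L.toFinset
    have h4 := L.toFinset_card_le
    rw [← h1] at h2
    omega
  match L, hlen with
  | u :: v :: Q, _ =>
    have h1 := hR.pair (P := []) hL ht
    refine ⟨h1.1, u :: v :: Q, hL, fun P' Q' h => ?_⟩
    by_cases hP : P' = []
    · rw [hP]; exact h1.2.1
    by_cases hQ : Q' = []
    · obtain ⟨P, a, b, hP⟩ : ∃ P a b, P' = P ++ [a, b] := by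
        subst hQ
        rw [List.append_nil] at h
        rw [← h]
        rcases List.eq_nil_or_concat Q with rfl | ⟨Q, c, rfl⟩
        · exact ⟨[], u, v, rfl⟩
        · rcases List.eq_nil_or_concat Q with rfl | ⟨Q, d, rfl⟩
          · exact ⟨[u], v, c, by simp⟩
          · exact ⟨u :: v :: Q, d, c, by simp⟩
      rw [hP, hQ, List.append_nil] at h
      rw [h] at hL ht
      have h2 := (hR.pair (P := P) (Q := []) hL ht).2.2.1
      rw [← h2, ← cut_sdiff hR.mem, hP]
      congr 2
      ext w
      have hm := hL.mem_iff w
      by_cases h3 : w = x₁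
      · have := (hL.mem_iff x₁).not.2 (by simp)
        simp only [Finset.mem_insert, Finset.mem_sdiff, List.mem_toFinset, h3, this, hR.ne.symm]
        simp [hR.mem₁]
      · by_cases h4 : w = x₀
        · simp [h4, hR.mem₀, hR.ne]
        · simp only [Finset.mem_insert, Finset.mem_sdiff, List.mem_toFinset, hm, h3, h4]
          simp [h3, h4]
    · exact ht P' Q' h hP hQ

end

/-! ### Adjacency in a list with tight initial segments -/

section

variable {S : Finset α} {M : Multiset (Sym2 α)} {x₀ x₁ : α} {m k : ℕ}

lemma IsListing.idxOf {L P Q : List α} {a : α} (h : L.Nodup) (hL : L = P ++ a :: Q) :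
    L.idxOf a = P.length ∧ (∀ z ∈ P, L.idxOf z < P.length) ∧ ∀ z ∈ Q, P.length < L.idxOf z := by
  subst hL
  rw [List.nodup_append, List.nodup_cons] at h
  obtain ⟨h1, ⟨h2, h3⟩, h4⟩ := h
  refine ⟨?_, fun z hz => ?_, fun z hz => ?_⟩
  · rw [List.idxOf_append_of_notMem fun h => h4 a h a (by simp) rfl]
    simp
  · rw [List.idxOf_append_of_mem hz]
    exact List.idxOf_lt_length_of_mem hz
  · rw [List.idxOf_append_of_notMem fun h => h4 z h z (by simp [hz]) rfl,
      List.idxOf_cons_ne _ (by rintro rfl; exact h2 hz)]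
    omega

/-- Only one initial segment changes, from $X\cup\{u\}$ to $X\cup\{v\}$. Without edges between $u$
and $v$, adding $v$ to $X$ changes the cut by as much as adding it to $X\cup\{u\}$, namely not at
all. -/
lemma TightList.swap {P Q : List α} {u v : α} (h : TightList S M x₀ x₁ k (P ++ u :: v :: Q))
    (huv : M.count s(u, v) = 0) : TightList S M x₀ x₁ k (P ++ v :: u :: Q) := by
  have hnd := h.nodup
  have hmem := h.mem_iff
  have hperm : (P ++ v :: u :: Q).Perm (P ++ u :: v :: Q) := (List.Perm.swap u v Q).append_left P
  refine ⟨⟨hperm.nodup_iff.2 hnd, fun w => hperm.mem_iff.trans (hmem w)⟩, ?_⟩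
  intro P' Q' hPQ
  rcases List.append_eq_append_iff.1 hPQ with ⟨R, hP', hR⟩ | ⟨R, hP', hR⟩
  · match R with
    | [] =>
      simp only [List.append_nil] at hP'
      rw [hP']
      exact h.tight P (u :: v :: Q) rfl
    | [c] =>
      simp only [List.cons_append, List.cons.injEq, List.nil_append] at hR
      obtain ⟨rfl, -⟩ := hR
      rw [List.nodup_append, List.nodup_cons, List.nodup_cons] at hnd
      obtain ⟨-, ⟨n2, -, -⟩, n5⟩ := hnd
      have hu := (hmem u).1 (by simp)
      have hv := (hmem v).1 (by simp)
      have huP : u ∉ P := fun h => n5 u h u (by simp) rfl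
      have hvP : v ∉ P := fun h => n5 v h v (by simp) rfl
      have hne : u ≠ v := by rintro rfl; simp at n2
      set X : Set α := ↑(insert x₀ P.toFinset : Finset α) with hX
      have huX : u ∉ X := by simp [hX, hu.2.1, huP]
      have hvX : v ∉ X := by simp [hX, hv.2.1, hvP]
      have t1 : cut M X = k := h.tight P (u :: v :: Q) rfl
      have t2 : cut M (X ∪ {u}) = k := by
        rw [← h.tight (P ++ [u]) (v :: Q) (by simp)]
        congr 1
        ext w
        simp only [hX, Finset.coe_insert, List.coe_toFinset, Set.mem_union, Set.mem_insert_iff,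
          Set.mem_ofPred_eq, Set.mem_singleton_iff, List.mem_append, List.mem_singleton]
        tauto
      have t3 : cut M ((X ∪ {u}) ∪ {v}) = k := by
        rw [← h.tight (P ++ [u, v]) Q (by simp)]
        congr 1
        ext w
        simp only [hX, Finset.coe_insert, List.coe_toFinset, Set.mem_union, Set.mem_insert_iff,
          Set.mem_ofPred_eq, Set.mem_singleton_iff, List.mem_append, List.mem_cons,
          List.not_mem_nil, or_false]
        tauto
      have t4 : cut M (insert x₀ P'.toFinset : Finset α) = cut M (X ∪ {v}) := by
        rw [hP']
        congr 1
        ext w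
        simp only [hX, Finset.coe_insert, List.coe_toFinset, Set.mem_union, Set.mem_insert_iff,
          Set.mem_ofPred_eq, Set.mem_singleton_iff, List.mem_append, List.mem_singleton]
        tauto
      have b1 := cut_union (M := M) (A := X) (B := {v}) (by simpa using hvX)
      have b2 := cut_union (M := M) (A := X ∪ {u}) (B := {v}) (by
        rw [Set.disjoint_singleton_right, Set.mem_union, Set.mem_singleton_iff, not_or]
        exact ⟨hvX, hne.symm⟩)
      rw [btw_comm, btw_union (by simpa using huX) (by simpa using hvX) (by simpa using hne.symm),
        btw_singleton, Sym2.eq_swap, huv, btw_comm] at b2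
      omega
    | c :: d :: R =>
      simp only [List.cons_append, List.cons.injEq] at hR
      obtain ⟨rfl, rfl, hR⟩ := hR
      rw [← h.tight (P ++ u :: v :: R) Q' (by simp [hR]), hP']
      congr 2
      ext w
      simp only [Finset.mem_insert, List.mem_toFinset, List.mem_append, List.mem_cons]
      tauto
  · refine h.tight P' (R ++ u :: v :: Q) ?_
    rw [hP']
    simp

/-- Induction on the vertices between $u$ and $v$. If $u$ is not adjacent to its successor, the two
are exchanged. If it is, the successor is its only later neighbour, which contradicts the edge $uv$
unless $v$ is the successor. -/
lemma TightList.unique (hR : NoD S M x₀ x₁ m k) (R : List α) : ∀ {P Q : List α} {u v : α},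
    TightList S M x₀ x₁ k (P ++ u :: (R ++ v :: Q)) → s(u, v) ∈ M → M.count s(u, v) = 2 ∧
      (∀ z, z = x₁ ∨ z ∈ R ∨ z ∈ Q → s(u, z) ∉ M) ∧ ∀ z, z = x₀ ∨ z ∈ P ∨ z ∈ R → s(v, z) ∉ M := by
  induction R with
  | nil =>
    intro P Q u v h huv
    have h1 := (hR.pair (P := P) (Q := Q) h.toIsListing fun P' Q' h' _ _ => h.tight P' Q' h').2.2.2
    have h2 := Multiset.count_pos.2 huv
    rcases h1 with h1 | ⟨h1, h3, h4⟩
    · omega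
    · refine ⟨h1, fun z hz => btw_eq_zero.1 h3 u rfl z ?_, fun z hz => btw_eq_zero.1 h4 v rfl z ?_⟩
      · simpa using hz
      · simpa using hz
  | cons w R ih =>
    intro P Q u v h huv
    have h1 := (hR.pair (P := P) (Q := R ++ v :: Q) h.toIsListing
      fun P' Q' h' _ _ => h.tight P' Q' h').2.2.2
    rcases h1 with h1 | ⟨h1, h3, h4⟩
    · have h2 := h.swap h1
      rw [← List.singleton_append, ← List.append_assoc] at h2
      obtain ⟨h3, h4, h5⟩ := ih h2 huv
      refine ⟨h3, fun z hz => ?_, fun z hz => ?_⟩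
      · rw [List.mem_cons] at hz
        rcases hz with hz | (rfl | hz) | hz
        · exact h4 z (Or.inl hz)
        · exact Multiset.count_eq_zero.1 h1
        · exact h4 z (by simp [hz])
        · exact h4 z (by simp [hz])
      · apply h5 z
        simp only [List.mem_append, List.mem_cons, List.not_mem_nil, or_false] at hz ⊢
        tauto
    · exact absurd huv (btw_eq_zero.1 h3 u rfl v (by simp))

/-- The segments just before and just after adding $u$ have cuts of equal size, so $u$ has as many
edges back as forward. -/
lemma TightList.balanced (hR : Rooted S M x₀ x₁) {P Q : List α} {u : α}
    (h : TightList S M x₀ x₁ k (P ++ u :: Q)) :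
    btw M {u} (insert x₀ P.toFinset : Finset α) = btw M {u} (insert x₁ Q.toFinset : Finset α) ∧
      cut M {u} = btw M {u} (insert x₀ P.toFinset : Finset α) +
        btw M {u} (insert x₁ Q.toFinset : Finset α) := by
  have hmem := h.mem_iff
  have hnd := h.nodup
  simp only [List.mem_append, List.mem_cons] at hmem
  rw [List.nodup_append, List.nodup_cons] at hnd
  obtain ⟨n1, ⟨n2, n3⟩, n5⟩ := hnd
  have hu := (hmem u).1 (by simp)
  have huP : u ∉ P := fun h => n5 u h u (by simp) rfl
  have h0 : x₀ ∉ P ∧ x₀ ∉ Q := by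
    have := (hmem x₀).not.2 (by simp)
    tauto
  have h1 : x₁ ∉ P ∧ x₁ ∉ Q := by
    have := (hmem x₁).not.2 (by simp)
    tauto
  have t1 := h.tight P (u :: Q) rfl
  have t2 := h.tight (P ++ [u]) Q (by simp)
  set X : Set α := ↑(insert x₀ P.toFinset : Finset α) with hX
  set W : Set α := ↑(insert x₁ Q.toFinset : Finset α) with hW
  have huX : u ∉ X := by simp [hX, hu.2.1, huP]
  have huW : u ∉ W := by simp [hW, hu.2.2, n2]
  have t3 : cut M (insert x₀ (P ++ [u]).toFinset : Finset α) = cut M (X ∪ {u}) := by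
    congr 1
    ext w
    simp only [hX, Finset.coe_insert, List.coe_toFinset, Set.mem_union, Set.mem_insert_iff,
      Set.mem_ofPred_eq, Set.mem_singleton_iff, List.mem_append, List.mem_singleton]
    tauto
  have b1 := cut_union (M := M) (A := X) (B := {u}) (by simpa using huX)
  rw [btw_comm] at b1
  have hXW : Disjoint X W := by
    rw [Set.disjoint_left]
    intro w hw hw'
    simp only [hX, hW, Finset.coe_insert, List.coe_toFinset, Set.mem_insert_iff,
      Set.mem_ofPred_eq] at hw hw'
    rcases hw with rfl | hw <;> rcases hw' with rfl | hw'
    · exact hR.ne rfl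
    · exact h0.2 hw'
    · exact h1.1 hw
    · exact n5 w hw w (by simp [hw']) rfl
  have b2 : cut M {u} = btw M {u} (X ∪ W) := by
    refine cut_eq_btw ?_ fun e he v hv => ?_
    · rw [Set.disjoint_singleton_left, Set.mem_union, not_or]
      exact ⟨huX, huW⟩
    · have h2 := hR.mem e he v hv
      have h3 := hmem v
      simp only [hX, hW, Finset.coe_insert, List.coe_toFinset, Set.mem_union, Set.mem_insert_iff,
        Set.mem_ofPred_eq, Set.mem_singleton_iff]
      tauto
  rw [btw_union hXW (by simpa using huX) (by simpa using huW)] at b2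
  omega

end

/-! ### Lobes -/

/-- `p 0, …, p ℓ` is a path from `x₀` to `x₁` whose edges have multiplicity `n`; together with
edges between `x₀` and `x₁` it forms everything incident with its inner vertices. -/
structure IsLobe (S : Finset α) (M : Multiset (Sym2 α)) (x₀ x₁ : α) (l n : ℕ) (p : ℕ → α) :
    Prop where
  two_le_length : 2 ≤ l
  zero : p 0 = x₀
  last : p l = x₁
  inj : ∀ i j, i ≤ l → j ≤ l → p i = p j → i = j
  mem : ∀ i, i ≤ l → p i ∈ S
  closed : ∀ i, 0 < i → i < l → ∀ z, s(p i, z) ∈ M → ∃ j, j ≤ l ∧ p j = z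
  count : ∀ i j, i < j → j ≤ l → ¬ (i = 0 ∧ j = l) →
    M.count s(p i, p j) = if i + 1 = j then n else 0
  two_le : 2 ≤ n
  eq_two : 3 ≤ l → n = 2

/-- Type `B_m` for multisets of edges. -/
structure TypeB (S : Finset α) (M : Multiset (Sym2 α)) (x₀ x₁ : α) (m : ℕ) : Prop where
  lobe : ∀ v ∈ S, v ≠ x₀ → v ≠ x₁ →
    ∃ l n p, IsLobe S M x₀ x₁ l n p ∧ ∃ i, 0 < i ∧ i < l ∧ p i = v
  -- The degrees of the roots replace the sum over the lobes: each lobe contributes its multiplicity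
  -- to both of them.
  cut₀ : cut M {x₀} = m + 1
  cut₁ : cut M {x₁} = m + 1

lemma btw_eq_count {M : Multiset (Sym2 α)} {a t : α} {B : Set α} (ht : t ∈ B)
    (h : ∀ z ∈ B, z ≠ t → s(a, z) ∉ M) : btw M {a} B = M.count s(a, t) := by
  rw [btw, Multiset.count]
  apply Multiset.countP_congr rfl
  intro e he
  rw [eq_iff_iff]
  constructor
  · rintro ⟨x, rfl, z, hz, rfl⟩
    by_contra hne
    exact h z hz (by rintro rfl; exact hne rfl) he
  · rintro rfl
    exact ⟨a, rfl, t, ht, rfl⟩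

section

variable {S : Finset α} {M : Multiset (Sym2 α)} {x₀ x₁ : α} {m k : ℕ} {L : List α}

/-- `TightList.unique` in terms of positions in the list. -/
lemma TightList.adj (hR : NoD S M x₀ x₁ m k) (hL : TightList S M x₀ x₁ k L) {a b : α} (ha : a ∈ L)
    (hb : b ∈ L) (hab : L.idxOf a < L.idxOf b) (h : s(a, b) ∈ M) : M.count s(a, b) = 2 ∧
      s(a, x₁) ∉ M ∧ s(b, x₀) ∉ M ∧ (∀ z ∈ L, L.idxOf a < L.idxOf z → z ≠ b → s(a, z) ∉ M) ∧
      ∀ z ∈ L, L.idxOf z < L.idxOf b → z ≠ a → s(b, z) ∉ M := by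
  obtain ⟨P, Q₁, hP⟩ := List.append_of_mem ha
  obtain ⟨h1, h2, h3⟩ := IsListing.idxOf hL.nodup hP
  have hb1 : b ∈ Q₁ := by
    rw [hP, List.mem_append, List.mem_cons] at hb
    rcases hb with hb | rfl | hb
    · have := h2 b hb
      omega
    · omega
    · exact hb
  obtain ⟨R, Q, rfl⟩ := List.append_of_mem hb1
  obtain ⟨h4, h5, h6⟩ := IsListing.idxOf (P := P ++ a :: R) (a := b) (Q := Q) hL.nodup (by simp [hP])
  have hL' := hL
  rw [hP] at hL'
  obtain ⟨h7, h8, h9⟩ := TightList.unique hR R hL' h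
  refine ⟨h7, h8 _ (Or.inl rfl), h9 _ (Or.inl rfl), fun z hz hlt hne => ?_, fun z hz hlt hne => ?_⟩
  · rw [hP, List.mem_append, List.mem_cons, List.mem_append, List.mem_cons] at hz
    rcases hz with hz | rfl | hz | rfl | hz
    · have := h2 z hz
      omega
    · omega
    · exact h8 z (by simp [hz])
    · exact absurd rfl hne
    · exact h8 z (by simp [hz])
  · rw [hP, List.mem_append, List.mem_cons, List.mem_append, List.mem_cons] at hz
    rcases hz with hz | rfl | hz | rfl | hz
    · exact h9 z (by simp [hz])
    · exact absurd rfl hne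
    · exact h9 z (by simp [hz])
    · omega
    · have := h6 z hz
      omega

/-- The edges from `a` to earlier vertices and to later vertices are equally many. -/
lemma TightList.btw_eq (hR : NoD S M x₀ x₁ m k) (hL : TightList S M x₀ x₁ k L) {a : α}
    (ha : a ∈ L) : btw M {a} (insert x₀ {z | z ∈ L ∧ L.idxOf z < L.idxOf a}) =
        btw M {a} (insert x₁ {z | z ∈ L ∧ L.idxOf a < L.idxOf z}) ∧
      2 ≤ btw M {a} (insert x₀ {z | z ∈ L ∧ L.idxOf z < L.idxOf a}) := by
  obtain ⟨P, Q, hP⟩ := List.append_of_mem ha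
  obtain ⟨h1, h2, h3⟩ := IsListing.idxOf hL.nodup hP
  have hL' := hL
  rw [hP] at hL'
  obtain ⟨h4, h5⟩ := TightList.balanced hR.toRooted hL'
  have e1 : ((insert x₀ P.toFinset : Finset α) : Set α) =
      insert x₀ {z | z ∈ L ∧ L.idxOf z < L.idxOf a} := by
    ext z
    simp only [Finset.coe_insert, List.coe_toFinset, Set.mem_insert_iff, Set.mem_ofPred_eq, h1]
    refine or_congr_right ⟨fun hz => ⟨by rw [hP]; simp [hz], h2 z hz⟩, fun ⟨hz, hlt⟩ => ?_⟩
    rw [hP, List.mem_append, List.mem_cons] at hz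
    rcases hz with hz | rfl | hz
    · exact hz
    · omega
    · have := h3 z hz
      omega
  have e2 : ((insert x₁ Q.toFinset : Finset α) : Set α) =
      insert x₁ {z | z ∈ L ∧ L.idxOf a < L.idxOf z} := by
    ext z
    simp only [Finset.coe_insert, List.coe_toFinset, Set.mem_insert_iff, Set.mem_ofPred_eq, h1]
    refine or_congr_right ⟨fun hz => ⟨by rw [hP]; simp [hz], h3 z hz⟩, fun ⟨hz, hlt⟩ => ?_⟩
    rw [hP, List.mem_append, List.mem_cons] at hz
    rcases hz with hz | rfl | hz
    · have := h2 z hz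
      omega
    · omega
    · exact hz
  have ha' := (hL.mem_iff a).1 ha
  have := hR.three_le {a} (by simpa using ha'.1) (by simpa using ha'.2.1.symm)
    (by simpa using ha'.2.2.symm) (by simp)
  rw [Finset.coe_singleton] at this
  rw [e1, e2] at h5
  rw [e1, e2] at h4
  omega

lemma TightList.adj_comm {a b : α} : s(a, b) ∈ M ↔ s(b, a) ∈ M := by rw [Sym2.eq_swap]

/-- A path of the graph that follows the order of the list. -/
lemma TightList.exists_lobe (hR : NoD S M x₀ x₁ m k) (hL : TightList S M x₀ x₁ k L) {u : α}
    (hu : u ∈ L) (hfirst : ∀ z ∈ L, L.idxOf z < L.idxOf u → s(u, z) ∉ M) :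
    ∃ l n p, IsLobe S M x₀ x₁ l n p ∧ p 1 = u := by
  -- From each vertex the path goes on to a later neighbour if there is one, and to $x_1$ otherwise.
  obtain ⟨next, hnext⟩ : ∃ next : α → α, ∀ a, (next a ∈ L ∧ L.idxOf a < L.idxOf (next a) ∧
      s(a, next a) ∈ M) ∨ (next a = x₁ ∧ ∀ b ∈ L, L.idxOf a < L.idxOf b → s(a, b) ∉ M) := by
    have : ∀ a, ∃ b, (b ∈ L ∧ L.idxOf a < L.idxOf b ∧ s(a, b) ∈ M) ∨
        (b = x₁ ∧ ∀ b ∈ L, L.idxOf a < L.idxOf b → s(a, b) ∉ M) := by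
      intro a
      by_cases h : ∃ b, b ∈ L ∧ L.idxOf a < L.idxOf b ∧ s(a, b) ∈ M
      · exact h.imp fun b hb => Or.inl hb
      · push Not at h
        exact ⟨x₁, Or.inr ⟨rfl, h⟩⟩
    choose next h using this
    exact ⟨next, h⟩
  have hx0 : x₀ ∉ L := fun h => ((hL.mem_iff _).1 h).2.1 rfl
  have hx1 : x₁ ∉ L := fun h => ((hL.mem_iff _).1 h).2.2 rfl
  set p : ℕ → α := fun i => if i = 0 then x₀ else next^[i - 1] u with hp
  have p0 : p 0 = x₀ := rfl
  have p1 : p 1 = u := rfl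
  have psucc : ∀ i, 0 < i → p (i + 1) = next (p i) := by
    intro i hi
    obtain ⟨j, rfl⟩ := Nat.exists_eq_add_of_le' hi
    simp [hp, Function.iterate_succ_apply']
  -- Positions in the list increase strictly along the path, so it must reach $x_1$. The index
  -- starts at two because $p_0=x_0$ and $p_1=u$.
  have hex : ∃ i, p (i + 2) = x₁ := by
    by_contra hne
    push Not at hne
    have key : ∀ i, p (i + 1) ∈ L ∧ i ≤ L.idxOf (p (i + 1)) := by
      intro i
      induction i with
      | zero => exact ⟨hu, Nat.zero_le _⟩
      | succ i ih =>
        rcases hnext (p (i + 1)) with h | h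
        · rw [← psucc (i + 1) (by omega)] at h
          exact ⟨h.1, by omega⟩
        · rw [← psucc (i + 1) (by omega)] at h
          exact absurd h.1 (hne i)
    have h1 := key L.length
    have h2 := List.idxOf_lt_length_of_mem h1.1
    omega
  obtain ⟨l, hl, hmin⟩ : ∃ l, p (l + 2) = x₁ ∧ ∀ i < l, p (i + 2) ≠ x₁ :=
    ⟨Nat.find hex, Nat.find_spec hex, fun i hi => Nat.find_min hex hi⟩
  have hpL : ∀ i, i ≤ l → p (i + 1) ∈ L := by
    intro i hi
    induction i with
    | zero => exact hu
    | succ i ih =>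
      have h1 := hnext (p (i + 1))
      rw [← psucc (i + 1) (by omega)] at h1
      rcases h1 with h | h
      · exact h.1
      · exact absurd h.1 (hmin i (by omega))
  have hstep : ∀ i, 0 < i → i ≤ l → L.idxOf (p i) < L.idxOf (p (i + 1)) ∧ s(p i, p (i + 1)) ∈ M := by
    intro i h1 h2
    have h3 := hnext (p i)
    rw [← psucc i h1] at h3
    rcases h3 with h | h
    · exact h.2
    · exact absurd (hpL i h2) (h.1 ▸ hx1)
  have hlast : ∀ b ∈ L, L.idxOf (p (l + 1)) < L.idxOf b → s(p (l + 1), b) ∉ M := by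
    have h3 := hnext (p (l + 1))
    rw [← psucc (l + 1) (by omega), hl] at h3
    rcases h3 with h | h
    · exact absurd h.1 hx1
    · exact h.2
  have hmono : ∀ i j, 0 < i → i < j → j ≤ l + 1 → L.idxOf (p i) < L.idxOf (p j) := by
    intro i j h1 h2 h3
    induction j with
    | zero => omega
    | succ j ih =>
      have h4 := (hstep j (by omega) (by omega)).1
      rcases Nat.lt_succ_iff_lt_or_eq.1 h2 with h | rfl
      · exact (ih h (by omega)).trans h4
      · exact h4
  have hpL' : ∀ i, 0 < i → i ≤ l + 1 → p i ∈ L := by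
    intro i h1 h2
    obtain ⟨j, rfl⟩ := Nat.exists_eq_add_of_le' h1
    exact hpL j (by omega)
  have hadj : ∀ i, 0 < i → i ≤ l → _ := fun i h1 h2 =>
    TightList.adj hR hL (hpL' i h1 (by omega)) (hpL' (i + 1) (by omega) (by omega))
      (hstep i h1 h2).1 (hstep i h1 h2).2
  have hpinj : ∀ i j, i < j → j ≤ l + 2 → p i ≠ p j := by
    intro i j h1 h2 h3
    rcases Nat.eq_zero_or_pos i with rfl | h4
    · rcases h2.lt_or_eq with h5 | rfl
      · exact hx0 (by rw [← p0, h3]; exact hpL' j h1 (by omega))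
      · exact hR.ne (by rw [← p0, h3, hl])
    · rcases h2.lt_or_eq with h5 | rfl
      · exact (hmono i j h4 h1 (by omega)).ne (by rw [h3])
      · exact hx1 (by rw [← hl, ← h3]; exact hpL' i h4 (by omega))
  obtain ⟨b1, b2⟩ := TightList.btw_eq hR hL hu
  have hfirst' : btw M {u} (insert x₀ {z | z ∈ L ∧ L.idxOf z < L.idxOf u}) = M.count s(u, x₀) :=
    btw_eq_count (by simp) fun z hz hne => by
      rcases hz with rfl | hz
      · exact absurd rfl hne
      · exact hfirst z hz.1 hz.2
  have hlast' : btw M {p (l + 1)} (insert x₁ {z | z ∈ L ∧ L.idxOf (p (l + 1)) < L.idxOf z}) =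
      M.count s(p (l + 1), x₁) :=
    btw_eq_count (by simp) fun z hz hne => by
      rcases hz with rfl | hz
      · exact absurd rfl hne
      · exact hlast z hz.1 hz.2
  -- Two adjacent inner vertices are joined by exactly two edges, and balance at the first and the
  -- last inner vertex carries this to the edges at the roots.
  have hn : 1 ≤ l → M.count s(u, x₀) = 2 ∧ M.count s(p (l + 1), x₁) = 2 := by
    intro h1
    constructor
    · obtain ⟨c1, c2, c3, c4, c5⟩ := hadj 1 (by omega) h1
      rw [← hfirst', b1, btw_eq_count (t := p 2), ← p1, c1]
      · exact Or.inr ⟨hpL' 2 (by omega) (by omega), (hstep 1 (by omega) h1).1⟩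
      · intro z hz hne
        rcases hz with rfl | hz
        · exact c2
        · exact c4 z hz.1 hz.2 hne
    · obtain ⟨c1, c2, c3, c4, c5⟩ := hadj l (by omega) le_rfl
      rw [← hlast', ← (TightList.btw_eq hR hL (hpL' (l + 1) (by omega) le_rfl)).1,
        btw_eq_count (t := p l), Sym2.eq_swap, c1]
      · exact Or.inr ⟨hpL' l (by omega) (by omega), (hstep l (by omega) le_rfl).1⟩
      · intro z hz hne
        rcases hz with rfl | hz
        · exact c3
        · exact c5 z hz.1 hz.2 hne
  have hn0 : l = 0 → M.count s(u, x₁) = M.count s(u, x₀) := by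
    rintro rfl
    simp only [zero_add, p1] at hlast'
    rw [← hfirst', b1, hlast']
  refine ⟨l + 2, M.count s(u, x₀), p, ⟨by omega, p0, hl, ?_, ?_, ?_, ?_, by omega, ?_⟩, p1⟩
  · intro i j hi hj hij
    rcases lt_trichotomy i j with h | h | h
    · exact absurd hij (hpinj i j h hj)
    · exact h
    · exact absurd hij.symm (hpinj j i h hi)
  · intro i hi
    rcases Nat.eq_zero_or_pos i with rfl | h1
    · exact hR.mem₀
    · rcases hi.lt_or_eq with h | rfl
      · exact ((hL.mem_iff _).1 (hpL' i h1 (by omega))).1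
      · rw [hl]; exact hR.mem₁
  · intro i h1 h2 z hz
    by_cases hz0 : z = x₀
    · exact ⟨0, by omega, hz0.symm⟩
    by_cases hz1 : z = x₁
    · exact ⟨l + 2, le_rfl, by rw [hl, hz1]⟩
    have hzL : z ∈ L := (hL.mem_iff z).2 ⟨hR.mem _ hz z (by simp), hz0, hz1⟩
    have hi := hpL' i h1 (by omega)
    rcases lt_trichotomy (L.idxOf (p i)) (L.idxOf z) with h | h | h
    · by_cases h3 : i = l + 1
      · exact absurd hz (by rw [h3] at h ⊢; exact hlast z hzL h)
      · refine ⟨i + 1, by omega, ?_⟩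
        by_contra hne
        exact (hadj i h1 (by omega)).2.2.2.1 z hzL h (Ne.symm hne) hz
    · rw [List.idxOf_inj hi] at h
      exact absurd (by rw [h]; simp) (hR.loopless _ hz)
    · by_cases h3 : i = 1
      · rw [h3, p1] at h hz
        exact absurd hz (hfirst z hzL h)
      · obtain ⟨j, rfl⟩ : ∃ j, i = j + 1 := ⟨i - 1, by omega⟩
        refine ⟨j, by omega, ?_⟩
        by_contra hne
        exact (hadj j (by omega) (by omega)).2.2.2.2 z hzL h (Ne.symm hne) hz
  · intro i j h1 h2 h3
    rcases Nat.eq_zero_or_pos i with rfl | hi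
    · by_cases hj : j = 1
      · rw [hj, p0, p1, Sym2.eq_swap]; simp
      · rw [if_neg (by omega), Multiset.count_eq_zero, p0, TightList.adj_comm]
        obtain ⟨j, rfl⟩ : ∃ i, j = i + 1 := ⟨j - 1, by omega⟩
        exact (hadj j (by omega) (by omega)).2.2.1
    · by_cases hj : j = l + 2
      · rw [hj, hl]
        by_cases hil : i = l + 1
        · rw [if_pos (by omega), hil]
          by_cases hl0 : l = 0
          · rw [hl0, ← hn0 hl0, p1]
          · obtain ⟨h4, h5⟩ := hn (by omega)
            rw [h4, h5]
        · rw [if_neg (by omega), Multiset.count_eq_zero]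
          exact (hadj i hi (by omega)).2.1
      · obtain ⟨c1, c2, c3, c4, c5⟩ := hadj i hi (by omega)
        by_cases hij : i + 1 = j
        · rw [if_pos hij, ← hij, c1, (hn (by omega)).1]
        · rw [if_neg hij, Multiset.count_eq_zero]
          exact c4 _ (hpL' j (by omega) (by omega)) (hmono i j hi h1 (by omega))
            (hpinj (i + 1) j (by omega) (by omega)).symm
  · intro h
    exact (hn (by omega)).1

theorem TightList.typeB (hR : NoD S M x₀ x₁ m k) (hk : k = m + 1) (hL : TightList S M x₀ x₁ k L) :
    TypeB S M x₀ x₁ m := by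
  have hmemL := hL.mem_iff
  refine ⟨fun v hv hv0 hv1 => ?_, ?_, ?_⟩
  · let A : α → α → Prop := fun a b => b ∈ L ∧ s(a, b) ∈ M
    have hvL : v ∈ L := (hmemL v).2 ⟨hv, hv0, hv1⟩
    -- The earliest vertex joined to $v$ off the roots has no earlier neighbour in the list and
    -- starts the lobe.
    obtain ⟨u, hu, hmin⟩ : ∃ u, (u ∈ L ∧ ReflTransGen A u v) ∧
        ∀ w, (w ∈ L ∧ ReflTransGen A w v) → ¬ L.idxOf w < L.idxOf u := by
      have := WellFounded.has_min (measure L.idxOf).wf {w | w ∈ L ∧ ReflTransGen A w v}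
        ⟨v, hvL, .refl⟩
      obtain ⟨u, hu, h⟩ := this
      exact ⟨u, hu, fun w hw => h w hw⟩
    obtain ⟨l, n, p, hp, hpu⟩ := hL.exists_lobe hR hu.1 fun z hz hlt hzu =>
      hmin z ⟨hz, ReflTransGen.head ⟨hu.1, by rwa [Sym2.eq_swap]⟩ hu.2⟩ hlt
    refine ⟨l, n, p, hp, ?_⟩
    have h2 := hp.two_le_length
    have key : ∀ w, ReflTransGen A u w → ∃ i, 0 < i ∧ i < l ∧ p i = w := by
      intro w hw
      induction hw with
      | refl => exact ⟨1, by omega, by omega, hpu⟩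
      | @tail a b _ hab ih =>
        obtain ⟨i, hi1, hi2, rfl⟩ := ih
        obtain ⟨j, hj, rfl⟩ := hp.closed i hi1 hi2 b hab.2
        have hjL := (hmemL _).1 hab.1
        refine ⟨j, Nat.pos_of_ne_zero ?_, lt_of_le_of_ne hj ?_, rfl⟩
        · rintro rfl
          exact hjL.2.1 hp.zero
        · rintro rfl
          exact hjL.2.2 hp.last
    exact key v hu.2
  · have := hL.tight [] L rfl
    rw [← hk, ← this]
    simp
  · have := hL.tight L [] (by simp)
    rw [← hk, ← this, ← cut_sdiff hR.mem]
    congr 1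
    ext w
    simp only [Set.mem_singleton_iff, Finset.coe_sdiff, Finset.coe_insert, List.coe_toFinset,
      Set.mem_sdiff, Finset.mem_coe, Set.mem_insert_iff, Set.mem_ofPred_eq, hmemL]
    constructor
    · rintro rfl
      simp [hR.mem₁, hR.ne.symm]
    · tauto

end

/-! ### Graphs of type `A_m` or `B_m` have no immersion of `D_m` -/

lemma cut_dEdges {m : ℕ} (hm : 2 ≤ m) {x₀ x₁ u v : α} {X : Set α} (h0 : x₀ ∈ X) (h1 : x₁ ∉ X)
    (h : ¬ (u ∈ X ↔ v ∈ X)) : cut (dEdges m x₀ x₁ u v) X = m + 1 := by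
  simp only [dEdges, cut_add, cut_nsmul, cut_edge]
  by_cases hu : u ∈ X <;> by_cases hv : v ∈ X <;> simp_all

lemma dEdges_comm (m : ℕ) (x₀ x₁ u v : α) : dEdges m x₀ x₁ u v = dEdges m x₀ x₁ v u := by
  simp only [dEdges]
  rw [edge_comm u v]
  abel

section

variable {S : Finset α} {M : Multiset (Sym2 α)} {x₀ x₁ u v : α} {m k : ℕ}

lemma mem_of_imm_dEdges (hM : ∀ e ∈ M, ∀ v ∈ e, v ∈ S) (hu0 : u ≠ x₀)
    (h : Imm M (dEdges m x₀ x₁ u v)) : u ∈ S := by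
  by_contra hu
  have h1 : cut M {u} = 0 := by
    rw [cut_eq_zero]
    rintro e he ⟨⟨w, hw, hwu⟩, -⟩
    exact hu (hwu ▸ hM e he w hw)
  have h2 := h.cut_le {u}
  rw [h1] at h2
  simp only [dEdges, cut_add, cut_nsmul, cut_edge] at h2
  simp [hu0.symm] at h2

/-- The vertices $u,v$ of $D_m$ lie on the same side of every tight cut. The first set is too small
to contain both besides $x_0$, and single steps cannot add both at once. So both lie outside the
last set, whose complement is too small for them and $x_1$. -/
lemma TypeA.not_hasD (hR : Rooted S M x₀ x₁) (hm : 2 ≤ m) (hA : TypeA S M x₀ x₁ m) :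
    ¬ HasD m M x₀ x₁ := by
  rintro ⟨u, v, huv, hu0, hu1, hv0, hv1, h⟩
  obtain ⟨X, Y, hX, hXc, hYc, hXY⟩ := hA
  have hu : u ∈ S := mem_of_imm_dEdges hR.mem hu0 h
  have hv : v ∈ S := by
    rw [dEdges_comm] at h
    exact mem_of_imm_dEdges hR.mem hv0 h
  have hiff : ∀ Z, Tight S M x₀ x₁ m Z → (u ∈ Z ↔ v ∈ Z) := by
    intro Z hZ
    by_contra hne
    have h1 := h.cut_le Z
    rw [cut_dEdges hm hZ.mem hZ.notMem hne, hZ.cut_eq] at h1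
    omega
  have hnot : ∀ Z, ReflTransGen (TightStep S M x₀ x₁ m) X Z → u ∉ Z ∧ v ∉ Z := by
    intro Z hXZ
    induction hXZ with
    | refl =>
      have h1 := hiff X hX
      have h2 : u ∉ X := by
        intro hu'
        have h3 : ({x₀, u, v} : Finset α) ⊆ X := by
          intro w hw
          simp only [Finset.mem_insert, Finset.mem_singleton] at hw
          rcases hw with rfl | rfl | rfl
          · exact hX.mem
          · exact hu'
          · exact h1.1 hu'
        have h4 := Finset.card_le_card h3
        rw [Finset.card_eq_three.2 ⟨x₀, u, v, hu0.symm, hv0.symm, huv, rfl⟩] at h4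
        omega
      exact ⟨h2, fun h => h2 (h1.2 h)⟩
    | @tail Z W _ hZW ih =>
      obtain ⟨w, hw, rfl, hWt⟩ := hZW
      have h1 := hiff _ hWt
      simp only [Finset.mem_insert, ih.1, ih.2, or_false] at h1 ⊢
      constructor
      · rintro rfl
        exact huv (h1.1 rfl).symm
      · rintro rfl
        exact huv (h1.2 rfl)
  have hY := hnot Y hXY
  have h3 : ({x₁, u, v} : Finset α) ⊆ S \ Y := by
    intro w hw
    simp only [Finset.mem_insert, Finset.mem_singleton] at hw
    rw [Finset.mem_sdiff]
    rcases hw with rfl | rfl | rfl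
    · exact ⟨hR.mem₁, (hX.of_reach hXY).notMem⟩
    · exact ⟨hu, hY.1⟩
    · exact ⟨hv, hY.2⟩
  have h4 := Finset.card_le_card h3
  rw [Finset.card_eq_three.2 ⟨x₁, u, v, hu1.symm, hv1.symm, huv, rfl⟩] at h4
  omega

/-- An edge between `A` and `B` can only be created at the cost of two edges of `δ(R)` or two
edges of `δ(T)`. -/
lemma Imm.noEdge {N : Multiset (Sym2 α)} {A B R T : Set α} {r t : ℕ}
    (hcov : ∀ w, w ∈ A ∨ w ∈ B ∨ w ∈ R ∨ w ∈ T) (hAB : Disjoint A B) (hAR : Disjoint A R)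
    (hAT : Disjoint A T) (hBR : Disjoint B R) (hBT : Disjoint B T)
    (hM : ∀ a ∈ A, ∀ b ∈ B, s(a, b) ∉ M) (hMR : cut M R ≤ r + 2) (hMT : cut M T ≤ t + 2)
    (h : Imm M N) (hNR : r < cut N R) (hNT : t < cut N T) :
    ∀ a ∈ A, ∀ b ∈ B, s(a, b) ∉ N := by
  induction h with
  | refl => exact hM
  | @tail K N hK hstep ih =>
    have h1 := hstep.cut_le R
    have h2 := hstep.cut_le T
    have hKR := Imm.cut_le hK R
    have hKT := Imm.cut_le hK T
    have ih := ih (by omega) (by omega)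
    cases hstep with
    | split a b c M' =>
      have key : ∀ a b c, (∀ x ∈ A, ∀ y ∈ B, s(x, y) ∉ s(a, b) ::ₘ s(b, c) ::ₘ M') → a ∈ A → c ∈ B →
          b ∈ R ∨ b ∈ T := by
        intro a b c h ha hc
        rcases hcov b with hb | hb | hb
        · exact absurd (by simp) (h b hb c hc)
        · exact absurd (by simp) (h a ha b hb)
        · exact hb
      have hdis : ∀ X : Set α, a ∉ X → b ∈ X → c ∉ X →
          cut (s(a, b) ::ₘ s(b, c) ::ₘ M') X = cut (s(a, c) ::ₘ M') X + 2 := by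
        intro X ha hb hc
        simp [cut_cons, ha, hb, hc]
      -- If the new edge joins $A$ to $B$, the middle vertex lies in $R$ or $T$ because no old edge
      -- does so. The cut around that set then drops by two, while only a drop by one is affordable.
      have hboth : a ∈ A ∧ c ∈ B ∨ a ∈ B ∧ c ∈ A → False := by
        intro hac
        have hb : b ∈ R ∨ b ∈ T := by
          rcases hac with hac | hac
          · exact key a b c ih hac.1 hac.2
          · refine key c b a ?_ hac.2 hac.1
            intro x hx y hy
            have := ih x hx y hy
            rwa [Multiset.cons_swap, Sym2.eq_swap (a := c), Sym2.eq_swap (a := b) (b := a)]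
        have haR : a ∉ R ∧ a ∉ T ∧ c ∉ R ∧ c ∉ T := by
          have d1 := @Set.disjoint_left.1 hAR
          have d2 := @Set.disjoint_left.1 hAT
          have d3 := @Set.disjoint_left.1 hBR
          have d4 := @Set.disjoint_left.1 hBT
          rcases hac with hac | hac
          · exact ⟨d1 hac.1, d2 hac.1, d3 hac.2, d4 hac.2⟩
          · exact ⟨d3 hac.1, d4 hac.1, d1 hac.2, d2 hac.2⟩
        rcases hb with hb | hb
        · have := hdis R haR.1 hb haR.2.2.1
          omega
        · have := hdis T haR.2.1 hb haR.2.2.2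
          omega
      intro x hx y hy hxy
      rcases Multiset.mem_cons.1 hxy with hxy | hxy
      · rw [Sym2.eq_iff] at hxy
        rcases hxy with ⟨rfl, rfl⟩ | ⟨rfl, rfl⟩
        · exact hboth (Or.inl ⟨hx, hy⟩)
        · exact hboth (Or.inr ⟨hy, hx⟩)
      · exact ih x hx y hy (by simp [hxy])
    | del e N =>
      exact fun x hx y hy hxy => ih x hx y hy (by simp [hxy])
    | loop a M' =>
      intro x hx y hy hxy
      rcases Multiset.mem_cons.1 hxy with hxy | hxy
      · rw [Sym2.eq_iff] at hxy
        have : x = y := by rcases hxy with ⟨rfl, rfl⟩ | ⟨rfl, rfl⟩ <;> rfl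
        exact Set.disjoint_left.1 hAB hx (this ▸ hy)
      · exact ih x hx y hy hxy

lemma IsLobe.cut_eq {l n i : ℕ} {p : ℕ → α} (h : IsLobe S M x₀ x₁ l n p)
    (hi : 0 < i) (hil : i < l) : cut M {p i} = 2 * n := by
  obtain ⟨i, rfl⟩ := Nat.exists_eq_add_of_le' hi
  have n1 : p (i + 1) ≠ p i := fun he => by
    have := h.inj _ _ (by omega) (by omega) he
    omega
  have n2 : p (i + 1) ≠ p (i + 2) := fun he => by
    have := h.inj _ _ (by omega) (by omega) he
    omega
  have n3 : p i ≠ p (i + 2) := fun he => by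
    have := h.inj _ _ (by omega) (by omega) he
    omega
  have hcov : ({p (i + 1)} : Set α)ᶜ = {p i} ∪ {w | w ≠ p (i + 1) ∧ w ≠ p i} := by
    ext w
    simp only [Set.mem_compl_iff, Set.mem_singleton_iff, Set.mem_union, Set.mem_ofPred_eq]
    by_cases hw : w = p i
    · simp [hw, n1.symm]
    · simp [hw]
  rw [cut_eq_btw (B := {p (i + 1)}ᶜ) disjoint_compl_right fun e _ v _ => by simp [Classical.em], hcov,
    btw_union (by simp) (by simpa using n1) (by simp), btw_singleton,
    btw_eq_count (t := p (i + 2)) (by simp [n2.symm, n3.symm]), Sym2.eq_swap,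
    h.count i (i + 1) (by omega) (by omega) (by omega), if_pos rfl,
    h.count (i + 1) (i + 2) (by omega) (by omega) (by omega), if_pos rfl]
  · omega
  · rintro z ⟨hz1, hz2⟩ hz3 hz
    obtain ⟨j, hj, rfl⟩ := h.closed _ hi hil z hz
    have m1 : j ≠ i + 1 := fun he => hz1 (he ▸ rfl)
    have m2 : j ≠ i := fun he => hz2 (he ▸ rfl)
    have m3 : j ≠ i + 2 := fun he => hz3 (he ▸ rfl)
    rcases lt_or_gt_of_ne m1 with h1 | h1
    · have := h.count j (i + 1) h1 (by omega) (by omega)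
      rw [if_neg (by omega), Multiset.count_eq_zero, Sym2.eq_swap] at this
      exact this hz
    · have := h.count (i + 1) j h1 hj (by omega)
      rw [if_neg (by omega), Multiset.count_eq_zero] at this
      exact this hz

lemma cut_dEdges_root {m : ℕ} (hm : 2 ≤ m) (hne : x₀ ≠ x₁) (hu0 : u ≠ x₀) (hu1 : u ≠ x₁)
    (hv0 : v ≠ x₀) (hv1 : v ≠ x₁) : cut (dEdges m x₀ x₁ u v) {x₀} = m ∧
      cut (dEdges m x₀ x₁ u v) {x₁} = m := by
  simp only [dEdges, cut_add, cut_nsmul, cut_edge]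
  constructor <;> simp [hne, hne.symm, hu0, hu1, hv0, hv1] <;> omega

/-- No immersion of `D_m` in which the vertices `u` and `v` belong to the same lobe. -/
lemma IsLobe.not_imm (hR : Rooted S M x₀ x₁) (hm : 2 ≤ m) (hc : cut M {x₁} = m + 1) {l n i j : ℕ}
    {p : ℕ → α} (h : IsLobe S M x₀ x₁ l n p) (hi : 0 < i) (hij : i < j) (hjl : j < l) :
    ¬ Imm M (dEdges m x₀ x₁ (p i) (p j)) := by
  intro himm
  have hne : ∀ i j, i ≤ l → j ≤ l → i ≠ j → p i ≠ p j := fun i j h1 h2 h3 h4 =>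
    h3 (h.inj i j h1 h2 h4)
  have hi0 : p i ≠ x₀ := by rw [← h.zero]; exact hne _ _ (by omega) (by omega) (by omega)
  have hi1 : p i ≠ x₁ := by rw [← h.last]; exact hne _ _ (by omega) (by omega) (by omega)
  have hj0 : p j ≠ x₀ := by rw [← h.zero]; exact hne _ _ (by omega) (by omega) (by omega)
  have hj1 : p j ≠ x₁ := by rw [← h.last]; exact hne _ _ (by omega) (by omega) (by omega)
  have hpij := hne i j (by omega) (by omega) (by omega)
  -- Off $p_i$ and $x_1$, the inner vertices after $p_i$ are separated from $x_0$. Here $p_i$ has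
  -- degree 4 against 3 in $D_m$, and $x_1$ has degree $m+1$ against $m$, so the edge $x_0p_j$ of
  -- $D_m$ cannot arise.
  set B : Set α := {w | ∃ k, i < k ∧ k < l ∧ p k = w} with hB
  have hBi : p i ∉ B := by
    rintro ⟨k, h1, h2, h3⟩
    exact hne k i (by omega) (by omega) (by omega) h3
  have hB1 : x₁ ∉ B := by
    rintro ⟨k, h1, h2, h3⟩
    exact hne k l (by omega) (by omega) (by omega) (h3.trans h.last.symm)
  have hB0 : x₀ ∉ B := by
    rintro ⟨k, h1, h2, h3⟩
    exact hne k 0 (by omega) (by omega) (by omega) (h3.trans h.zero.symm)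
  refine Imm.noEdge (M := M) (A := {w | w ∉ B ∧ w ≠ p i ∧ w ≠ x₁}) (B := B) (R := {p i}) (T := {x₁})
    (r := 2) (t := m - 1) ?_ ?_ ?_ ?_ ?_ ?_ ?_ ?_ ?_ himm ?_ ?_ x₀ ⟨hB0, hi0.symm, hR.ne⟩ (p j)
    ⟨j, hij, hjl, rfl⟩ (by simp [dEdges])
  · intro w
    simp only [Set.mem_ofPred_eq, Set.mem_singleton_iff]
    tauto
  · exact Set.disjoint_left.2 fun w hw => hw.1
  · exact Set.disjoint_left.2 fun w hw => hw.2.1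
  · exact Set.disjoint_left.2 fun w hw => hw.2.2
  · simpa using hBi
  · simpa using hB1
  · rintro a ⟨ha, hai, ha1⟩ b ⟨k, hk1, hk2, rfl⟩ hab
    rw [Sym2.eq_swap] at hab
    obtain ⟨j', hj', rfl⟩ := h.closed k (by omega) hk2 a hab
    have m1 : ¬ (i < j' ∧ j' < l) := fun hh => ha ⟨j', hh.1, hh.2, rfl⟩
    have m2 : j' ≠ i := fun hh => hai (hh ▸ rfl)
    have m3 : j' ≠ l := fun hh => ha1 (hh ▸ h.last)
    have := h.count j' k (by omega) (by omega) (by omega)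
    rw [if_neg (by omega), Multiset.count_eq_zero, Sym2.eq_swap] at this
    exact this hab
  · rw [h.cut_eq hi (by omega), h.eq_two (by omega)]
  · omega
  · simp only [dEdges, cut_add, cut_nsmul, cut_edge]
    simp [hi0, hi1, hpij, hi0.symm, hi1.symm, hpij.symm]
  · rw [(cut_dEdges_root hm hR.ne hi0 hi1 hj0 hj1).2]
    omega

/-- For two vertices in different lobes the two roots are the separators, and the edge that cannot
arise is the rung $uv$. -/
lemma TypeB.not_hasD (hR : Rooted S M x₀ x₁) (hm : 2 ≤ m) (hB : TypeB S M x₀ x₁ m) :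
    ¬ HasD m M x₀ x₁ := by
  rintro ⟨u, v, huv, hu0, hu1, hv0, hv1, himm⟩
  have himm' := himm
  rw [dEdges_comm] at himm'
  have hv : v ∈ S := mem_of_imm_dEdges hR.mem hv0 himm'
  obtain ⟨l, n, p, h, j, hj0, hjl, rfl⟩ := hB.lobe v hv hv0 hv1
  by_cases hu : ∃ i, 0 < i ∧ i < l ∧ p i = u
  · obtain ⟨i, hi0, hil, rfl⟩ := hu
    rcases lt_trichotomy i j with hij | rfl | hij
    · exact h.not_imm hR hm hB.cut₁ hi0 hij hjl himm
    · exact huv rfl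
    · exact h.not_imm hR hm hB.cut₁ hj0 hij hil himm'
  have hne : ∀ i j, i ≤ l → j ≤ l → i ≠ j → p i ≠ p j := fun i j h1 h2 h3 h4 =>
    h3 (h.inj i j h1 h2 h4)
  set B : Set α := {w | ∃ k, 0 < k ∧ k < l ∧ p k = w} with hBdef
  have hB1 : x₁ ∉ B := by
    rintro ⟨k, h1, h2, h3⟩
    exact hne k l (by omega) (by omega) (by omega) (h3.trans h.last.symm)
  have hB0 : x₀ ∉ B := by
    rintro ⟨k, h1, h2, h3⟩
    exact hne k 0 (by omega) (by omega) (by omega) (h3.trans h.zero.symm)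
  have hD := cut_dEdges_root hm hR.ne hu0 hu1 hv0 hv1
  have hc0 := hB.cut₀
  have hc1 := hB.cut₁
  refine Imm.noEdge (M := M) (A := {w | w ∉ B ∧ w ≠ x₀ ∧ w ≠ x₁}) (B := B) (R := {x₀}) (T := {x₁})
    (r := m - 1) (t := m - 1) ?_ ?_ ?_ ?_ ?_ ?_ ?_ ?_ ?_ himm ?_ ?_ u ⟨hu, hu0, hu1⟩ (p j)
    ⟨j, hj0, hjl, rfl⟩ (by simp [dEdges])
  · intro w
    simp only [Set.mem_ofPred_eq, Set.mem_singleton_iff]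
    tauto
  · exact Set.disjoint_left.2 fun w hw => hw.1
  · exact Set.disjoint_left.2 fun w hw => hw.2.1
  · exact Set.disjoint_left.2 fun w hw => hw.2.2
  · simpa using hB0
  · simpa using hB1
  · rintro a ⟨ha, ha0, ha1⟩ b ⟨k, hk1, hk2, rfl⟩ hab
    rw [Sym2.eq_swap] at hab
    obtain ⟨j', hj', rfl⟩ := h.closed k (by omega) hk2 a hab
    refine ha ⟨j', Nat.pos_of_ne_zero ?_, lt_of_le_of_ne hj' ?_, rfl⟩
    · rintro rfl; exact ha0 h.zero
    · rintro rfl; exact ha1 h.last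
  all_goals omega

/-- The main theorem for multisets of edges. -/
theorem not_hasD_iff (hR : Rooted S M x₀ x₁) (hm : 2 ≤ m) (hS : 4 ≤ S.card)
    (hsep : ∀ X : Finset α, X ⊆ S → x₀ ∈ X → x₁ ∉ X → m ≤ cut M X) :
    ¬ HasD m M x₀ x₁ ↔ TypeA S M x₀ x₁ m ∨ TypeB S M x₀ x₁ m := by
  constructor
  · intro hD
    -- A minimum separating cut; its size is the $k$ of the chain argument, and the cases $k>m$ and
    -- $k=m$ lead to the two types.
    obtain ⟨X, hX, hmin⟩ := Finset.exists_min_image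
      (S.powerset.filter fun X => x₀ ∈ X ∧ x₁ ∉ X) (fun X => cut M X)
      ⟨{x₀}, by simp [hR.mem₀, hR.ne.symm]⟩
    simp only [Finset.mem_filter, Finset.mem_powerset] at hX hmin
    have hmin' : ∀ Y : Finset α, Y ⊆ S → x₀ ∈ Y → x₁ ∉ Y → cut M X ≤ cut M Y :=
      fun Y h1 h2 h3 => hmin Y ⟨h1, h2, h3⟩
    have hXt : Tight S M x₀ x₁ (cut M X) X := ⟨hX.1, hX.2.1, hX.2.2, rfl⟩
    have hmX := hsep X hX.1 hX.2.1 hX.2.2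
    have hA : TypeA S M x₀ x₁ (cut M X) :=
      (hasD_or_typeA hR (hm.trans hmX) hS hmin' ⟨X, hXt⟩).resolve_left fun h => hD (h.mono hmX)
    rcases hmX.lt_or_eq with hlt | heq
    · right
      have hN : NoD S M x₀ x₁ m (cut M X) := ⟨hR, hm, hlt, hmin', hD⟩
      obtain ⟨h1, L, hL⟩ := hN.exists_tightList hS hA
      exact hL.typeB hN h1
    · left
      rwa [← heq] at hA
  · rintro (h | h)
    · exact h.not_hasD hR hm
    · exact h.not_hasD hR hm

end

/-! ### Multigraphs as multisets of edges -/

section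

variable {β : Type*} {G : Graph α β} {F : Finset β} {ε : β → Sym2 α}

/-- The edges of `G` form the finite set `F`, and `ε` maps each of them to its ends. -/
structure Reps (G : Graph α β) (F : Finset β) (ε : β → Sym2 α) : Prop where
  isLink_iff : ∀ e x y, G.IsLink e x y ↔ e ∈ F ∧ ε e = s(x, y)

/-- The multiset of the edges in `F`. -/
def edges (F : Finset β) (ε : β → Sym2 α) : Multiset (Sym2 α) := F.val.map ε

lemma Reps.mem_edgeSet (h : Reps G F ε) {e : β} : e ∈ G.edgeSet ↔ e ∈ F := by
  rw [G.edge_mem_iff_exists_isLink]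
  constructor
  · rintro ⟨x, y, hxy⟩
    exact ((h.isLink_iff e x y).1 hxy).1
  · intro he
    obtain ⟨⟨x, y⟩, hxy⟩ := Quot.exists_rep (ε e)
    exact ⟨x, y, (h.isLink_iff e x y).2 ⟨he, hxy.symm⟩⟩

lemma Reps.mem_vertexSet (h : Reps G F ε) {e : Sym2 α} (he : e ∈ edges F ε) {v : α} (hv : v ∈ e) :
    v ∈ G.vertexSet := by
  obtain ⟨f, hf, rfl⟩ := Multiset.mem_map.1 he
  obtain ⟨w, hw⟩ := Sym2.mem_iff_exists.1 hv
  exact ((h.isLink_iff f v w).2 ⟨hf, hw⟩).left_mem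

lemma Reps.not_isDiag (h : Reps G F ε) (hG : G.Loopless) {e : Sym2 α} (he : e ∈ edges F ε) :
    ¬ e.IsDiag := by
  obtain ⟨f, hf, rfl⟩ := Multiset.mem_map.1 he
  intro hd
  induction hx : ε f with | _ x y
  rw [hx, Sym2.mk_isDiag_iff] at hd
  subst hd
  exact hG.not_isLoopAt f x ((h.isLink_iff f x x).2 ⟨hf, hx⟩)

lemma exists_reps [Nonempty α] (hE : G.edgeSet.Finite) :
    ∃ (F : Finset β) (ε : β → Sym2 α), Reps G F ε := by
  have : ∀ e, ∃ s : Sym2 α, ∀ x y, G.IsLink e x y ↔ e ∈ G.edgeSet ∧ s = s(x, y) := by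
    intro e
    by_cases he : e ∈ G.edgeSet
    · obtain ⟨x, y, hxy⟩ := (G.edge_mem_iff_exists_isLink e).1 he
      refine ⟨s(x, y), fun z w => ?_⟩
      rw [hxy.isLink_iff_sym2_eq]
      simp [he]
    · exact ⟨s(Classical.arbitrary α, Classical.arbitrary α), fun x y =>
        ⟨fun h => absurd h.edge_mem he, fun h => absurd h.1 he⟩⟩
  choose ε hε using this
  exact ⟨hE.toFinset, ε, ⟨fun e x y => by rw [hε, Set.Finite.mem_toFinset]⟩⟩

lemma Reps.cutSize_eq (h : Reps G F ε) (X : Set α) : G.cutSize X = cut (edges F ε) X := by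
  have : G.edgeCut X = ((F.filter fun e => Crosses X (ε e) : Finset β) : Set β) := by
    ext e
    simp only [Graph.edgeCut, Set.mem_ofPred_eq, Finset.coe_filter, h.isLink_iff]
    constructor
    · rintro ⟨x, hx, y, hy, he, hxy⟩
      refine ⟨he, ?_⟩
      rw [hxy, crosses_mk]
      simp [hx, hy]
    · rintro ⟨he, ⟨x, hx, hxX⟩, y, hy, hyX⟩
      refine ⟨x, hxX, y, hyX, he, ?_⟩
      rw [← Sym2.mem_and_mem_iff (by rintro rfl; exact hyX hxX)]
      exact ⟨hx, hy⟩
  rw [Graph.cutSize, this, Set.ncard_coe_finset, cut, edges, Multiset.countP_map]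
  rfl

lemma Reps.edgeMult_eq (h : Reps G F ε) (u v : α) :
    G.edgeMult u v = (edges F ε).count s(u, v) := by
  have : G.edgesBetween u v = ((F.filter fun e => s(u, v) = ε e : Finset β) : Set β) := by
    ext e
    simp only [Graph.edgesBetween, Set.mem_ofPred_eq, Finset.coe_filter, h.isLink_iff]
    rw [eq_comm (a := s(u, v))]
  rw [Graph.edgeMult, this, Set.ncard_coe_finset, edges, Multiset.count_map]
  rfl

/-! ### Splitting and deletion of edges -/

lemma exists_subset_edges {N : Multiset (Sym2 α)} : ∀ {F : Finset β}, N ≤ edges F ε →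
    ∃ F' ⊆ F, edges F' ε = N := by
  induction N using Multiset.induction_on with
  | empty => exact fun _ => ⟨∅, by simp, rfl⟩
  | cons a N ih =>
    intro F h
    obtain ⟨e, he, rfl⟩ := Multiset.mem_map.1 (Multiset.mem_of_le h (Multiset.mem_cons_self a N))
    have h1 : edges F ε = ε e ::ₘ edges (F.erase e) ε := by
      rw [edges, edges, ← Multiset.map_cons, Finset.erase_val, Multiset.cons_erase he]
    rw [h1, Multiset.cons_le_cons_iff] at h
    obtain ⟨F', hF', rfl⟩ := ih h
    have he' : e ∉ F' := fun h => by simpa using hF' h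
    refine ⟨insert e F', ?_, ?_⟩
    · exact Finset.insert_subset he (hF'.trans (Finset.erase_subset _ _))
    · rw [edges, Finset.insert_val_of_notMem he', Multiset.map_cons, edges]

lemma edges_erase {e : β} (he : e ∈ F) : edges F ε = ε e ::ₘ edges (F.erase e) ε := by
  rw [edges, edges, ← Multiset.map_cons, Finset.erase_val, Multiset.cons_erase he]

lemma edges_congr {ε' : β → Sym2 α} (h : ∀ e ∈ F, ε e = ε' e) : edges F ε = edges F ε' :=
  Multiset.map_congr rfl h

/-- The effect of a splitting on the multiset of edges. -/
lemma Reps.splitOff (h : Reps G F ε) {e f : β} {x y z : α} (he : G.IsLink e x y)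
    (hf : G.IsLink f y z) (hef : e ≠ f) :
    Reps (G.splitOff he hf) (F.erase f) (Function.update ε e s(x, z)) ∧
      edges F ε = s(x, y) ::ₘ s(y, z) ::ₘ edges ((F.erase e).erase f) ε ∧
      edges (F.erase f) (Function.update ε e s(x, z)) =
        s(x, z) ::ₘ edges ((F.erase e).erase f) ε := by
  obtain ⟨heF, he'⟩ := (h.isLink_iff e x y).1 he
  obtain ⟨hfF, hf'⟩ := (h.isLink_iff f y z).1 hf
  refine ⟨⟨fun g u v => ?_⟩, ?_, ?_⟩
  · simp only [Graph.splitOff, h.isLink_iff, Finset.mem_erase]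
    by_cases hg : g = e
    · subst hg
      simp only [Function.update_self, hef, heF]
      rw [eq_comm (a := s(x, z))]
      simp [hef]
    · rw [Function.update_of_ne hg]
      simp [hg]
      tauto
  · rw [edges_erase heF, he', edges_erase (F := F.erase e) (e := f) (by simp [hfF, hef.symm]), hf']
  · rw [edges_erase (F := F.erase f) (e := e) (by simp [heF, hef]), Function.update_self,
      Finset.erase_right_comm]
    congr 1
    apply edges_congr
    intro g hg
    simp only [Finset.mem_erase] at hg
    rw [Function.update_of_ne hg.2.1]

lemma Reps.of_le (h : Reps G F ε) {H : Graph α β} (hH : H ≤ G) :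
    Reps H (F.filter (· ∈ H.edgeSet)) ε := by
  refine ⟨fun e x y => ?_⟩
  rw [Finset.mem_filter]
  constructor
  · intro he
    have := (h.isLink_iff e x y).1 (he.mono hH)
    exact ⟨⟨this.1, he.edge_mem⟩, this.2⟩
  · rintro ⟨⟨h1, h2⟩, h3⟩
    rw [hH.isLink_iff h2]
    exact (h.isLink_iff e x y).2 ⟨h1, h3⟩

lemma Reps.exists_of_steps (h : Reps G F ε) {G' : Graph α β}
    (hG : ReflTransGen Graph.ImmersionStep G G') :
    ∃ F' ε', Reps G' F' ε' ∧ Imm (edges F ε) (edges F' ε') := by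
  induction hG with
  | refl => exact ⟨F, ε, h, .refl _⟩
  | tail _ hstep ih =>
    obtain ⟨F', ε', h1, h2⟩ := ih
    cases hstep with
    | split he hf hef hxz =>
      obtain ⟨h3, h4, h5⟩ := h1.splitOff he hf hef
      refine ⟨_, _, h3, h2.trans ?_⟩
      rw [h4, h5]
      exact ReflTransGen.single (Step.split _ _ _ _)
    | delete hle =>
      refine ⟨_, _, h1.of_le hle, h2.trans (imm_of_le ?_)⟩
      exact Multiset.map_le_map (Finset.val_le_iff.2 (Finset.filter_subset _ _))

/-- The multiset of the edges that are not loops. -/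
noncomputable def core (N : Multiset (Sym2 α)) : Multiset (Sym2 α) := N.filter fun e => ¬ e.IsDiag

lemma Reps.exists_steps_of_le (h : Reps G F ε) {N : Multiset (Sym2 α)} (hN : N ≤ edges F ε) :
    ∃ G' F', ReflTransGen Graph.ImmersionStep G G' ∧ G'.vertexSet = G.vertexSet ∧ Reps G' F' ε ∧
      edges F' ε = N := by
  obtain ⟨F', hF', rfl⟩ := exists_subset_edges hN
  refine ⟨G.restrict F', F', .single (.delete Graph.restrict_le), rfl, ⟨fun e x y => ?_⟩, rfl⟩
  rw [Graph.restrict_isLink, h.isLink_iff]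
  constructor
  · rintro ⟨h1, h2, h3⟩
    exact ⟨h1, h3⟩
  · rintro ⟨h1, h2⟩
    exact ⟨h1, hF' h1, h2⟩

/-- Immersions of multisets of edges are realised by sequences of splittings and deletions. -/
theorem Reps.exists_steps (h : Reps G F ε) {N : Multiset (Sym2 α)}
    (hl : ∀ e ∈ edges F ε, ¬ e.IsDiag) (hN : Imm (edges F ε) N) :
    ∃ G' F' ε', ReflTransGen Graph.ImmersionStep G G' ∧ G'.vertexSet = G.vertexSet ∧
      Reps G' F' ε' ∧ edges F' ε' = core N := by
  induction hN with
  | refl => exact ⟨G, F, ε, .refl, rfl, h, (Multiset.filter_eq_self.2 hl).symm⟩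
  | @tail N N' _ hstep ih =>
    obtain ⟨G', F', ε', h1, h2, h3, h4⟩ := ih
    -- Steps that only shrink the loopless part are realised by deletions. This covers created loops
    -- and splittings with two equal vertices, which `ImmersionStep` does not permit or which do
    -- nothing.
    have hdel : core N' ≤ core N → ∃ G' F' ε', ReflTransGen Graph.ImmersionStep G G' ∧
        G'.vertexSet = G.vertexSet ∧ Reps G' F' ε' ∧ edges F' ε' = core N' := by
      intro hle
      rw [← h4] at hle
      obtain ⟨G'', F'', h5, h6, h7, h8⟩ := h3.exists_steps_of_le hle
      exact ⟨G'', F'', ε', h1.trans h5, h6.trans h2, h7, h8⟩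
    cases hstep with
    | split a b c K =>
      by_cases hac : a = c
      · apply hdel
        subst hac
        simp only [core, Multiset.filter_cons, Sym2.mk_isDiag_iff]
        simp
        exact (Multiset.le_add_left _ _).trans (Multiset.le_add_left _ _)
      by_cases hab : a = b
      · apply hdel
        subst hab
        simp [core]
      by_cases hbc : b = c
      · apply hdel
        subst hbc
        simp [core, Multiset.filter_cons]
      have h5 : core (s(a, b) ::ₘ s(b, c) ::ₘ K) = s(a, b) ::ₘ s(b, c) ::ₘ core K := by
        simp [core, hab, hbc]
      have h6 : core (s(a, c) ::ₘ K) = s(a, c) ::ₘ core K := by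
        simp [core, hac]
      rw [h5] at h4
      obtain ⟨e, he, hea⟩ := Multiset.mem_map.1
        (show s(a, b) ∈ edges F' ε' by rw [h4]; simp)
      rw [edges_erase he, hea, Multiset.cons_inj_right] at h4
      obtain ⟨f, hf, hfb⟩ := Multiset.mem_map.1
        (show s(b, c) ∈ edges (F'.erase e) ε' by rw [h4]; simp)
      have hf' := Finset.mem_erase.1 hf
      rw [edges_erase hf, hfb, Multiset.cons_inj_right] at h4
      have he1 : G'.IsLink e a b := (h3.isLink_iff e a b).2 ⟨he, hea⟩
      have hf1 : G'.IsLink f b c := (h3.isLink_iff f b c).2 ⟨hf'.2, hfb⟩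
      obtain ⟨h7, -, h9⟩ := h3.splitOff he1 hf1 hf'.1.symm
      exact ⟨_, _, _, h1.tail (.split he1 hf1 hf'.1.symm hac), h2, h7, by rw [h9, h4, h6]⟩
    | del e K => exact hdel (Multiset.filter_le_filter _ (Multiset.le_cons_self _ _))
    | loop a K => exact hdel (by simp [core])

end

/-! ### Rooted immersions of $D_m$ in graphs and in multisets -/

section

variable {β : Type*} {G : Graph α β} {F : Finset β} {ε : β → Sym2 α}

lemma map_dEnds (m : ℕ) (g : Fin 4 → α) :
    (Finset.univ : Finset (Fin 5 ⊕ Fin (m - 2))).val.map (fun k => (Graph.dEnds m k).map g) =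
      dEdges m (g 0) (g 1) (g 2) (g 3) := by
  rw [← Multiset.sum_map_singleton (Multiset.map _ _), Multiset.map_map]
  change ∑ k : Fin 5 ⊕ Fin (m - 2), ({(Graph.dEnds m k).map g} : Multiset (Sym2 α)) = _
  rw [Fintype.sum_sum_type, Fin.sum_univ_five]
  simp only [Graph.dEnds, Finset.sum_const, Finset.card_univ, Fintype.card_fin, dEdges]
  rw [add_comm]
  rfl

/-- Equal multiplicities give bijections between the fibres over each pair of ends. -/
lemma exists_equiv_of_edges_eq {J : Type*} [Fintype J] {d : J → Sym2 α}
    (h : edges F ε = Finset.univ.val.map d) : ∃ ψ : F ≃ J, ∀ e : F, ε e = d (ψ e) := by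
  have key : ∀ s : Sym2 α, Nonempty ({e : F // ε e = s} ≃ {j : J // d j = s}) := by
    intro s
    rw [← Fintype.card_eq, Fintype.card_subtype, Fintype.card_subtype]
    have h1 := congrArg (Multiset.count s) h
    rw [edges, Multiset.count_map, Multiset.count_map] at h1
    have h2 : (Finset.univ.filter fun e : F => ε e = s).card = (F.filter fun e => ε e = s).card := by
      rw [← Finset.card_map (Function.Embedding.subtype (· ∈ F))]
      congr 1
      ext e
      simp [and_comm]
    rw [h2]
    simp only [eq_comm (a := s)] at h1
    exact h1
  exact ⟨Equiv.ofFiberEquiv fun s => (key s).some, fun e =>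
    (Equiv.ofFiberEquiv_map (fun s => (key s).some) e).symm⟩

lemma hasD_of_hasRootedImmersion (h : Reps G F ε) {x₀ x₁ : α} {m : ℕ}
    (hG : G.HasRootedImmersion x₀ x₁ (Graph.dGraph m) 0 1) : HasD m (edges F ε) x₀ x₁ := by
  obtain ⟨G', hsteps, φ, ψ, hφ, ⟨h0, hφ0⟩, ⟨h1, hφ1⟩⟩ := hG
  obtain ⟨F', ε', hF', himm⟩ := h.exists_of_steps hsteps
  have hV : ∀ i : Fin 4, i ∈ (Graph.dGraph m).vertexSet := fun i => Set.mem_univ i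
  have hE : ∀ k, k ∈ (Graph.dGraph m).edgeSet := by
    intro k
    rw [Graph.edge_mem_iff_exists_isLink]
    obtain ⟨⟨a, b⟩, hab⟩ := Quot.exists_rep (Graph.dEnds m k)
    exact ⟨a, b, hab.symm⟩
  set g : Fin 4 → α := fun i => φ.symm ⟨i, hV i⟩ with hg
  have ginj : Function.Injective g := by
    intro i j hij
    have := φ.symm.injective (Subtype.ext hij)
    exact congrArg Subtype.val this
  have g0 : g 0 = x₀ := by
    have : φ.symm ⟨0, hV 0⟩ = ⟨x₀, h0⟩ := by
      rw [Equiv.symm_apply_eq]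
      exact Subtype.ext hφ0.symm
    simp only [hg, this]
  have g1 : g 1 = x₁ := by
    have : φ.symm ⟨1, hV 1⟩ = ⟨x₁, h1⟩ := by
      rw [Equiv.symm_apply_eq]
      exact Subtype.ext hφ1.symm
    simp only [hg, this]
  have hends : ∀ k, (ψ.symm ⟨k, hE k⟩ : β) ∈ F' ∧
      ε' (ψ.symm ⟨k, hE k⟩) = (Graph.dEnds m k).map g := by
    intro k
    have h2 := hφ (ψ.symm ⟨k, hE k⟩)
    obtain ⟨⟨a, b⟩, hab⟩ := Quot.exists_rep (Graph.dEnds m k)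
    have h3 := (h2 (φ.symm ⟨a, hV a⟩) (φ.symm ⟨b, hV b⟩)).2 (by
      rw [Equiv.apply_symm_apply, Equiv.apply_symm_apply, Equiv.apply_symm_apply]
      exact hab.symm)
    rw [hF'.isLink_iff] at h3
    refine ⟨h3.1, h3.2.trans ?_⟩
    rw [← hab]
    rfl
  have heq : edges F' ε' = dEdges m (g 0) (g 1) (g 2) (g 3) := by
    rw [← map_dEnds, edges]
    symm
    refine Multiset.map_eq_map_of_bij_of_nodup _ _ Finset.univ.nodup F'.nodup
      (fun k _ => (ψ.symm ⟨k, hE k⟩ : β)) (fun k _ => (hends k).1) ?_ ?_ fun k _ => (hends k).2.symm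
    · intro k _ k' _ hkk
      have := ψ.symm.injective (Subtype.ext hkk)
      exact congrArg Subtype.val this
    · intro e he
      refine ⟨ψ ⟨e, hF'.mem_edgeSet.2 he⟩, Finset.mem_univ_val _, ?_⟩
      simp
  rw [heq] at himm
  have hne : ∀ i j, i ≠ j → g i ≠ g j := fun i j => ginj.ne
  refine ⟨g 2, g 3, hne _ _ (by decide), ?_, ?_, ?_, ?_, by rwa [g0, g1] at himm⟩
  · rw [← g0]; exact hne _ _ (by decide)
  · rw [← g1]; exact hne _ _ (by decide)
  · rw [← g0]; exact hne _ _ (by decide)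
  · rw [← g1]; exact hne _ _ (by decide)

lemma hasRootedImmersion_of_hasD (h : Reps G F ε) (hl : G.Loopless) {S : Finset α} {x₀ x₁ : α}
    {m : ℕ} (hS : ∀ v, v ∈ S ↔ v ∈ G.vertexSet) (h0 : x₀ ∈ S) (h1 : x₁ ∈ S) (hne : x₀ ≠ x₁)
    (hD : HasD m (edges F ε) x₀ x₁) : G.HasRootedImmersion x₀ x₁ (Graph.dGraph m) 0 1 := by
  obtain ⟨u, v, huv, hu0, hu1, hv0, hv1, himm⟩ := hD
  have hM : ∀ e ∈ edges F ε, ∀ w ∈ e, w ∈ S := fun e he w hw => (hS w).2 (h.mem_vertexSet he hw)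
  have hu := mem_of_imm_dEdges hM hu0 himm
  have hv := mem_of_imm_dEdges hM hv0 (by rwa [dEdges_comm] at himm)
  obtain ⟨G', F', ε', hsteps, hV, hF', heq⟩ := h.exists_steps (fun e he => h.not_isDiag hl he) himm
  set g : Fin 4 → α := ![x₀, x₁, u, v] with hg
  have hcore : core (dEdges m x₀ x₁ u v) = dEdges m x₀ x₁ u v := by
    rw [core, Multiset.filter_eq_self]
    intro e he
    simp only [dEdges, Multiset.mem_add, Multiset.mem_singleton] at he
    rcases he with he | he
    · rw [Multiset.mem_singleton.1 (Multiset.mem_of_mem_nsmul he)]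
      simpa using hne
    · rcases he with (((rfl | rfl) | rfl) | rfl) | rfl <;> simp [hu0.symm, hu1.symm, hv0.symm,
        hv1.symm, huv]
  rw [hcore] at heq
  have hmap : edges F' ε' = Finset.univ.val.map fun k => (Graph.dEnds m k).map g := by
    rw [map_dEnds, heq]
    rfl
  obtain ⟨ψ, hψ⟩ := exists_equiv_of_edges_eq hmap
  have ginj : Function.Injective g := by
    intro i j hij
    fin_cases i <;> fin_cases j <;> simp_all [hg]
  have hsub : Set.range g ⊆ G'.vertexSet := by
    rintro _ ⟨i, rfl⟩
    rw [hV, ← hS]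
    fin_cases i
    · exact h0
    · exact h1
    · exact hu
    · exact hv
  -- All ends of edges are among the four vertices, so deleting the other vertices loses no edge.
  have hlink : ∀ e a b, (G'.induce (Set.range g)).IsLink e a b ↔ G'.IsLink e a b := by
    intro e a b
    rw [Graph.induce_isLink]
    refine ⟨fun h => h.1, fun h => ⟨h, ?_⟩⟩
    obtain ⟨h2, h3⟩ := (hF'.isLink_iff e a b).1 h
    have h4 := hψ ⟨e, h2⟩
    have h5 : ∀ w, w ∈ ε' e → w ∈ Set.range g := by
      intro w hw
      have h6 : w ∈ (Graph.dEnds m (ψ ⟨e, h2⟩)).map g := by rw [← h4]; exact hw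
      obtain ⟨i, -, hi⟩ := Sym2.mem_map.1 h6
      exact ⟨i, hi⟩
    rw [h3] at h5
    exact ⟨h5 a (by simp), h5 b (by simp)⟩
  have hreps : Reps (G'.induce (Set.range g)) F' ε' :=
    ⟨fun e a b => (hlink e a b).trans (hF'.isLink_iff e a b)⟩
  have hE : ∀ k, k ∈ (Graph.dGraph m).edgeSet := by
    intro k
    rw [Graph.edge_mem_iff_exists_isLink]
    obtain ⟨⟨a, b⟩, hab⟩ := Quot.exists_rep (Graph.dEnds m k)
    exact ⟨a, b, hab.symm⟩
  let φ : (G'.induce (Set.range g)).vertexSet ≃ (Graph.dGraph m).vertexSet :=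
    (Equiv.ofInjective g ginj).symm.trans (Equiv.Set.univ (Fin 4)).symm
  let ψ' : (G'.induce (Set.range g)).edgeSet ≃ (Graph.dGraph m).edgeSet :=
    ((Equiv.subtypeEquivRight fun e => hreps.mem_edgeSet).trans ψ).trans
      (Equiv.subtypeUnivEquiv hE).symm
  have hφg : ∀ i a (ha : a ∈ (G'.induce (Set.range g)).vertexSet), g i = a →
      (φ ⟨a, ha⟩ : Fin 4) = i := by
    rintro i a ha rfl
    change ((Equiv.ofInjective g ginj).symm ⟨g i, ha⟩ : Fin 4) = i
    rw [Equiv.symm_apply_eq]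
    rfl
  refine ⟨G'.induce (Set.range g), hsteps.tail (.delete (Graph.induce_le hsub)), φ, ψ', ?_,
    ⟨⟨0, rfl⟩, hφg 0 _ _ rfl⟩, ⟨⟨1, rfl⟩, hφg 1 _ _ rfl⟩⟩
  rintro ⟨e, he⟩ ⟨a, ha⟩ ⟨b, hb⟩
  have heF := hreps.mem_edgeSet.1 he
  have h2 : (G'.induce (Set.range g)).IsLink e a b ↔
      Graph.dEnds m (ψ ⟨e, heF⟩) = s((φ ⟨a, ha⟩ : Fin 4), (φ ⟨b, hb⟩ : Fin 4)) := by
    obtain ⟨i, hi⟩ : ∃ i, g i = a := id ha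
    obtain ⟨j, hj⟩ : ∃ j, g j = b := id hb
    rw [hφg i a ha hi, hφg j b hb hj, ← hi, ← hj, hreps.isLink_iff]
    simp only [heF, true_and]
    rw [show ε' e = (Graph.dEnds m (ψ ⟨e, heF⟩)).map g from hψ ⟨e, heF⟩, ← Sym2.map_mk]
    exact (Sym2.map.injective ginj).eq_iff
  exact h2

end

/-! ### Cut conditions and type $A_m$ for graphs -/

section

variable {β : Type*} {G : Graph α β} {F : Finset β} {ε : β → Sym2 α} {S : Finset α} {x₀ x₁ : α}
  {m : ℕ}

lemma Reps.rooted (h : Reps G F ε) (hG : G.IsRootedGraph x₀ x₁) (hS : (S : Set α) = G.vertexSet)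
    (hn : 3 ≤ G.lambdaN x₀ x₁) (hni : 4 ≤ G.lambdaNI x₀ x₁) : Rooted S (edges F ε) x₀ x₁ := by
  have hS' : ∀ v, v ∈ S ↔ v ∈ G.vertexSet := fun v => by rw [← hS]; rfl
  refine ⟨fun e he v hv => (hS' v).2 (h.mem_vertexSet he hv), fun e he => h.not_isDiag hG.loopless he,
    (hS' _).2 hG.mem₀, (hS' _).2 hG.mem₁, hG.ne, ?_, ?_⟩
  · intro Y hY h0 h1 hne
    have h2 := le_iInf₂_iff.1 hn Y ⟨⟨by rw [← hS]; exact_mod_cast hY, ?_, ?_⟩, ?_⟩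
    · rw [h.cutSize_eq] at h2
      exact_mod_cast h2
    · rw [Set.one_le_encard_iff_nonempty]
      exact_mod_cast hne
    · rw [Set.one_le_encard_iff_nonempty]
      exact ⟨x₀, hG.mem₀, by simpa using h0⟩
    · simp [Graph.Separates, h0, h1]
  · intro Y hY h0 h1 hc
    have h2 := le_iInf₂_iff.1 hni Y ⟨⟨by rw [← hS]; exact_mod_cast hY, ?_, ?_⟩, ?_⟩
    · rw [h.cutSize_eq] at h2
      exact_mod_cast h2
    · rw [Set.encard_coe_eq_coe_finsetCard]
      exact_mod_cast hc
    · rw [← Set.encard_pair hG.ne]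
      apply Set.encard_le_encard
      rintro v (rfl | rfl)
      · exact ⟨hG.mem₀, by simpa using h0⟩
      · exact ⟨hG.mem₁, by simpa using h1⟩
    · simp [Graph.Separates, h0, h1]

lemma Reps.le_cut (h : Reps G F ε) (hG : G.IsRootedGraph x₀ x₁) (hS : (S : Set α) = G.vertexSet)
    (hs : (m : ℕ∞) ≤ G.lambdaS x₀ x₁) (X : Finset α) (hX : X ⊆ S) (h0 : x₀ ∈ X) (h1 : x₁ ∉ X) :
    m ≤ cut (edges F ε) X := by
  have h2 := le_iInf₂_iff.1 hs X ⟨⟨by rw [← hS]; exact_mod_cast hX, ?_, ?_⟩, ?_⟩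
  · rw [h.cutSize_eq] at h2
    exact_mod_cast h2
  · rw [Set.one_le_encard_iff_nonempty]
    exact ⟨x₀, h0⟩
  · rw [Set.one_le_encard_iff_nonempty]
    exact ⟨x₁, hG.mem₁, by simpa using h1⟩
  · simp [Graph.Separates, h0, h1]

lemma exists_seq_of_reflTransGen {γ : Type*} {r : γ → γ → Prop} {a b : γ} (h : ReflTransGen r a b) :
    ∃ (k : ℕ) (Z : ℕ → γ), Z 0 = a ∧ Z k = b ∧ ∀ i < k, r (Z i) (Z (i + 1)) := by
  induction h with
  | refl => exact ⟨0, fun _ => a, rfl, rfl, by simp⟩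
  | @tail b c _ hbc ih =>
    obtain ⟨k, Z, h0, hk, hZ⟩ := ih
    refine ⟨k + 1, fun i => if i ≤ k then Z i else c, by simpa using h0, by simp, fun i hi => ?_⟩
    rcases (Nat.lt_succ_iff.1 hi).lt_or_eq with h | rfl
    · simp only [h.le, Nat.succ_le_of_lt h, if_true]
      exact hZ i h
    · simp only [le_rfl, if_true, Nat.not_succ_le_self, if_false, hk]
      exact hbc

lemma Reps.typeA_iff (h : Reps G F ε) (hS : (S : Set α) = G.vertexSet) (h1S : x₁ ∈ S) :
    G.IsTypeA x₀ x₁ m ↔ TypeA S (edges F ε) x₀ x₁ m := by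
  have hS' : ∀ v, v ∈ S ↔ v ∈ G.vertexSet := fun v => by rw [← hS]; rfl
  constructor
  · rintro ⟨A, B, hA, hB, h0, h1, k, X, hX, hcut⟩
    have hmono : Monotone X := (Fin.strictMono_iff_lt_succ.2 fun i => hX.ssubset i).monotone
    let Y : Fin (k + 1) → Finset α := fun i => S.filter (· ∈ X i)
    have hY : ∀ i, (Y i : Set α) = X i := by
      intro i
      ext v
      simp only [Y, Finset.coe_filter, Set.mem_ofPred_eq, hS', and_iff_right_iff_imp]
      exact fun hv => hX.subset i hv
    have hY' : ∀ i v, v ∈ Y i ↔ v ∈ X i := fun i v => by rw [← hY]; rfl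
    have htight : ∀ i, Tight S (edges F ε) x₀ x₁ m (Y i) := by
      intro i
      refine ⟨Finset.filter_subset _ _, ?_, ?_, ?_⟩
      · rw [hY']
        exact hmono (Fin.zero_le i) (hX.head_eq ▸ h0)
      · rw [hY']
        intro h2
        rw [← hX.tail_eq] at h1
        exact h1.2 (hmono (Fin.le_last i) h2)
      · rw [hY, ← h.cutSize_eq, hcut]
    refine ⟨Y 0, Y (Fin.last k), htight 0, ?_, ?_, ?_⟩
    · rw [← hX.head_eq, ← hY, Set.encard_coe_eq_coe_finsetCard] at hA
      exact_mod_cast hA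
    · rw [← hX.tail_eq, ← hS, ← hY, ← Finset.coe_sdiff, Set.encard_coe_eq_coe_finsetCard] at hB
      exact_mod_cast hB
    · have : ∀ i, ReflTransGen (TightStep S (edges F ε) x₀ x₁ m) (Y 0) (Y i) := by
        intro i
        induction i using Fin.induction with
        | zero => exact .refl
        | succ i ih =>
          refine ih.tail ?_
          obtain ⟨v, hv⟩ := Set.encard_eq_one.1 (hX.step i)
          have hv' : ∀ w, w ∈ X i.succ ∧ w ∉ X i.castSucc ↔ w = v := fun w => by
            rw [← Set.mem_sdiff, hv]; rfl
          refine ⟨v, ?_, ?_, htight _⟩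
          · rw [hY']
            exact ((hv' v).2 rfl).2
          · ext w
            rw [Finset.mem_insert, hY', hY', ← hv' w]
            have := @(hX.ssubset i).1 w
            tauto
      exact this _
  · rintro ⟨X, Y, hX, hXc, hYc, hXY⟩
    have hY := hX.of_reach hXY
    obtain ⟨k, Z, rfl, rfl, hZ⟩ := exists_seq_of_reflTransGen hXY
    have htight : ∀ i ≤ k, Tight S (edges F ε) x₀ x₁ m (Z i) := by
      intro i hi
      cases i with
      | zero => exact hX
      | succ i => exact (hZ i hi).choose_spec.2.2
    have hsub : ∀ i ≤ k, Z 0 ⊆ Z i := by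
      intro i hi
      induction i with
      | zero => exact subset_rfl
      | succ i ih =>
        obtain ⟨v, -, hv, -⟩ := hZ i hi
        rw [hv]
        exact (ih (by omega)).trans (Finset.subset_insert _ _)
    refine ⟨Z 0, G.vertexSet \ Z k, ?_, ?_, hX.mem, ⟨(hS' _).1 h1S, by simpa using hY.notMem⟩, k,
      fun i => Z i, ⟨?_, ?_, rfl, rfl, ?_, ?_⟩, ?_⟩
    · rw [Set.encard_coe_eq_coe_finsetCard]
      exact_mod_cast hXc
    · rw [← hS, ← Finset.coe_sdiff, Set.encard_coe_eq_coe_finsetCard]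
      exact_mod_cast hYc
    · intro i
      rw [← hS]
      exact_mod_cast (htight i (by omega)).subset
    · rw [Set.disjoint_left]
      intro v hv hv'
      exact hv'.2 (hsub k le_rfl hv)
    · intro i
      obtain ⟨v, hv, hv', -⟩ := hZ i i.2
      simp only [Fin.val_castSucc, Fin.val_succ, hv']
      exact_mod_cast Finset.ssubset_insert hv
    · intro i
      obtain ⟨v, hv, hv', -⟩ := hZ i i.2
      simp only [Fin.val_castSucc, Fin.val_succ, hv']
      rw [Set.encard_eq_one]
      refine ⟨v, ?_⟩
      ext w
      simp only [Finset.coe_insert, Set.mem_sdiff, Set.mem_insert_iff, Finset.mem_coe,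
        Set.mem_singleton_iff]
      constructor
      · tauto
      · rintro rfl
        exact ⟨Or.inl rfl, hv⟩
    · intro i
      rw [h.cutSize_eq]
      exact (htight i (by omega)).cut_eq

end

section

variable {β : Type*} {G : Graph α β} {F : Finset β} {ε : β → Sym2 α} {S : Finset α} {x₀ x₁ : α}
  {m : ℕ}

/-! ### Lobes -/

lemma Reps.deleteVerts_adj (h : Reps G F ε) {X : Set α} {u v : α} :
    (G.deleteVerts X).Adj u v ↔ s(u, v) ∈ edges F ε ∧ u ∉ X ∧ v ∉ X := by
  simp only [Graph.Adj, Graph.deleteVerts_isLink, h.isLink_iff, edges, Multiset.mem_map,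
    Finset.mem_val]
  constructor
  · rintro ⟨e, ⟨h1, h2⟩, h3, h4⟩
    exact ⟨⟨e, h1, h2⟩, h3, h4⟩
  · rintro ⟨⟨e, h1, h2⟩, h3, h4⟩
    exact ⟨e, ⟨h1, h2⟩, h3, h4⟩

lemma reaches_symm {G : Graph α β} {u v : α} (h : G.Reaches u v) : G.Reaches v u := by
  induction h with
  | refl => exact .refl
  | tail _ hbc ih => exact ReflTransGen.head hbc.symm ih

lemma isComponent_eq {G : Graph α β} {K : Set α} (hK : G.IsComponent K) {u : α} (hu : u ∈ K) :
    K = {w | G.Reaches u w} := by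
  obtain ⟨v, -, rfl⟩ := hK
  ext w
  exact ⟨fun hw => (reaches_symm hu).trans hw, fun hw => ReflTransGen.trans hu hw⟩

lemma isComponent_nonempty {G : Graph α β} {K : Set α} (hK : G.IsComponent K) : K.Nonempty := by
  obtain ⟨v, -, rfl⟩ := hK
  exact ⟨v, .refl⟩

lemma isComponent_subset {G : Graph α β} {K : Set α} (hK : G.IsComponent K) :
    K ⊆ G.vertexSet := by
  obtain ⟨v, hv, rfl⟩ := hK
  intro w hw
  induction hw with
  | refl => exact hv
  | tail _ hbc _ => exact hbc.right_mem

lemma isComponent_closed {G : Graph α β} {K : Set α} (hK : G.IsComponent K) {u w : α}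
    (hu : u ∈ K) (huw : G.Adj u w) : w ∈ K := by
  obtain ⟨v, hv, rfl⟩ := hK
  exact ReflTransGen.tail hu huw

lemma isComponent_subset_of_closed {G : Graph α β} {K Q : Set α} (hK : G.IsComponent K) {u : α}
    (hu : u ∈ K) (huQ : u ∈ Q) (hQ : ∀ a b, a ∈ Q → G.Adj a b → b ∈ Q) : K ⊆ Q := by
  rw [isComponent_eq hK hu]
  intro w hw
  induction hw with
  | refl => exact huQ
  | tail _ hbc ih => exact hQ _ _ ih hbc

lemma sum_btw_eq {M : Multiset (Sym2 α)} {r : α} (T : Finset (Set α))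
    (hT : ∀ A ∈ T, ∀ B ∈ T, A ≠ B → Disjoint A B) (hr : ∀ A ∈ T, r ∉ A) :
    ∑ A ∈ T, btw M {r} A = btw M {r} (⋃ A ∈ T, A) := by
  induction T using Finset.induction_on with
  | empty => simp [(btw_eq_zero (M := M) (A := {r}) (B := ∅)).2 (by simp)]
  | insert A T hA ih =>
    rw [Finset.sum_insert hA, Finset.set_biUnion_insert, btw_union, ih]
    · exact fun B hB C hC => hT B (Finset.mem_insert_of_mem hB) C (Finset.mem_insert_of_mem hC)
    · exact fun B hB => hr B (Finset.mem_insert_of_mem hB)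
    · rw [Set.disjoint_iUnion₂_right]
      intro B hB
      exact hT A (Finset.mem_insert_self _ _) B (Finset.mem_insert_of_mem hB)
        (by rintro rfl; exact hA hB)
    · simpa using hr A (Finset.mem_insert_self _ _)
    · simp only [Set.disjoint_singleton_left, Set.mem_iUnion, not_exists]
      exact fun B hB => hr B (Finset.mem_insert_of_mem hB)

/-- Each edge at $x_0$ leads to $x_1$ or into exactly one component. The set `X` is kept abstract so
that the lemma also applies with the roots exchanged, without changing the deleted set
syntactically. -/
lemma Reps.cut_root (h : Reps G F ε) (hS : (S : Set α) = G.vertexSet)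
    (hR : Rooted S (edges F ε) x₀ x₁) {X : Set α} (hX : X = {x₀, x₁}) :
    cut (edges F ε) {x₀} = G.edgeMult x₀ x₁ +
      ∑ᶠ (C : Set α) (_ : (G.deleteVerts X).IsComponent C), btw (edges F ε) {x₀} C := by
  have hS' : ∀ v, v ∈ S ↔ v ∈ G.vertexSet := fun v => by rw [← hS]; rfl
  have hsub : ∀ K, (G.deleteVerts X).IsComponent K → ∀ v ∈ K, v ∈ S ∧ v ≠ x₀ ∧ v ≠ x₁ := by
    intro K hK v hv
    have := isComponent_subset hK hv
    rw [Graph.vertexSet_deleteVerts, ← hS, hX] at this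
    simpa using this
  have hfin : {K | (G.deleteVerts X).IsComponent K}.Finite := by
    apply S.finite_toSet.finite_subsets.subset
    intro K hK v hv
    exact (hsub K hK v hv).1
  have h1 := finsum_mem_eq_finite_toFinset_sum (fun C => btw (edges F ε) {x₀} C) hfin
  have h2 : ∑ᶠ (C : Set α) (_ : (G.deleteVerts X).IsComponent C), btw (edges F ε) {x₀} C =
    ∑ C ∈ hfin.toFinset, btw (edges F ε) {x₀} C := h1
  have hU : (⋃ A ∈ hfin.toFinset, A) = {v | v ∈ S ∧ v ≠ x₀ ∧ v ≠ x₁} := by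
    ext v
    simp only [Set.Finite.mem_toFinset, Set.mem_ofPred_eq, Set.mem_iUnion, exists_prop]
    constructor
    · rintro ⟨K, hK, hv⟩
      exact hsub K hK v hv
    · rintro ⟨hv, h0, h1⟩
      refine ⟨_, ⟨v, ?_, rfl⟩, .refl⟩
      rw [Graph.vertexSet_deleteVerts, ← hS, hX]
      simp [hv, h0, h1]
  rw [h2, sum_btw_eq, hU, h.edgeMult_eq, ← btw_singleton, ← btw_union]
  · apply cut_eq_btw
    · simp [hR.ne]
    · intro e he v hv
      have := hR.mem e he v hv
      simp only [Set.mem_union, Set.mem_singleton_iff, Set.mem_ofPred_eq]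
      tauto
  · simp
  · simp [hR.ne]
  · simp
  · intro A hA B hB hne
    rw [Set.disjoint_left]
    intro v hvA hvB
    simp only [Set.Finite.mem_toFinset, Set.mem_ofPred_eq] at hA hB
    exact hne ((isComponent_eq hA hvA).trans (isComponent_eq hB hvB).symm)
  · intro A hA h0
    simp only [Set.Finite.mem_toFinset, Set.mem_ofPred_eq] at hA
    exact (hsub A hA _ h0).2.1 rfl

lemma Reps.lobe_edgeMult (h : Reps G F ε) {C : Set α} {u v : α} (hu : u ∈ C ∪ {x₀, x₁})
    (hv : v ∈ C ∪ {x₀, x₁}) : (G.lobe x₀ x₁ C).edgeMult u v =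
      if s(u, v) = s(x₀, x₁) then 0 else (edges F ε).count s(u, v) := by
  rw [← h.edgeMult_eq, Graph.edgeMult]
  split_ifs with huv
  · rw [show (G.lobe x₀ x₁ C).edgesBetween u v = ∅ from ?_, Set.ncard_empty]
    ext e
    simp only [Graph.lobe, Graph.edgesBetween, Graph.deleteEdges_isLink, Set.mem_ofPred_eq,
      Graph.induce_isLink, h.isLink_iff, huv]
    simp only [Set.mem_empty_iff_false, iff_false]
    tauto
  · congr 1
    ext e
    simp only [Graph.lobe, Graph.edgesBetween, Graph.deleteEdges_isLink, Set.mem_ofPred_eq,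
      Graph.induce_isLink, h.isLink_iff]
    constructor
    · rintro ⟨⟨h1, -⟩, -⟩
      exact h1
    · rintro ⟨h1, h2⟩
      exact ⟨⟨⟨h1, h2⟩, hu, hv⟩, fun h3 => huv (h2.symm.trans h3.2)⟩

lemma lobe_vertexSet (C : Set α) : (G.lobe x₀ x₁ C).vertexSet = C ∪ {x₀, x₁} := rfl

end

section

variable {β : Type*} {G : Graph α β} {F : Finset β} {ε : β → Sym2 α} {S : Finset α} {x₀ x₁ : α}
  {m : ℕ}

lemma IsLobe.btw₀ {M : Multiset (Sym2 α)} {l n : ℕ} {p : ℕ → α} (h : IsLobe S M x₀ x₁ l n p)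
    {K : Set α} (hK : ∀ v, v ∈ K ↔ ∃ i, 0 < i ∧ i < l ∧ p i = v) : btw M {x₀} K = n := by
  have hl := h.two_le_length
  rw [btw_eq_count (t := p 1) ((hK _).2 ⟨1, by omega, by omega, rfl⟩), ← h.zero,
    h.count 0 1 (by omega) (by omega) (by omega)]
  · simp
  · intro z hz hne
    obtain ⟨i, h1, h2, rfl⟩ := (hK z).1 hz
    rw [← h.zero, ← Multiset.count_eq_zero, h.count 0 i h1 h2.le (by omega), if_neg]
    rintro rfl
    exact hne rfl

lemma IsLobe.btw₁ {M : Multiset (Sym2 α)} {l n : ℕ} {p : ℕ → α} (h : IsLobe S M x₀ x₁ l n p)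
    {K : Set α} (hK : ∀ v, v ∈ K ↔ ∃ i, 0 < i ∧ i < l ∧ p i = v) : btw M {x₁} K = n := by
  have hl := h.two_le_length
  rw [btw_eq_count (t := p (l - 1)) ((hK _).2 ⟨l - 1, by omega, by omega, rfl⟩), ← h.last,
    Sym2.eq_swap, h.count (l - 1) l (by omega) (by omega) (by omega), if_pos (by omega)]
  intro z hz hne
  obtain ⟨i, h1, h2, rfl⟩ := (hK z).1 hz
  rw [← h.last, Sym2.eq_swap, ← Multiset.count_eq_zero, h.count i l h2 le_rfl (by omega), if_neg]
  intro hi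
  exact hne (by congr 1; omega)

/-- The inner vertices of a lobe are closed under adjacency off the roots, and consecutive ones are
adjacent, so they form a whole component. -/
lemma Reps.component_iff (h : Reps G F ε) {K : Set α} {l n : ℕ} {p : ℕ → α}
    (hp : IsLobe S (edges F ε) x₀ x₁ l n p) (hK : (G.deleteVerts {x₀, x₁}).IsComponent K) {j : ℕ}
    (hj0 : 0 < j) (hjl : j < l) (hj : p j ∈ K) (v : α) :
    v ∈ K ↔ ∃ i, 0 < i ∧ i < l ∧ p i = v := by
  have hne : ∀ i, 0 < i → i < l → p i ∉ ({x₀, x₁} : Set α) := by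
    rintro i h0 h1 (hi | hi)
    · rw [← hp.zero] at hi
      exact h0.ne' (hp.inj _ _ h1.le (by omega) hi)
    · rw [Set.mem_singleton_iff, ← hp.last] at hi
      exact h1.ne (hp.inj _ _ h1.le le_rfl hi)
  have hadj : ∀ i, 0 < i → i + 1 < l → (G.deleteVerts {x₀, x₁}).Adj (p i) (p (i + 1)) := by
    intro i h0 h1
    rw [h.deleteVerts_adj]
    refine ⟨?_, hne i h0 (by omega), hne (i + 1) (by omega) h1⟩
    rw [← Multiset.count_pos, hp.count i (i + 1) (by omega) (by omega) (by omega), if_pos rfl]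
    have := hp.two_le
    omega
  constructor
  · intro hv
    refine isComponent_subset_of_closed (Q := {v | ∃ i, 0 < i ∧ i < l ∧ p i = v}) hK hj
      ⟨j, hj0, hjl, rfl⟩ ?_ hv
    rintro a b ⟨i, h0, h1, rfl⟩ hab
    rw [h.deleteVerts_adj] at hab
    obtain ⟨k, hk, rfl⟩ := hp.closed i h0 h1 b hab.1
    refine ⟨k, Nat.pos_of_ne_zero ?_, lt_of_le_of_ne hk ?_, rfl⟩
    · rintro rfl
      exact hab.2.2 (Or.inl hp.zero)
    · rintro rfl
      exact hab.2.2 (Or.inr hp.last)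
  · have hup : ∀ d, j + d < l → p (j + d) ∈ K := by
      intro d hd
      induction d with
      | zero => exact hj
      | succ d ih => exact isComponent_closed hK (ih (by omega)) (hadj _ (by omega) hd)
    have hdown : ∀ d, d < j → p (j - d) ∈ K := by
      intro d hd
      induction d with
      | zero => exact hj
      | succ d ih =>
        refine isComponent_closed hK (ih (by omega)) ?_
        have := hadj (j - (d + 1)) (by omega) (by omega)
        rw [show j - (d + 1) + 1 = j - d by omega] at this
        exact this.symm
    rintro ⟨i, h0, h1, rfl⟩
    rcases le_total j i with hij | hij
    · have := hup (i - j) (by omega)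
      rwa [show j + (i - j) = i by omega] at this
    · have := hdown (j - i) (by omega)
      rwa [show j - (j - i) = i by omega] at this

lemma IsLobe.mem_union_iff {M : Multiset (Sym2 α)} {l n : ℕ} {p : ℕ → α}
    (h : IsLobe S M x₀ x₁ l n p) {K : Set α} (hK : ∀ v, v ∈ K ↔ ∃ i, 0 < i ∧ i < l ∧ p i = v)
    (v : α) : v ∈ K ∪ {x₀, x₁} ↔ ∃ i, i ≤ l ∧ p i = v := by
  rw [Set.mem_union, hK]
  constructor
  · rintro (⟨i, h1, h2, rfl⟩ | rfl | rfl)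
    · exact ⟨i, h2.le, rfl⟩
    · exact ⟨0, by omega, h.zero⟩
    · exact ⟨l, le_rfl, h.last⟩
  · rintro ⟨i, hi, rfl⟩
    rcases Nat.eq_zero_or_pos i with rfl | h0
    · exact Or.inr (Or.inl h.zero)
    rcases hi.lt_or_eq with h1 | rfl
    · exact Or.inl ⟨i, h0, h1, rfl⟩
    · exact Or.inr (Or.inr h.last)

lemma IsLobe.encard {M : Multiset (Sym2 α)} {l n : ℕ} {p : ℕ → α}
    (h : IsLobe S M x₀ x₁ l n p) {K : Set α} (hK : ∀ v, v ∈ K ↔ ∃ i, 0 < i ∧ i < l ∧ p i = v) :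
    (K ∪ {x₀, x₁}).encard = l + 1 := by
  have : K ∪ {x₀, x₁} = p '' (Finset.range (l + 1) : Set ℕ) := by
    ext v
    rw [h.mem_union_iff hK]
    simp [Nat.lt_succ_iff]
  rw [this, Set.InjOn.encard_image, Set.encard_coe_eq_coe_finsetCard]
  · simp
  · intro i hi j hj hij
    simp only [Finset.coe_range, Set.mem_Iio, Nat.lt_succ_iff] at hi hj
    exact h.inj i j hi hj hij

lemma Reps.isMultipliedPath (h : Reps G F ε) (hR : Rooted S (edges F ε) x₀ x₁) {K : Set α}
    {l n : ℕ} {p : ℕ → α} (hp : IsLobe S (edges F ε) x₀ x₁ l n p)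
    (hK : ∀ v, v ∈ K ↔ ∃ i, 0 < i ∧ i < l ∧ p i = v) :
    (G.lobe x₀ x₁ K).IsMultipliedPath x₀ x₁ n := by
  have hl := hp.two_le_length
  have hinj : Function.Injective fun i : Fin (l + 1) => p i := by
    intro i j hij
    exact Fin.ext (hp.inj i j (by omega) (by omega) hij)
  refine ⟨l, fun i => p i, hinj, hp.zero, by simpa using hp.last, ?_, ?_⟩
  · ext v
    rw [lobe_vertexSet, hp.mem_union_iff hK]
    constructor
    · rintro ⟨i, rfl⟩
      exact ⟨i, by omega, rfl⟩
    · rintro ⟨i, hi, rfl⟩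
      exact ⟨⟨i, by omega⟩, rfl⟩
  · have key : ∀ i j : Fin (l + 1), (i : ℕ) < j → (G.lobe x₀ x₁ K).edgeMult (p i) (p j) =
        if (i : ℕ) + 1 = j ∨ (j : ℕ) + 1 = i then n else 0 := by
      intro i j hij
      rw [h.lobe_edgeMult ((hp.mem_union_iff hK _).2 ⟨i, by omega, rfl⟩)
        ((hp.mem_union_iff hK _).2 ⟨j, by omega, rfl⟩)]
      by_cases h1 : (i : ℕ) = 0 ∧ (j : ℕ) = l
      · rw [h1.1, h1.2, hp.zero, hp.last, if_pos rfl, if_neg (by omega)]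
      · rw [if_neg, hp.count i j hij (by omega) h1]
        · congr 1
          rw [eq_iff_iff]
          omega
        · rw [← hp.zero, ← hp.last, Sym2.eq_iff]
          rintro (⟨h2, h3⟩ | ⟨h2, h3⟩)
          · have := hp.inj _ _ (by omega) (by omega) h2
            have := hp.inj _ _ (by omega) (by omega) h3
            omega
          · have := hp.inj _ _ (by omega) (by omega) h2
            have := hp.inj _ _ (by omega) (by omega) h3
            omega
    intro i j
    rcases lt_trichotomy (i : ℕ) j with hij | hij | hij
    · exact key i j hij
    · rw [← Fin.ext hij, if_neg (by omega),
        h.lobe_edgeMult ((hp.mem_union_iff hK _).2 ⟨i, by omega, rfl⟩)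
        ((hp.mem_union_iff hK _).2 ⟨i, by omega, rfl⟩), Multiset.count_eq_zero.2, ite_self]
      exact fun h1 => hR.loopless _ h1 rfl
    · have h1 := key j i hij
      rw [h.lobe_edgeMult ((hp.mem_union_iff hK _).2 ⟨j, by omega, rfl⟩)
        ((hp.mem_union_iff hK _).2 ⟨i, by omega, rfl⟩), Sym2.eq_swap] at h1
      rw [h.lobe_edgeMult ((hp.mem_union_iff hK _).2 ⟨i, by omega, rfl⟩)
        ((hp.mem_union_iff hK _).2 ⟨j, by omega, rfl⟩), h1]
      simp only [or_comm]

lemma Reps.exists_isLobe (h : Reps G F ε) (hS : (S : Set α) = G.vertexSet)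
    (hR : Rooted S (edges F ε) x₀ x₁) {K : Set α} {n : ℕ}
    (hK : (G.deleteVerts {x₀, x₁}).IsComponent K) (hn : 2 ≤ n)
    (hp : (G.lobe x₀ x₁ K).IsMultipliedPath x₀ x₁ n)
    (h2 : 4 ≤ (G.lobe x₀ x₁ K).vertexSet.encard → n = 2) :
    ∃ l p, IsLobe S (edges F ε) x₀ x₁ l n p ∧
      ∀ v, v ∈ K ↔ ∃ i, 0 < i ∧ i < l ∧ p i = v := by
  obtain ⟨l, q, hinj, h0, h1, hrange, hq⟩ := hp
  have hKS : ∀ v ∈ K, v ∈ S ∧ v ∉ ({x₀, x₁} : Set α) := by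
    intro v hv
    have := isComponent_subset hK hv
    rwa [Graph.vertexSet_deleteVerts, ← hS] at this
  rw [lobe_vertexSet] at hrange h2
  -- The value beyond $l$ is irrelevant, as `IsLobe` only refers to indices up to $l$.
  let p : ℕ → α := fun i => if hi : i < l + 1 then q ⟨i, hi⟩ else x₀
  have hpq : ∀ i : Fin (l + 1), p i = q i := fun i => dif_pos i.2
  have hpi : ∀ i (hi : i ≤ l), p i = q ⟨i, by omega⟩ := fun i hi => hpq ⟨i, by omega⟩
  have hp0 : p 0 = x₀ := by rw [← h0]; exact hpq 0
  have hpl : p l = x₁ := by rw [← h1]; exact hpq (Fin.last l)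
  have hpinj : ∀ i j, i ≤ l → j ≤ l → p i = p j → i = j := by
    intro i j hi hj hij
    rw [hpi i hi, hpi j hj] at hij
    simpa using hinj hij
  have hmemU : ∀ v, v ∈ K ∪ {x₀, x₁} ↔ ∃ i, i ≤ l ∧ p i = v := by
    intro v
    rw [← hrange]
    constructor
    · rintro ⟨i, rfl⟩
      exact ⟨i, by omega, hpq i⟩
    · rintro ⟨i, hi, rfl⟩
      exact ⟨⟨i, by omega⟩, (hpi i hi).symm⟩
  have hmem : ∀ v, v ∈ K ↔ ∃ i, 0 < i ∧ i < l ∧ p i = v := by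
    intro v
    constructor
    · intro hv
      obtain ⟨i, hi, rfl⟩ := (hmemU v).1 (Or.inl hv)
      refine ⟨i, Nat.pos_of_ne_zero ?_, lt_of_le_of_ne hi ?_, rfl⟩
      · rintro rfl
        exact (hKS _ hv).2 (Or.inl hp0)
      · rintro rfl
        exact (hKS _ hv).2 (Or.inr hpl)
    · rintro ⟨i, hi0, hil, rfl⟩
      rcases (hmemU (p i)).2 ⟨i, hil.le, rfl⟩ with h3 | h3 | h3
      · exact h3
      · rw [← hp0] at h3
        exact absurd (hpinj _ _ hil.le (by omega) h3) hi0.ne'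
      · rw [Set.mem_singleton_iff, ← hpl] at h3
        exact absurd (hpinj _ _ hil.le le_rfl h3) hil.ne
  have hl : 2 ≤ l := by
    obtain ⟨v, hv⟩ := isComponent_nonempty hK
    obtain ⟨i, hi0, hil, -⟩ := (hmem v).1 hv
    omega
  have hlobe : IsLobe S (edges F ε) x₀ x₁ l n p := by
    refine ⟨hl, hp0, hpl, hpinj, ?_, ?_, ?_, hn, ?_⟩
    · intro i hi
      rcases (hmemU (p i)).2 ⟨i, hi, rfl⟩ with h3 | h3 | h3
      · exact (hKS _ h3).1
      · rw [h3]
        exact hR.mem₀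
      · rw [Set.mem_singleton_iff.1 h3]
        exact hR.mem₁
    · intro i hi0 hil z hz
      rw [← hmemU]
      by_cases hzx : z ∈ ({x₀, x₁} : Set α)
      · exact Or.inr hzx
      have hiK := (hmem (p i)).2 ⟨i, hi0, hil, rfl⟩
      exact Or.inl (isComponent_closed hK hiK (h.deleteVerts_adj.2 ⟨hz, (hKS _ hiK).2, hzx⟩))
    · intro i j hij hj hne
      have h3 := hq ⟨i, by omega⟩ ⟨j, by omega⟩
      rw [← hpi i (by omega), ← hpi j hj, h.lobe_edgeMult ((hmemU _).2 ⟨i, by omega, rfl⟩)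
        ((hmemU _).2 ⟨j, hj, rfl⟩), if_neg] at h3
      · rw [h3]
        congr 1
        simp only [eq_iff_iff]
        omega
      · rw [← hp0, ← hpl, Sym2.eq_iff]
        rintro (⟨h4, h5⟩ | ⟨h4, h5⟩)
        · have := hpinj _ _ (by omega) (by omega) h4
          have := hpinj _ _ (by omega) (by omega) h5
          omega
        · have := hpinj _ _ (by omega) (by omega) h4
          have := hpinj _ _ (by omega) (by omega) h5
          omega
    · intro hl3
      apply h2
      rw [← hrange, ← Set.image_univ, hinj.encard_image, Set.encard_univ]
      simp only [ENat.card_eq_coe_fintype_card, Fintype.card_fin]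
      exact_mod_cast (by omega : 4 ≤ l + 1)
  exact ⟨l, p, hlobe, hmem⟩

lemma Reps.typeB_iff (h : Reps G F ε) (hS : (S : Set α) = G.vertexSet)
    (hR : Rooted S (edges F ε) x₀ x₁) : G.IsTypeB x₀ x₁ m ↔ TypeB S (edges F ε) x₀ x₁ m := by
  have hcut₀ := h.cut_root hS hR (X := {x₀, x₁}) rfl
  have hcut₁ := h.cut_root hS hR.symm (X := {x₀, x₁}) (Set.pair_comm _ _)
  rw [h.edgeMult_eq, Sym2.eq_swap, ← h.edgeMult_eq] at hcut₁
  constructor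
  · rintro ⟨n, hn, hsum⟩
    have hlobe := fun K hK => h.exists_isLobe hS hR (n := n K) hK (hn K hK).1 (hn K hK).2.1
      (hn K hK).2.2
    refine ⟨?_, ?_, ?_⟩
    · intro v hv hv0 hv1
      obtain ⟨l, p, hp, hK⟩ := hlobe _ ⟨v, by
        rw [Graph.vertexSet_deleteVerts, ← hS]
        simp [hv, hv0, hv1], rfl⟩
      exact ⟨l, _, p, hp, (hK v).1 .refl⟩
    · rw [hcut₀, ← hsum]
      congr 1
      refine finsum_congr fun K => finsum_congr fun hK => ?_
      obtain ⟨l, p, hp, hpK⟩ := hlobe K hK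
      exact hp.btw₀ hpK
    · rw [hcut₁, ← hsum]
      congr 1
      refine finsum_congr fun K => finsum_congr fun hK => ?_
      obtain ⟨l, p, hp, hpK⟩ := hlobe K hK
      exact hp.btw₁ hpK
  · intro hB
    -- The multiplicity of a lobe is recovered as the number of edges from $x_0$ into its component.
    refine ⟨fun K => btw (edges F ε) {x₀} K, fun K hK => ?_, by rw [← hcut₀, hB.cut₀]⟩
    obtain ⟨v, hv⟩ := isComponent_nonempty hK
    have hvS := isComponent_subset hK hv
    rw [Graph.vertexSet_deleteVerts, ← hS] at hvS
    obtain ⟨l, n, p, hp, i, hi0, hil, rfl⟩ := hB.lobe v hvS.1 (fun h => hvS.2 (Or.inl h))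
      (fun h => hvS.2 (Or.inr h))
    have hpK := h.component_iff hp hK hi0 hil hv
    simp only [hp.btw₀ hpK]
    refine ⟨hp.two_le, h.isMultipliedPath hR hp hpK, fun h4 => hp.eq_two ?_⟩
    rw [lobe_vertexSet, hp.encard hpK] at h4
    have : 4 ≤ l + 1 := by exact_mod_cast h4
    omega

end

end EdgeMultiset

theorem mainTheorem3 {α : Type*} {β : Type*} (m : ℕ) (hm : 2 ≤ m)
    (G : Graph α β) (x₀ x₁ : α) (hG : G.IsRootedGraph x₀ x₁)
    (hcard : 4 ≤ G.vertexSet.encard)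
    (hn : 3 ≤ G.lambdaN x₀ x₁) (hni : 4 ≤ G.lambdaNI x₀ x₁)
    (hs : (m : ℕ∞) ≤ G.lambdaS x₀ x₁) :
    ¬ G.HasRootedImmersion x₀ x₁ (Graph.dGraph m) 0 1 ↔
      (G.IsTypeA x₀ x₁ m ∨ G.IsTypeB x₀ x₁ m) := by
  have : Nonempty α := ⟨x₀⟩
  obtain ⟨F, ε, h⟩ := EdgeMultiset.exists_reps hG.finite_edgeSet
  obtain ⟨S, hS⟩ := hG.finite_vertexSet.exists_finset_coe
  have hS' : ∀ v, v ∈ S ↔ v ∈ G.vertexSet := fun v => by rw [← hS]; rfl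
  have hR := h.rooted hG hS hn hni
  have hS4 : 4 ≤ S.card := by
    rw [← hS, Set.encard_coe_eq_coe_finsetCard] at hcard
    exact_mod_cast hcard
  have hD : G.HasRootedImmersion x₀ x₁ (Graph.dGraph m) 0 1 ↔
      EdgeMultiset.HasD m (EdgeMultiset.edges F ε) x₀ x₁ :=
    ⟨EdgeMultiset.hasD_of_hasRootedImmersion h,
      EdgeMultiset.hasRootedImmersion_of_hasD h hG.loopless hS' hR.mem₀ hR.mem₁ hR.ne⟩
  rw [hD, h.typeA_iff hS hR.mem₁, h.typeB_iff hS hR]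
  exact EdgeMultiset.not_hasD_iff hR hm hS4 fun X hX h0 h1 => h.le_cut hG hS hs X hX h0 h1
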